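/- Let $V$ be a complex manifold (Hausdorff, second countable) of dimension $n\ge 2$, and let $1\le p\le n-1$. Let $T$ be a positive plurisuperharmonic current of bidimension $(p,p)$ on $V$, that is, $T$ is a continuous linear form on the space of smooth compactly supported $(p,p)$-forms, $T$ is positive, and $-\mathrm{dd}^{\mathrm c}T$ is positive (an $(r,r)$-bidimensional current is positive if it takes nonnegative values on the test forms which are, at every point, nonnegative combinations of forms $i\alpha_1\wedge\overline{\alpha_1}\wedge\dots\wedge i\alpha_r\wedge\overline{\alpha_r}$ with $\alpha_j$ of type $(1,0)$). Then $X:=\mathrm{supp}(T)$ is (locally) $p$-pseudoconcave in $V$: it is a closed subset of $V$, and $X\cap W$ is $p$-pseudoconcave in $W$ for every open set $W\subset V$ which admits a holomorphic immersion into some $\mathbb{C}^N$ (for instance, every coordinate domain $W$; every open $W\subset V$, including $W=V$, if $V$ is Stein). Here $X\cap W$ is $p$-pseudoconcave in $W$ if for every open set $U$ whose closure $\overline U$ in $V$ is compact and contained in $W$, and every holomorphic map $f$ from a neighbourhood of $\overline U$ in $W$ into $\mathbb{C}^p$, one has $f(X\cap U)\subset\mathbb{C}^p\setminus\Omega$,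 where $\Omega$ is the unbounded connected component of $\mathbb{C}^p\setminus f(X\cap \partial U)$. -/

import Mathlib

open scoped Manifold ContDiff Topology

noncomputable section

namespace ComplexCurrents

universe u v

variable {E : Type u} [NormedAddCommGroup E] [NormedSpace ℂ E]
variable {V : Type v} [TopologicalSpace V] [ChartedSpace E V]

/-! ### Differential forms

`V` is a complex manifold modelled on the complex vector space `E`.  A complex-valued differential
form of degree `k` on `V` is a function `φ : V → E [⋀^Fin k]→L[ℝ] ℂ`, where `φ x` is an
`ℝ`-multilinear alternating form on the tangent space `TangentSpace 𝓘(ℝ, E) x` (which is `E` by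
definition in Mathlib; the identification is the one given by the preferred chart at `x`). -/

/-- The real differential of the parametrisation `c.symm` at `y`, as a map from `E` to the tangent
space of `V` at `c.symm y`. -/
def dparam (c : OpenPartialHomeomorph V E) (y : E) : E →L[ℝ] E :=
  mfderiv 𝓘(ℝ, E) 𝓘(ℝ, E) c.symm y

/-- The real differential of the chart `c` at `x`, as a map from the tangent space of `V` at `x`
to `E`. -/
def dchart (c : OpenPartialHomeomorph V E) (x : V) : E →L[ℝ] E :=
  mfderiv 𝓘(ℝ, E) 𝓘(ℝ, E) c x

/-- The expression of a form in a chart `c`: its pullback by `c.symm`. -/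
def inChart {k : ℕ} (c : OpenPartialHomeomorph V E) (φ : V → E [⋀^Fin k]→L[ℝ] ℂ) (y : E) :
    E [⋀^Fin k]→L[ℝ] ℂ :=
  (φ (c.symm y)).compContinuousLinearMap (dparam c y)

/-- A form is smooth if its expressions in all the charts of the atlas are `C^∞`. -/
def IsSmoothForm {k : ℕ} (φ : V → E [⋀^Fin k]→L[ℝ] ℂ) : Prop :=
  ∀ c ∈ atlas E V, ContDiffOn ℝ ∞ (inChart c φ) c.target

/-- The exterior derivative `dφ`, computed at `x` in the preferred chart at `x`. -/
def extD {k : ℕ} (φ : V → E [⋀^Fin k]→L[ℝ] ℂ) (x : V) : E [⋀^Fin (k + 1)]→L[ℝ] ℂ :=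
  (extDeriv (inChart (chartAt E x) φ) (chartAt E x x)).compContinuousLinearMap
    (dchart (chartAt E x) x)

/-- Multiplication of tangent vectors by the complex number `u`. -/
def mulVec (E : Type u) [NormedAddCommGroup E] [NormedSpace ℂ E] (u : ℂ) : E →L[ℝ] E :=
  (u • ContinuousLinearMap.id ℂ E).restrictScalars ℝ

/-- The form `φ(u v₁, …, u v_k)`. For `u = I` this is the action of the complex structure. -/
def rot {X : Type*} {k : ℕ} (u : ℂ) (φ : X → E [⋀^Fin k]→L[ℝ] ℂ) (x : X) :
    E [⋀^Fin k]→L[ℝ] ℂ :=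
  (φ x).compContinuousLinearMap (mulVec E u)

/-- `dᶜ = J⁻¹ d J`, that is `dᶜ = i (∂̄ - ∂)`. -/
def extDc {k : ℕ} (φ : V → E [⋀^Fin k]→L[ℝ] ℂ) : V → E [⋀^Fin (k + 1)]→L[ℝ] ℂ :=
  rot (-Complex.I) (extD (rot Complex.I φ))

/-- `ddᶜ = d ∘ dᶜ`, that is `ddᶜ = 2 i ∂ ∂̄`. -/
def ddc {k : ℕ} (φ : V → E [⋀^Fin k]→L[ℝ] ℂ) : V → E [⋀^Fin (k + 2)]→L[ℝ] ℂ :=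
  extD (extDc φ)

/-- An alternating form has bidegree `(p, q)` (its degree `k` being `p + q`) if multiplication of
all the vectors by `z` multiplies it by `z ^ p * conj z ^ q`. -/
def HasBidegree {k : ℕ} (p q : ℕ) (α : E [⋀^Fin k]→L[ℝ] ℂ) : Prop :=
  ∀ (z : ℂ) (v : Fin k → E), α (fun j => z • v j) = z ^ p * (starRingEnd ℂ z) ^ q * α v

/-! ### Calculus facts needed for `ddᶜ` to act on test forms -/

section Flat

variable {k : ℕ}

theorem mulVec_apply (u : ℂ) (v : E) : mulVec E u v = u • v := rfl

theorem rot_apply {X : Type*} (u : ℂ) (φ : X → E [⋀^Fin k]→L[ℝ] ℂ) (x : X) (v : Fin k → E) :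
    rot u φ x v = φ x (fun j => u • v j) := rfl

theorem rot_rot {X : Type*} (u w : ℂ) (φ : X → E [⋀^Fin k]→L[ℝ] ℂ) :
    rot u (rot w φ) = rot (u * w) φ := by
  funext x; ext v
  simp only [rot_apply, smul_smul, mul_comm w u]

theorem rot_one {X : Type*} (φ : X → E [⋀^Fin k]→L[ℝ] ℂ) : rot 1 φ = φ := by
  funext x; ext v
  simp [rot_apply]

theorem rot_contDiffOn (u : ℂ) {f : E → E [⋀^Fin k]→L[ℝ] ℂ} {s : Set E}
    (hf : ContDiffOn ℝ ∞ f s) : ContDiffOn ℝ ∞ (rot u f) s :=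
  (ContinuousAlternatingMap.compContinuousLinearMapCLM (F := ℂ) (ι := Fin k)
    (mulVec E u)).contDiff.comp_contDiffOn hf

theorem extDeriv_contDiffOn {f : E → E [⋀^Fin k]→L[ℝ] ℂ} {s : Set E} (hs : IsOpen s)
    (hf : ContDiffOn ℝ ∞ f s) : ContDiffOn ℝ ∞ (extDeriv f) s :=
  ContDiff.comp_contDiffOn
    (g := fun A => ContinuousAlternatingMap.alternatizeUncurryFinCLM (n := k) ℝ E ℂ A)
    (ContinuousLinearMap.contDiff (𝕜 := ℝ) (E := E →L[ℝ] E [⋀^Fin k]→L[ℝ] ℂ)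
      (F := E [⋀^Fin (k + 1)]→L[ℝ] ℂ)
      (ContinuousAlternatingMap.alternatizeUncurryFinCLM (n := k) ℝ E ℂ))
    (hf.fderiv_of_isOpen hs (m := ∞) (by simp))

/-- The conjugate of `d` by the multiplication by `u`. -/
def rotD (u : ℂ) (f : E → E [⋀^Fin k]→L[ℝ] ℂ) : E → E [⋀^Fin (k + 1)]→L[ℝ] ℂ :=
  rot u (extDeriv (rot u⁻¹ f))

theorem rotD_apply {u : ℂ} (hu : u ≠ 0) {f : E → E [⋀^Fin k]→L[ℝ] ℂ} {x : E}
    (hf : DifferentiableAt ℝ f x) (v : Fin (k + 1) → E) :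
    rotD u f x v = ∑ i, (-1 : ℤ) ^ i.val • fderiv ℝ f x (u • v i) (i.removeNth v) := by
  have h1 : HasFDerivAt (rot u⁻¹ f)
      ((ContinuousAlternatingMap.compContinuousLinearMapCLM (mulVec E u⁻¹)).comp
        (fderiv ℝ f x)) x :=
    (ContinuousAlternatingMap.compContinuousLinearMapCLM (F := ℂ) (ι := Fin k)
      (mulVec E u⁻¹)).hasFDerivAt.comp x hf.hasFDerivAt
  rw [rotD, rot_apply, extDeriv, h1.fderiv,
    ContinuousAlternatingMap.alternatizeUncurryFin_apply]
  refine Finset.sum_congr rfl fun i _ => ?_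
  congr 1
  change fderiv ℝ f x (u • v i) (fun j => u⁻¹ • (i.removeNth (fun j => u • v j) j)) = _
  congr 1
  funext j
  simp [Fin.removeNth, smul_smul, inv_mul_cancel₀ hu]

theorem rotD_eq {u : ℂ} (hu : u ≠ 0) {f : E → E [⋀^Fin k]→L[ℝ] ℂ} {x : E}
    (hf : DifferentiableAt ℝ f x) :
    rotD u f x = u.re • rotD 1 f x + u.im • rotD Complex.I f x := by
  ext v
  have hv : ∀ w : E, u • w = u.re • ((1 : ℂ) • w) + u.im • (Complex.I • w) := by
    intro w
    conv_lhs => rw [← Complex.re_add_im u]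
    rw [add_smul, mul_smul, one_smul]
    rfl
  rw [ContinuousAlternatingMap.add_apply, ContinuousAlternatingMap.smul_apply,
    ContinuousAlternatingMap.smul_apply, rotD_apply hu hf, rotD_apply one_ne_zero hf,
    rotD_apply Complex.I_ne_zero hf, Finset.smul_sum, Finset.smul_sum, ← Finset.sum_add_distrib]
  refine Finset.sum_congr rfl fun i _ => ?_
  have h : fderiv ℝ f x (u • v i) = u.re • fderiv ℝ f x ((1 : ℂ) • v i)
      + u.im • fderiv ℝ f x (Complex.I • v i) := by
    rw [hv (v i), (fderiv ℝ f x).map_add, (fderiv ℝ f x).map_smul, (fderiv ℝ f x).map_smul]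
  rw [h, ContinuousAlternatingMap.add_apply, ContinuousAlternatingMap.smul_apply,
    ContinuousAlternatingMap.smul_apply, smul_add, smul_comm, smul_comm ((-1 : ℤ) ^ i.val) u.im]

theorem rotD_comb {u : ℂ} (hu : u ≠ 0) {f g h : E → E [⋀^Fin k]→L[ℝ] ℂ} {x : E} (a b : ℝ)
    (hg : DifferentiableAt ℝ g x) (hh : DifferentiableAt ℝ h x)
    (hf : f =ᶠ[𝓝 x] fun y => a • g y + b • h y) :
    rotD u f x = a • rotD u g x + b • rotD u h x := by
  have hd : HasFDerivAt f (a • fderiv ℝ g x + b • fderiv ℝ h x) x :=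
    ((hg.hasFDerivAt.const_smul a).add (hh.hasFDerivAt.const_smul b)).congr_of_eventuallyEq hf
  ext v
  rw [ContinuousAlternatingMap.add_apply, ContinuousAlternatingMap.smul_apply,
    ContinuousAlternatingMap.smul_apply, rotD_apply hu hd.differentiableAt, rotD_apply hu hg,
    rotD_apply hu hh, hd.fderiv, Finset.smul_sum, Finset.smul_sum, ← Finset.sum_add_distrib]
  refine Finset.sum_congr rfl fun i _ => ?_
  rw [smul_comm a, smul_comm b, ← smul_add]
  rfl

theorem rotD_congr {u : ℂ} {f g : E → E [⋀^Fin k]→L[ℝ] ℂ} {x : E} (h : f =ᶠ[𝓝 x] g) :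
    rotD u f x = rotD u g x := by
  have h' : rot u⁻¹ f =ᶠ[𝓝 x] rot u⁻¹ g := h.mono fun y hy => by simp only [rot, hy]
  simp only [rotD, rot, h'.extDeriv_eq]

theorem rotD_contDiffOn (u : ℂ) {f : E → E [⋀^Fin k]→L[ℝ] ℂ} {s : Set E} (hs : IsOpen s)
    (hf : ContDiffOn ℝ ∞ f s) : ContDiffOn ℝ ∞ (rotD u f) s :=
  rot_contDiffOn _ (extDeriv_contDiffOn hs (rot_contDiffOn _ hf))

theorem rotD_rotD {u : ℂ} (hu : u ≠ 0) {f : E → E [⋀^Fin k]→L[ℝ] ℂ} {s : Set E} (hs : IsOpen s)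
    (hf : ContDiffOn ℝ ∞ f s) {x : E} (hx : x ∈ s) : rotD u (rotD u f) x = 0 := by
  have h : rotD u (rotD u f) = rot u (extDeriv (extDeriv (rot u⁻¹ f))) := by
    simp only [rotD, rot_rot, inv_mul_cancel₀ hu, rot_one]
  have h0 : extDeriv (extDeriv (rot u⁻¹ f)) x = 0 :=
    extDeriv_extDeriv_apply ((rot_contDiffOn u⁻¹ hf).contDiffAt (hs.mem_nhds hx)) (r := ∞)
      (by rw [minSmoothness_of_isRCLikeNormedField]; exact WithTop.coe_le_coe.2 le_top)
  rw [h]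
  ext v
  rw [rot_apply, h0]
  rfl

theorem rot_extDeriv_rotD {f : E → E [⋀^Fin k]→L[ℝ] ℂ} {s : Set E} (hs : IsOpen s)
    (hf : ContDiffOn ℝ ∞ f s) (hinv : ∀ u : ℂ, ‖u‖ = 1 → ∀ y ∈ s, rot u f y = f y)
    {u : ℂ} (hu : ‖u‖ = 1) {x : E} (hx : x ∈ s) :
    rot u (extDeriv (rotD (-Complex.I) f)) x = extDeriv (rotD (-Complex.I) f) x := by
  have hu0 : u ≠ 0 := by rintro rfl; simp at hu
  have huI : -(u * Complex.I) ≠ 0 := by simp [hu0]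
  have hdiff : ∀ {m : ℕ} {g : E → E [⋀^Fin m]→L[ℝ] ℂ}, ContDiffOn ℝ ∞ g s → ∀ y ∈ s,
      DifferentiableAt ℝ g y := fun hg y hy =>
    (hg.contDiffAt (hs.mem_nhds hy)).differentiableAt (by simp)
  have hD := rotD_contDiffOn 1 hs hf
  have hK := rotD_contDiffOn Complex.I hs hf
  -- the conjugated operators in terms of `D = rotD 1` and `K = rotD I`
  have e1 : rotD (-Complex.I) f =ᶠ[𝓝 x] fun y => (0 : ℝ) • rotD 1 f y + (-1 : ℝ) • rotD Complex.I f y := by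
    filter_upwards [hs.mem_nhds hx] with y hy
    rw [rotD_eq (by simp) (hdiff hf y hy)]
    simp
  have e2 : rotD (-(u * Complex.I)) f =ᶠ[𝓝 x]
      fun y => u.im • rotD 1 f y + (-u.re) • rotD Complex.I f y := by
    filter_upwards [hs.mem_nhds hx] with y hy
    rw [rotD_eq huI (hdiff hf y hy)]
    simp
  have e3 : rotD (1 + Complex.I) f =ᶠ[𝓝 x]
      fun y => (1 : ℝ) • rotD 1 f y + (1 : ℝ) • rotD Complex.I f y := by
    filter_upwards [hs.mem_nhds hx] with y hy
    rw [rotD_eq (by intro h; simpa using congrArg Complex.re h) (hdiff hf y hy)]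
    simp
  have hDx := hdiff hD x hx
  have hKx := hdiff hK x hx
  -- `D D = 0`, `K K = 0`, `D K = - K D`
  have z1 := rotD_rotD one_ne_zero hs hf hx
  have z2 := rotD_rotD Complex.I_ne_zero hs hf hx
  have h1I : (1 + Complex.I : ℂ) ≠ 0 := by intro h; simpa using congrArg Complex.re h
  have z3 := rotD_rotD h1I hs hf hx
  rw [rotD_comb h1I _ _ hDx hKx e3, rotD_eq h1I hDx, rotD_eq h1I hKx, z1, z2] at z3
  simp only [Complex.add_re, Complex.one_re, Complex.I_re, Complex.add_im, Complex.one_im,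
    Complex.I_im, add_zero, zero_add, one_smul] at z3
  have hKD : rotD Complex.I (rotD 1 f) x = - rotD 1 (rotD Complex.I f) x :=
    eq_neg_of_add_eq_zero_left z3
  -- the right-hand side
  have hR : extDeriv (rotD (-Complex.I) f) x = - rotD 1 (rotD Complex.I f) x := by
    have : extDeriv (rotD (-Complex.I) f) x = rotD 1 (rotD (-Complex.I) f) x := by
      rw [rotD.eq_1 1, inv_one, rot_one, rot_one]
    rw [this, rotD_comb one_ne_zero _ _ hDx hKx e1]
    ext v
    simp only [ContinuousAlternatingMap.add_apply, ContinuousAlternatingMap.smul_apply,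
      ContinuousAlternatingMap.neg_apply, zero_smul, neg_smul, one_smul, zero_add]
  -- the left-hand side
  have hL : rot u (extDeriv (rotD (-Complex.I) f)) x = rotD u (rotD (-(u * Complex.I)) f) x := by
    have h1 : rot u (rotD (-Complex.I) f) =ᶠ[𝓝 x] rotD (-(u * Complex.I)) f := by
      filter_upwards [hs.mem_nhds hx] with y hy
      have h2 : rot (-Complex.I)⁻¹ f =ᶠ[𝓝 y] rot (-(u * Complex.I))⁻¹ f := by
        filter_upwards [hs.mem_nhds hy] with z hz
        rw [hinv _ (by simp) z hz, hinv _ (by simp [hu]) z hz]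
      rw [rotD, rotD, rot_rot, mul_neg]
      simp only [rot, h2.extDeriv_eq]
    rw [← rotD_congr h1, rotD.eq_1 u, rot_rot, inv_mul_cancel₀ hu0, rot_one]
  have hsq : u.re * u.re + u.im * u.im = 1 := by
    have := Complex.normSq_apply u
    rw [Complex.normSq_eq_norm_sq, hu] at this
    linarith
  rw [hL, hR, rotD_comb hu0 _ _ hDx hKx e2, rotD_eq hu0 hDx, rotD_eq hu0 hKx, z1, z2, hKD]
  ext v
  simp only [ContinuousAlternatingMap.add_apply, ContinuousAlternatingMap.smul_apply,
    ContinuousAlternatingMap.neg_apply, ContinuousAlternatingMap.coe_zero, Pi.zero_apply]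
  generalize rotD 1 (rotD Complex.I f) x v = w
  have hsq' : (u.re : ℂ) * u.re + u.im * u.im = 1 := by exact_mod_cast hsq
  simp only [Complex.real_smul, Complex.ofReal_neg]
  linear_combination (-w) * hsq'

end Flat

section Charts

theorem hasMFDerivAt_restrictScalars {M N F : Type*} [TopologicalSpace M] [ChartedSpace E M]
    [NormedAddCommGroup F] [NormedSpace ℂ F] [TopologicalSpace N] [ChartedSpace F N]
    {f : M → N} {x : M} {f' : E →L[ℂ] F} (h : HasMFDerivAt 𝓘(ℂ, E) 𝓘(ℂ, F) f x f') :
    HasMFDerivAt 𝓘(ℝ, E) 𝓘(ℝ, F) f x (f'.restrictScalars ℝ) :=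
  ⟨h.1, HasFDerivWithinAt.restrictScalars ℝ h.2⟩

/-- A complex manifold is a smooth real manifold. -/
theorem isManifold_real [IsManifold 𝓘(ℂ, E) ω V] : IsManifold 𝓘(ℝ, E) ∞ V := by
  refine isManifold_of_contDiffOn _ _ _ fun e e' he he' => ?_
  have h := (contDiffGroupoid ω 𝓘(ℂ, E)).compatible he he'
  rw [contDiffGroupoid, mem_groupoid_of_pregroupoid] at h
  exact (h.1.restrict_scalars ℝ).of_le le_top

theorem IsSmoothForm.differentiableAt {k : ℕ} {φ : V → E [⋀^Fin k]→L[ℝ] ℂ} (hφ : IsSmoothForm φ)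
    {c : OpenPartialHomeomorph V E} (hc : c ∈ atlas E V) {y : E} (hy : y ∈ c.target) :
    DifferentiableAt ℝ (inChart c φ) y :=
  ((hφ c hc).contDiffAt (c.open_target.mem_nhds hy)).differentiableAt (by simp)

variable [IsManifold 𝓘(ℂ, E) ω V]

theorem dparam_smul {c : OpenPartialHomeomorph V E} (hc : c ∈ atlas E V) {y : E}
    (hy : y ∈ c.target) (u : ℂ) (v : E) : dparam c y (u • v) = u • dparam c y v := by
  have : IsManifold 𝓘(ℂ, E) 1 V := IsManifold.of_le (n := ω) le_top
  have h := hasMFDerivAt_restrictScalars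
    (mdifferentiableAt_atlas_symm (I := 𝓘(ℂ, E)) hc hy).hasMFDerivAt
  rw [dparam, h.mfderiv]
  exact ContinuousLinearMap.map_smul (mfderiv 𝓘(ℂ, E) 𝓘(ℂ, E) c.symm y : E →L[ℂ] E) u v

theorem inChart_rot {k : ℕ} {c : OpenPartialHomeomorph V E} (hc : c ∈ atlas E V) {y : E}
    (hy : y ∈ c.target) (u : ℂ) (φ : V → E [⋀^Fin k]→L[ℝ] ℂ) :
    inChart c (rot u φ) y = rot u (inChart c φ) y := by
  ext v
  change φ (c.symm y) (fun j => u • dparam c y (v j)) = φ (c.symm y) (fun j => dparam c y (u • v j))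
  simp only [dparam_smul hc hy]

/-- The differential of a change of charts. -/
theorem mfderiv_comp_dparam {c c' : OpenPartialHomeomorph V E} (hc : c ∈ atlas E V)
    (hc' : c' ∈ atlas E V) {y : E} (hy : y ∈ c.target) (hy' : c.symm y ∈ c'.source) :
    (dchart c' (c.symm y)).comp (dparam c y) =
      fderiv ℝ (c' ∘ c.symm) y := by
  have : IsManifold 𝓘(ℝ, E) ∞ V := isManifold_real
  have : IsManifold 𝓘(ℝ, E) 1 V := IsManifold.of_le (n := ∞) (by simp)
  rw [← mfderiv_eq_fderiv]
  exact (mfderiv_comp y (mdifferentiableAt_atlas hc' hy')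
    (mdifferentiableAt_atlas_symm hc hy)).symm

theorem dparam_comp_fderiv {c c' : OpenPartialHomeomorph V E} (hc : c ∈ atlas E V)
    (hc' : c' ∈ atlas E V) {y : E} (hy : y ∈ c.target) (hy' : c.symm y ∈ c'.source) :
    (dparam c' (c' (c.symm y))).comp (fderiv ℝ (c' ∘ c.symm) y) = dparam c y := by
  have : IsManifold 𝓘(ℝ, E) ∞ V := isManifold_real
  have : IsManifold 𝓘(ℝ, E) 1 V := IsManifold.of_le (n := ∞) (by simp)
  have h1 : MDifferentiableAt 𝓘(ℝ, E) 𝓘(ℝ, E) c' (c.symm y) := mdifferentiableAt_atlas hc' hy'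
  have h2 : MDifferentiableAt 𝓘(ℝ, E) 𝓘(ℝ, E) c.symm y := mdifferentiableAt_atlas_symm hc hy
  have h3 : MDifferentiableAt 𝓘(ℝ, E) 𝓘(ℝ, E) c'.symm ((c' ∘ c.symm) y) :=
    mdifferentiableAt_atlas_symm hc' (c'.map_source hy')
  have h4 := mfderiv_comp y h3 (h1.comp y h2)
  have h5 : c.symm =ᶠ[𝓝 y] c'.symm ∘ (c' ∘ c.symm) := by
    have : c.symm ⁻¹' c'.source ∈ 𝓝 y :=
      (c.continuousAt_symm hy).preimage_mem_nhds (c'.open_source.mem_nhds hy')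
    filter_upwards [this] with z hz
    exact (c'.left_inv hz).symm
  have h6 := h5.mfderiv_eq (I := 𝓘(ℝ, E)) (I' := 𝓘(ℝ, E))
  rw [h4, mfderiv_eq_fderiv] at h6
  exact h6.symm

theorem contDiffAt_transition {c c' : OpenPartialHomeomorph V E} (hc : c ∈ atlas E V)
    (hc' : c' ∈ atlas E V) {y : E} (hy : y ∈ c.target) (hy' : c.symm y ∈ c'.source) :
    ContDiffAt ℝ ∞ (c' ∘ c.symm) y := by
  have : IsManifold 𝓘(ℝ, E) ∞ V := isManifold_real
  have h := (contDiffGroupoid ∞ 𝓘(ℝ, E)).compatible hc hc'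
  rw [contDiffGroupoid, mem_groupoid_of_pregroupoid] at h
  have h' : ContDiffOn ℝ ∞ (c' ∘ c.symm) (c.symm.trans c').source := by
    refine h.1.mono fun z hz => ⟨?_, ⟨z, rfl⟩⟩
    exact hz
  exact h'.contDiffAt ((c.symm.trans c').open_source.mem_nhds ⟨hy, hy'⟩)

theorem inChart_transition {k : ℕ} {c c' : OpenPartialHomeomorph V E} (hc : c ∈ atlas E V)
    (hc' : c' ∈ atlas E V) {y : E} (hy : y ∈ c.target) (hy' : c.symm y ∈ c'.source)
    (φ : V → E [⋀^Fin k]→L[ℝ] ℂ) :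
    inChart c φ y = (inChart c' φ ((c' ∘ c.symm) y)).compContinuousLinearMap
      (fderiv ℝ (c' ∘ c.symm) y) := by
  rw [inChart, inChart, Function.comp_apply, c'.left_inv hy', ← dparam_comp_fderiv hc hc' hy hy']
  rfl

/-- The exterior derivative is computed in any chart by the usual formula. -/
theorem inChart_extD {k : ℕ} {φ : V → E [⋀^Fin k]→L[ℝ] ℂ} (hφ : IsSmoothForm φ)
    {c : OpenPartialHomeomorph V E} (hc : c ∈ atlas E V) {y : E} (hy : y ∈ c.target) :
    inChart c (extD φ) y = extDeriv (inChart c φ) y := by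
  set c' := chartAt E (c.symm y) with hc'
  have hca : c' ∈ atlas E V := chart_mem_atlas E _
  have hy' : c.symm y ∈ c'.source := mem_chart_source E _
  have h1 : inChart c φ =ᶠ[𝓝 y] fun z => (inChart c' φ ((c' ∘ c.symm) z)).compContinuousLinearMap
      (fderiv ℝ (c' ∘ c.symm) z) := by
    have : c.symm ⁻¹' c'.source ∈ 𝓝 y :=
      (c.continuousAt_symm hy).preimage_mem_nhds (c'.open_source.mem_nhds hy')
    filter_upwards [this, c.open_target.mem_nhds hy] with z hz hz'
    exact inChart_transition hc hca hz' hz φ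
  rw [h1.extDeriv_eq, extDeriv_pullback (f := c' ∘ c.symm) (hφ.differentiableAt hca (c'.map_source hy'))
    (contDiffAt_transition hc hca hy hy')
    (by rw [minSmoothness_of_isRCLikeNormedField]; exact WithTop.coe_le_coe.2 le_top),
    ← mfderiv_comp_dparam hc hca hy hy']
  rfl

theorem IsSmoothForm.rot {k : ℕ} {φ : V → E [⋀^Fin k]→L[ℝ] ℂ} (hφ : IsSmoothForm φ) (u : ℂ) :
    IsSmoothForm (rot u φ) := fun c hc =>
  (rot_contDiffOn u (hφ c hc)).congr fun _ hy => inChart_rot hc hy u φ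

theorem IsSmoothForm.extD {k : ℕ} {φ : V → E [⋀^Fin k]→L[ℝ] ℂ} (hφ : IsSmoothForm φ) :
    IsSmoothForm (extD φ) := fun c hc =>
  (extDeriv_contDiffOn c.open_target (hφ c hc)).congr fun _ hy => inChart_extD hφ hc hy

theorem IsSmoothForm.extDc {k : ℕ} {φ : V → E [⋀^Fin k]→L[ℝ] ℂ} (hφ : IsSmoothForm φ) :
    IsSmoothForm (extDc φ) := (hφ.rot _).extD.rot _

theorem IsSmoothForm.ddc {k : ℕ} {φ : V → E [⋀^Fin k]→L[ℝ] ℂ} (hφ : IsSmoothForm φ) :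
    IsSmoothForm (ddc φ) := hφ.extDc.extD

/-- `ddᶜ` maps forms of bidegree `(q, q)` to forms of bidegree `(q + 1, q + 1)`. -/
theorem ddc_hasBidegree {q : ℕ} {φ : V → E [⋀^Fin (2 * q)]→L[ℝ] ℂ} (hφ : IsSmoothForm φ)
    (hq : ∀ x, HasBidegree q q (φ x)) (x : V) : HasBidegree (q + 1) (q + 1) (ddc φ x) := by
  -- invariance of the form by multiplication by unit complex numbers
  have key : ∀ u : ℂ, ‖u‖ = 1 → rot u (ddc φ) x = ddc φ x := by
    intro u hu
    set c := chartAt E x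
    have hc : c ∈ atlas E V := chart_mem_atlas E _
    have hx : c x ∈ c.target := c.map_source (mem_chart_source E x)
    have hinv : ∀ u : ℂ, ‖u‖ = 1 → ∀ y ∈ c.target, rot u (inChart c φ) y = inChart c φ y := by
      intro u hu y hy
      rw [← inChart_rot hc hy]
      have : rot u φ = φ := by
        funext z; ext v
        rw [rot_apply, hq z u v, ← mul_pow, Complex.mul_conj, Complex.normSq_eq_norm_sq, hu]
        simp
      rw [this]
    have hdc : Set.EqOn (inChart c (extDc φ)) (rotD (-Complex.I) (inChart c φ)) c.target := by
      intro y hy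
      have h1 : inChart c (rot Complex.I φ) =ᶠ[𝓝 y] rot (-Complex.I)⁻¹ (inChart c φ) := by
        filter_upwards [c.open_target.mem_nhds hy] with z hz
        rw [inChart_rot hc hz]
        simp
      rw [extDc, inChart_rot hc hy, rotD]
      simp only [rot, inChart_extD (hφ.rot Complex.I) hc hy]
      rw [← h1.extDeriv_eq]
    have hdd : inChart c (ddc φ) (c x) = extDeriv (rotD (-Complex.I) (inChart c φ)) (c x) := by
      rw [ddc, inChart_extD hφ.extDc hc hx]
      exact (Filter.eventuallyEq_of_mem (c.open_target.mem_nhds hx) hdc).extDeriv_eq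
    have hfin : inChart c (rot u (ddc φ)) (c x) = inChart c (ddc φ) (c x) := by
      rw [inChart_rot hc hx, hdd, ← rot_extDeriv_rotD c.open_target (hφ c hc) hinv hu hx]
      simp only [rot, hdd]
    -- back from the chart
    have hback : ∀ ψ : V → E [⋀^Fin (2 * q + 2)]→L[ℝ] ℂ, ψ x =
        (inChart c ψ (c x)).compContinuousLinearMap (dchart c x) := by
      intro ψ
      have : IsManifold 𝓘(ℝ, E) ∞ V := isManifold_real
      have : IsManifold 𝓘(ℝ, E) 1 V := IsManifold.of_le (n := ∞) (by simp)
      have hxs : x ∈ c.source := mem_chart_source E x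
      have h1 : MDifferentiableAt 𝓘(ℝ, E) 𝓘(ℝ, E) c x := mdifferentiableAt_atlas hc hxs
      have h2 : MDifferentiableAt 𝓘(ℝ, E) 𝓘(ℝ, E) c.symm (c x) :=
        mdifferentiableAt_atlas_symm hc hx
      have h3 := mfderiv_comp x h2 h1
      have h4 : c.symm ∘ c =ᶠ[𝓝 x] id := by
        filter_upwards [c.open_source.mem_nhds hxs] with z hz
        exact c.left_inv hz
      rw [h4.mfderiv_eq, mfderiv_id] at h3
      have h5 : ∀ v : E, dparam c (c x) (dchart c x v) = v := fun v =>
        (DFunLike.congr_fun h3 v).symm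
      ext v
      change ψ x v = ψ (c.symm (c x)) (fun j => dparam c (c x) (dchart c x (v j)))
      simp only [h5, c.left_inv hxs]
    rw [hback (rot u (ddc φ)), hfin, ← hback]
  intro z v
  rcases eq_or_ne z 0 with rfl | hz
  · have : ddc φ x (fun j => (0 : ℂ) • v j) = 0 := by
      refine (ddc φ x).map_coord_zero (⟨0, by omega⟩ : Fin (2 * q + 2)) (by simp)
    rw [this]
    simp
  · have hn : (‖z‖ : ℂ) ≠ 0 := by simpa using hz
    set u : ℂ := z / ‖z‖ with hu
    have hu1 : ‖u‖ = 1 := by simp [hu, hz]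
    have h1 := DFunLike.congr_fun (key u hu1) (fun j => ‖z‖ • v j)
    rw [rot_apply] at h1
    have h2 : ∀ w : E, u • (‖z‖ • w) = z • w := by
      intro w
      rw [← Complex.coe_smul, smul_smul, hu, div_mul_cancel₀ _ hn]
    simp only [h2] at h1
    rw [h1]
    have h3 := (ddc φ x).toMultilinearMap.map_smul_univ (fun _ => ‖z‖) v
    refine h3.trans ?_
    rw [← mul_pow, Complex.mul_conj, Complex.normSq_eq_norm_sq]
    simp only [Finset.prod_const, Finset.card_univ, Fintype.card_fin, Complex.real_smul]
    push_cast
    rw [← pow_mul]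
    rfl

end Charts

/-! ### Test forms and currents -/

section Currents

theorem extD_zero_of_eventually {k : ℕ} {φ : V → E [⋀^Fin k]→L[ℝ] ℂ} {x : V}
    (h : ∀ᶠ z in 𝓝 x, φ z = 0) : extD φ x = 0 := by
  have hx : x ∈ (chartAt E x).source := mem_chart_source E x
  have ht := (chartAt E x).map_source hx
  have h1 : inChart (chartAt E x) φ =ᶠ[𝓝 (chartAt E x x)] fun _ => 0 := by
    have h2 : Filter.Tendsto (chartAt E x).symm (𝓝 (chartAt E x x)) (𝓝 x) := by
      have := (chartAt E x).continuousAt_symm ht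
      rwa [ContinuousAt, (chartAt E x).left_inv hx] at this
    filter_upwards [h2.eventually h] with y hy
    rw [inChart, hy]
    rfl
  have h3 : extDeriv (inChart (chartAt E x) φ) (chartAt E x x) = 0 := by
    rw [h1.extDeriv_eq]
    simp only [extDeriv, fderiv_const_apply]
    exact map_zero (ContinuousAlternatingMap.alternatizeUncurryFinCLM (n := k) ℝ E ℂ)
  rw [extD, h3]
  rfl

theorem support_extD {k : ℕ} (φ : V → E [⋀^Fin k]→L[ℝ] ℂ) :
    Function.support (extD φ) ⊆ tsupport φ := by
  intro x hx
  by_contra hx'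
  exact hx (extD_zero_of_eventually (notMem_tsupport_iff_eventuallyEq.1 hx'))

theorem support_rot {X : Type*} {k : ℕ} (u : ℂ) (φ : X → E [⋀^Fin k]→L[ℝ] ℂ) :
    Function.support (rot u φ) ⊆ Function.support φ := by
  intro x hx hx'
  refine hx ?_
  rw [rot, hx']
  rfl

theorem tsupport_ddc {k : ℕ} (φ : V → E [⋀^Fin k]→L[ℝ] ℂ) : tsupport (ddc φ) ⊆ tsupport φ := by
  have h1 : ∀ {m : ℕ} (ψ : V → E [⋀^Fin m]→L[ℝ] ℂ), tsupport (extD ψ) ⊆ tsupport ψ := fun ψ =>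
    closure_minimal (support_extD ψ) (isClosed_tsupport ψ)
  have h2 : ∀ {m : ℕ} (u : ℂ) (ψ : V → E [⋀^Fin m]→L[ℝ] ℂ), tsupport (rot u ψ) ⊆ tsupport ψ :=
    fun u ψ => closure_mono (support_rot u ψ)
  exact (h1 _).trans ((h2 _ _).trans ((h1 _).trans (h2 _ _)))

theorem inChart_add {k : ℕ} (c : OpenPartialHomeomorph V E) (φ ψ : V → E [⋀^Fin k]→L[ℝ] ℂ) :
    inChart c (φ + ψ) = inChart c φ + inChart c ψ := rfl

theorem inChart_smul {k : ℕ} (c : OpenPartialHomeomorph V E) (a : ℂ)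
    (φ : V → E [⋀^Fin k]→L[ℝ] ℂ) : inChart c (a • φ) = a • inChart c φ := rfl

theorem extD_add {k : ℕ} {φ ψ : V → E [⋀^Fin k]→L[ℝ] ℂ} (hφ : IsSmoothForm φ)
    (hψ : IsSmoothForm ψ) : extD (φ + ψ) = extD φ + extD ψ := by
  funext x
  have hc := chart_mem_atlas E x
  have ht := (chartAt E x).map_source (mem_chart_source E x)
  rw [extD, inChart_add, extDeriv_add (hφ.differentiableAt hc ht) (hψ.differentiableAt hc ht)]
  rfl

theorem extD_smul {k : ℕ} (a : ℂ) {φ : V → E [⋀^Fin k]→L[ℝ] ℂ} (hφ : IsSmoothForm φ) :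
    extD (a • φ) = a • extD φ := by
  funext x
  have hc := chart_mem_atlas E x
  have ht := (chartAt E x).map_source (mem_chart_source E x)
  have h := (hφ.differentiableAt hc ht).hasFDerivAt.const_smul a
  have h' : extDeriv (a • inChart (chartAt E x) φ) (chartAt E x x) =
      a • extDeriv (inChart (chartAt E x) φ) (chartAt E x x) := by
    rw [extDeriv, h.fderiv, ContinuousAlternatingMap.alternatizeUncurryFin_smul, extDeriv]
  rw [extD, inChart_smul, h']
  rfl

theorem rot_add {X : Type*} {k : ℕ} (u : ℂ) (φ ψ : X → E [⋀^Fin k]→L[ℝ] ℂ) :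
    rot u (φ + ψ) = rot u φ + rot u ψ := rfl

theorem rot_smul {X : Type*} {k : ℕ} (u a : ℂ) (φ : X → E [⋀^Fin k]→L[ℝ] ℂ) :
    rot u (a • φ) = a • rot u φ := rfl

theorem ddc_add [IsManifold 𝓘(ℂ, E) ω V] {k : ℕ} {φ ψ : V → E [⋀^Fin k]→L[ℝ] ℂ}
    (hφ : IsSmoothForm φ) (hψ : IsSmoothForm ψ) : ddc (φ + ψ) = ddc φ + ddc ψ := by
  rw [ddc, extDc, rot_add, extD_add (hφ.rot _) (hψ.rot _), rot_add]
  exact extD_add hφ.extDc hψ.extDc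

theorem ddc_smul [IsManifold 𝓘(ℂ, E) ω V] {k : ℕ} (a : ℂ) {φ : V → E [⋀^Fin k]→L[ℝ] ℂ}
    (hφ : IsSmoothForm φ) : ddc (a • φ) = a • ddc φ := by
  rw [ddc, extDc, rot_smul, extD_smul a (hφ.rot _), rot_smul]
  exact extD_smul a hφ.extDc

variable (E V)

/-- Test forms of bidegree `(q, q)`: smooth forms of bidegree `(q, q)` with compact support. -/
def TestForm (q : ℕ) : Submodule ℂ (V → E [⋀^Fin (2 * q)]→L[ℝ] ℂ) where
  carrier := {φ | IsSmoothForm φ ∧ HasCompactSupport φ ∧ ∀ x, HasBidegree q q (φ x)}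
  add_mem' := by
    rintro φ ψ ⟨h1, h2, h3⟩ ⟨h1', h2', h3'⟩
    refine ⟨fun c hc => (h1 c hc).add (h1' c hc), h2.add h2', fun x z v => ?_⟩
    simp only [Pi.add_apply, ContinuousAlternatingMap.add_apply, h3 x z v, h3' x z v, mul_add]
  zero_mem' := by
    refine ⟨fun c _ => ?_, HasCompactSupport.zero, fun x z v => by simp⟩
    exact (contDiffOn_const (c := (0 : E [⋀^Fin (2 * q)]→L[ℝ] ℂ)))
  smul_mem' := by
    rintro a φ ⟨h1, h2, h3⟩
    refine ⟨fun c hc => (h1 c hc).const_smul a, ?_, fun x z v => ?_⟩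
    · exact h2.mono' fun x hx => subset_tsupport _ fun h0 => hx (by simp [h0])
    · simp only [Pi.smul_apply, ContinuousAlternatingMap.smul_apply, h3 x z v, smul_eq_mul]
      ring

variable {E V}

/-- The operator `ddᶜ` from test forms of bidegree `(q, q)` to test forms of bidegree
`(q + 1, q + 1)`. -/
def ddcTest [IsManifold 𝓘(ℂ, E) ω V] (q : ℕ) : TestForm E V q →ₗ[ℂ] TestForm E V (q + 1) where
  toFun φ := ⟨ddc φ.1, φ.2.1.ddc, φ.2.2.1.mono' ((subset_tsupport _).trans (tsupport_ddc φ.1)),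
    ddc_hasBidegree φ.2.1 φ.2.2.2⟩
  map_add' φ ψ := Subtype.ext (ddc_add φ.2.1 ψ.2.1)
  map_smul' a φ := Subtype.ext (ddc_smul a φ.2.1)

variable (E V)

/-- A current of bidimension `(p, p)`: a linear form on the space of test forms of bidegree
`(p, p)`, continuous in the sense of distributions.  Continuity is expressed in the usual way by
estimates, over every compact subset `K` of a chart domain, by finitely many derivatives of the
coefficients of the form in that chart. -/
structure Current (p : ℕ) where
  /-- the linear form -/
  toFun : TestForm E V p →ₗ[ℂ] ℂ
  /-- continuity -/
  cont : ∀ c ∈ atlas E V, ∀ K : Set V, IsCompact K → K ⊆ c.source →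
    ∃ (C : ℝ) (m : ℕ), ∀ φ : TestForm E V p, tsupport φ.1 ⊆ K →
      ∀ B : ℝ, (∀ j ≤ m, ∀ y ∈ c.target, ‖iteratedFDeriv ℝ j (inChart c φ.1) y‖ ≤ B) →
        ‖toFun φ‖ ≤ C * B

variable {E V}

/-- For `(1, 0)`-covectors `a₁, …, a_q`, the list `a₁, conj a₁, …, a_q, conj a_q`. -/
def coframe {q : ℕ} (a : Fin q → E →L[ℂ] ℂ) (r : Fin (2 * q)) (w : E) : ℂ :=
  if r.1 % 2 = 0 then a ⟨r.1 / 2, by omega⟩ w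
  else starRingEnd ℂ (a ⟨r.1 / 2, by omega⟩ w)

/-- The elementary form `i a₁ ∧ conj a₁ ∧ ⋯ ∧ i a_q ∧ conj a_q`; the wedge product of covectors
`b₁, …, b_k` at `v₁, …, v_k` is the determinant of the matrix `b_r (v_s)`. -/
def elementaryForm {q : ℕ} (a : Fin q → E →L[ℂ] ℂ) (v : Fin (2 * q) → E) : ℂ :=
  Complex.I ^ q * (Matrix.of fun r s => coframe a r (v s)).det

/-- Strongly positive `(q, q)`-covectors: the convex cone generated by the elementary forms. -/
def IsStronglyPositive {q : ℕ} (α : E [⋀^Fin (2 * q)]→L[ℝ] ℂ) : Prop :=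
  ∃ (m : ℕ) (t : Fin m → ℝ) (a : Fin m → Fin q → E →L[ℂ] ℂ), (∀ j, 0 ≤ t j) ∧
    ∀ v, α v = ∑ j, (t j : ℂ) * elementaryForm (a j) v

/-- Positivity of a linear form on test forms (in the sense of Lelong): it takes nonnegative real
values on the test forms which are strongly positive at every point. -/
def IsPositive {q : ℕ} (L : TestForm E V q →ₗ[ℂ] ℂ) : Prop :=
  ∀ φ : TestForm E V q, (∀ x, IsStronglyPositive (φ.1 x)) → 0 ≤ (L φ).re ∧ (L φ).im = 0

/-- `T` is plurisuperharmonic if `-ddᶜ T` is positive, where `⟨ddᶜ T, φ⟩ = ⟨T, ddᶜ φ⟩`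
(for bidimension `(0, 0)`, `ddᶜ T` vanishes for degree reasons). -/
def IsPlurisuperharmonic [IsManifold 𝓘(ℂ, E) ω V] : (p : ℕ) → Current E V p → Prop
  | 0, _ => True
  | q + 1, T => IsPositive (-(T.toFun ∘ₗ ddcTest q))

/-- The support of a current: the points all of whose neighbourhoods carry a test form which is not
annihilated by the current. -/
def Current.support {p : ℕ} (T : Current E V p) : Set V :=
  {x | ∀ O : Set V, IsOpen O → x ∈ O → ∃ φ : TestForm E V p, tsupport φ.1 ⊆ O ∧ T.toFun φ ≠ 0}

end Currents

/-! ### Pseudoconcave sets -/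

section Pseudoconcave

/-- The unbounded component of the complement of a compact subset `K` of `ℂ^p` (`p ≥ 1`), as the
set of points of the complement whose connected component is unbounded. -/
def unboundedComponent {p : ℕ} (K : Set (EuclideanSpace ℂ (Fin p))) :
    Set (EuclideanSpace ℂ (Fin p)) :=
  {z | z ∈ Kᶜ ∧ ¬ Bornology.IsBounded (connectedComponentIn Kᶜ z)}

/-- `X ∩ W` is `p`-pseudoconcave in the open subset `W` of `V`: for every relatively compact open
subset `U` of `W` and every holomorphic map `f` from a neighbourhood of `closure U` to `ℂ^p`, no
point of `X ∩ U` is mapped into the unbounded component of the complement of `f (X ∩ ∂U)`. -/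
def IsPseudoconcaveIn (E : Type u) [NormedAddCommGroup E] [NormedSpace ℂ E]
    {V : Type v} [TopologicalSpace V] [ChartedSpace E V] (p : ℕ) (X W : Set V) : Prop :=
  ∀ U : Set V, IsOpen U → IsCompact (closure U) → closure U ⊆ W →
    ∀ W' : Set V, IsOpen W' → closure U ⊆ W' → W' ⊆ W →
      ∀ f : V → EuclideanSpace ℂ (Fin p),
        ContMDiffOn 𝓘(ℂ, E) 𝓘(ℂ, EuclideanSpace ℂ (Fin p)) ω f W' →
          f '' (X ∩ U) ⊆ (unboundedComponent (f '' (X ∩ frontier U)))ᶜ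

/-- The open set `W` admits a holomorphic immersion into some `ℂ^N`.  This holds for chart domains,
and for every `W` if `V` is a Stein manifold. -/
def HasHolomorphicImmersion (E : Type u) [NormedAddCommGroup E] [NormedSpace ℂ E]
    {V : Type v} [TopologicalSpace V] [ChartedSpace E V] (W : Set V) : Prop :=
  ∃ (N : ℕ) (g : V → EuclideanSpace ℂ (Fin N)),
    ContMDiffOn 𝓘(ℂ, E) 𝓘(ℂ, EuclideanSpace ℂ (Fin N)) ω g W ∧
      ∀ x ∈ W, Function.Injective (mfderiv 𝓘(ℂ, E) 𝓘(ℂ, EuclideanSpace ℂ (Fin N)) g x)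

end Pseudoconcave

end ComplexCurrents

end

open scoped Manifold ContDiff Topology

noncomputable section

/-! Write X for the support of the current and suppose that f maps a point of X ∩ U into the
unbounded component of the complement of f(X ∩ ∂U). The compact set f(X ∩ closure U) must have a
boundary point in that component, and moving a ball towards it gives a closed ball with centre a
which meets f(X ∩ closure U) in one point f(x), with the whole fibre of X over f(x) inside U
(`exists_touching_ball`).

Take R slightly larger than ‖f(x) - a‖² and let u be the barrier exp(-1/(R - ‖z - a‖²)), extended by
zero outside the ball. Choose a coordinate j in which f(x) and a differ. Multiply u by the
elementary form in the coordinates other than j: its ddᶜ is a function times the full elementary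
form, because only the (j, j) second derivative survives the wedge product
(`extDeriv_rotD_barrier`). The function is positive in the ball near its boundary, where the j-th
coordinate stays away from that of a (`barrierCoeff_pos`). After pulling back by f and cutting off
near X, the current is nonnegative on this ddᶜ by positivity and nonpositive by
plurisuperharmonicity. So it is zero there, and by comparison it vanishes near x on every multiple
of the pulled back form (`Current.vanishesNear_of_barrier`).

One form is not enough to remove x from the support. The touching situation is stable under small
perturbations f + tH with H(x) = 0 (`Current.eventually_vanishesNear`), and an immersion g lets the
differential of H at x be prescribed: H = A(g - g(x)) with A linear. The elementary forms so
obtained at x span all forms of bidegree (p, p), since a linear functional which kills them is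
polynomial in t along each line (`mem_span_elemForm_near`). Inverting a matrix of functions near x
writes each test form supported there as a sum of multiples of finitely many such pullbacks
(`Current.notMem_support_of_span`). Hence the current vanishes near x, which contradicts x ∈ X. -/

namespace ComplexCurrents

/-! ### Wedge products of covectors as determinants. -/

section DeterminantForms

variable {E : Type*} [NormedAddCommGroup E] [NormedSpace ℂ E]

/-- The determinant of the rows, as a continuous alternating map. -/
def detCLM (k : ℕ) : (Fin k → ℂ) [⋀^Fin k]→L[ℂ] ℂ :=
  { (Matrix.detRowAlternating : (Fin k → ℂ) [⋀^Fin k]→ₗ[ℂ] ℂ) with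
    cont := Continuous.matrix_det (A := fun M : Fin k → Fin k → ℂ => Matrix.of M)
      continuous_id }

/-- The wedge product of real-linear complex-valued covectors. -/
def detForm {k : ℕ} (τ : Fin k → E →L[ℝ] ℂ) : E [⋀^Fin k]→L[ℝ] ℂ :=
  ((detCLM k).restrictScalars ℝ).compContinuousLinearMap (ContinuousLinearMap.pi τ)

theorem detForm_apply {k : ℕ} (τ : Fin k → E →L[ℝ] ℂ) (v : Fin k → E) :
    detForm τ v = (Matrix.of fun r s => τ r (v s)).det := by
  rw [← Matrix.det_transpose]
  rfl

/-- The value of a wedge product at fixed vectors, as an alternating map of the covectors. -/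
def detAlt {k : ℕ} (v : Fin k → E) : (E →L[ℝ] ℂ) [⋀^Fin k]→ₗ[ℂ] ℂ :=
  (Matrix.detRowAlternating : (Fin k → ℂ) [⋀^Fin k]→ₗ[ℂ] ℂ).compLinearMap
    { toFun := fun b s => b (v s)
      map_add' := fun _ _ => rfl
      map_smul' := fun _ _ => rfl }

theorem detAlt_apply {k : ℕ} (v : Fin k → E) (τ : Fin k → E →L[ℝ] ℂ) :
    detAlt v τ = detForm τ v := by
  rw [detForm_apply]
  rfl

/-- The conjugate of a `(1, 0)`-covector. -/
def conjCov (b : E →L[ℂ] ℂ) : E →L[ℝ] ℂ :=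
  Complex.conjCLE.toContinuousLinearMap.comp (b.restrictScalars ℝ)

@[simp] theorem conjCov_apply (b : E →L[ℂ] ℂ) (v : E) :
    conjCov b v = starRingEnd ℂ (b v) := rfl

/-- The list `a₁, conj b₁, …, a_q, conj b_q`. -/
def mixedCoframe {q : ℕ} (a b : Fin q → E →L[ℂ] ℂ) (r : Fin (2 * q)) : E →L[ℝ] ℂ :=
  if r.1 % 2 = 0 then (a ⟨r.1 / 2, by omega⟩).restrictScalars ℝ
  else conjCov (b ⟨r.1 / 2, by omega⟩)

/-- The elementary form as a continuous alternating map. -/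
def elemForm {q : ℕ} (a : Fin q → E →L[ℂ] ℂ) : E [⋀^Fin (2 * q)]→L[ℝ] ℂ :=
  Complex.I ^ q • detForm (mixedCoframe a a)

theorem elemForm_apply {q : ℕ} (a : Fin q → E →L[ℂ] ℂ) (v : Fin (2 * q) → E) :
    elemForm a v = elementaryForm a v := by
  rw [elemForm, elementaryForm, ContinuousAlternatingMap.smul_apply, detForm_apply, smul_eq_mul]
  congr 3
  funext r s
  simp only [mixedCoframe, coframe]
  split_ifs <;> rfl

theorem mixedCoframe_cons {q : ℕ} (l m : E →L[ℂ] ℂ) (a b : Fin q → E →L[ℂ] ℂ) :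
    (mixedCoframe (Fin.cons l a : Fin (q + 1) → E →L[ℂ] ℂ) (Fin.cons m b) :
      Fin (2 * q + 1 + 1) → E →L[ℝ] ℂ) =
    Fin.cons (l.restrictScalars ℝ) (Fin.cons (conjCov m) (mixedCoframe a b)) := by
  funext r
  refine Fin.cases ?_ (fun r => Fin.cases ?_ (fun r => ?_) r) r
  · rw [mixedCoframe, if_pos (by rfl)]
    exact congrArg (fun i => ((Fin.cons l a : Fin (q + 1) → E →L[ℂ] ℂ) i).restrictScalars ℝ)
      (Fin.ext (by simp) : _ = (0 : Fin (q + 1)))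
  · rw [mixedCoframe, if_neg (by simp)]
    exact congrArg (fun i => conjCov ((Fin.cons m b : Fin (q + 1) → E →L[ℂ] ℂ) i))
      (Fin.ext (by simpa using Nat.mod_le _ _) : _ = (0 : Fin (q + 1)))
  · simp only [Fin.cons_succ, mixedCoframe, Fin.val_succ]
    have h1 : (r.1 + 1 + 1) % 2 = r.1 % 2 := by omega
    have h2 : ∀ h, (⟨(r.1 + 1 + 1) / 2, h⟩ : Fin (q + 1)) = Fin.succ ⟨r.1 / 2, by omega⟩ := by
      intro h
      ext
      simp only [Fin.val_succ]
      omega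
    simp only [h1, h2, Fin.cons_succ]

theorem elemForm_comp {F : Type*} [NormedAddCommGroup F] [NormedSpace ℂ F] {q : ℕ}
    (a : Fin q → F →L[ℂ] ℂ) (D : E →L[ℂ] F) :
    (elemForm a).compContinuousLinearMap (D.restrictScalars ℝ) =
      elemForm fun k => (a k).comp D := by
  ext v
  rw [ContinuousAlternatingMap.compContinuousLinearMap_apply, elemForm_apply, elemForm_apply]
  rfl

theorem HasBidegree.comp {F : Type*} [NormedAddCommGroup F] [NormedSpace ℂ F] {k r s : ℕ}
    {α : F [⋀^Fin k]→L[ℝ] ℂ} (h : HasBidegree r s α) (D : E →L[ℂ] F) :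
    HasBidegree r s (α.compContinuousLinearMap (D.restrictScalars ℝ)) := by
  intro z v
  simp only [ContinuousAlternatingMap.compContinuousLinearMap_apply]
  rw [← h z]
  congr 1
  funext j
  simp

theorem HasBidegree.smul {k r s : ℕ} {α : E [⋀^Fin k]→L[ℝ] ℂ} (h : HasBidegree r s α) (c : ℂ) :
    HasBidegree r s (c • α) := by
  intro z v
  simp only [ContinuousAlternatingMap.smul_apply, h z v, smul_eq_mul]
  ring

theorem detForm_smul_vec {k : ℕ} (τ : Fin k → E →L[ℝ] ℂ) (z : ℂ) (c : Fin k → ℂ)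
    (h : ∀ r v, τ r (z • v) = c r * τ r v) (v : Fin k → E) :
    detForm τ (fun j => z • v j) = (∏ r, c r) * detForm τ v := by
  rw [detForm_apply, detForm_apply]
  simp only [h]
  rw [← Matrix.det_mul_column]
  rfl

theorem prod_parity (z w : ℂ) (q : ℕ) :
    (∏ r : Fin (2 * q), if r.1 % 2 = 0 then z else w) = z ^ q * w ^ q := by
  rw [Fin.prod_univ_eq_prod_range (fun r => if r % 2 = 0 then z else w)]
  induction q with
  | zero => simp
  | succ n ih =>
    rw [show 2 * (n + 1) = 2 * n + 1 + 1 by ring, Finset.prod_range_succ, Finset.prod_range_succ,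
      ih, if_pos (by omega), if_neg (by omega)]
    ring

theorem elemForm_hasBidegree {q : ℕ} (a : Fin q → E →L[ℂ] ℂ) : HasBidegree q q (elemForm a) := by
  refine HasBidegree.smul (fun z v => ?_) _
  rw [detForm_smul_vec _ z (fun r => if r.1 % 2 = 0 then z else starRingEnd ℂ z), prod_parity]
  intro r v
  simp only [mixedCoframe]
  split_ifs <;> simp

theorem detForm_cons {k : ℕ} (b : E →L[ℝ] ℂ) (τ : Fin k → E →L[ℝ] ℂ) (v : Fin (k + 1) → E) :
    detForm (Fin.cons b τ) v =
      ∑ i, (-1 : ℂ) ^ i.val * (b (v i) * detForm τ (i.removeNth v)) := by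
  rw [detForm_apply, Matrix.det_succ_row_zero]
  refine Finset.sum_congr rfl fun i _ => ?_
  rw [detForm_apply, mul_assoc]
  rfl

/-- The `(1, 0)`-covector of a real covector. -/
def cplx (l : E →L[ℝ] ℝ) : E →L[ℂ] ℂ :=
  StrongDual.extendRCLike (𝕜 := ℂ) l

theorem cplx_apply (l : E →L[ℝ] ℝ) (v : E) :
    cplx l v = (l v : ℂ) - Complex.I * l (Complex.I • v) := by
  rw [cplx, StrongDual.extendRCLike_apply]
  rfl

/-- This is the algebra behind ddᶜ of a function whose Hessian is l ⊗ l. With L = l and M = l(-i ·),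
the (1, 0)-covector λ = `cplx l` is L + iM, and expanding gives i λ ∧ conj λ = 2 L ∧ M. The double
alternating sum on the left is L ∧ M ∧ `elemForm a`. -/
theorem sum_sum_elemForm {q : ℕ} (l : E →L[ℝ] ℝ) (a : Fin q → E →L[ℂ] ℂ)
    (v : Fin (2 * q + 1 + 1) → E) :
    ∑ i, (-1 : ℂ) ^ i.val * ((l (v i) : ℂ) * ∑ j, (-1 : ℂ) ^ j.val *
      ((l (-Complex.I • i.removeNth v j) : ℂ) * elemForm a (j.removeNth (i.removeNth v)))) =
    (1 / 2 : ℂ) * elemForm (q := q + 1) (Fin.cons (cplx l) a) v := by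
  set L : E →L[ℝ] ℂ := Complex.ofRealCLM.comp l with hL
  set M : E →L[ℝ] ℂ := Complex.ofRealCLM.comp (l.comp (mulVec E (-Complex.I))) with hM
  have h1 : ∀ i : Fin (2 * q + 1 + 1), ∑ j, (-1 : ℂ) ^ j.val *
      ((l (-Complex.I • i.removeNth v j) : ℂ) * elemForm a (j.removeNth (i.removeNth v))) =
      Complex.I ^ q * detForm (Fin.cons M (mixedCoframe a a)) (i.removeNth v) := by
    intro i
    rw [detForm_cons, Finset.mul_sum]
    refine Finset.sum_congr rfl fun j _ => ?_
    have : M (i.removeNth v j) = (l (-Complex.I • i.removeNth v j) : ℂ) := rfl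
    rw [this, elemForm, ContinuousAlternatingMap.smul_apply, smul_eq_mul]
    ring
  have h2 : ∑ i, (-1 : ℂ) ^ i.val * ((l (v i) : ℂ) * ∑ j, (-1 : ℂ) ^ j.val *
      ((l (-Complex.I • i.removeNth v j) : ℂ) * elemForm a (j.removeNth (i.removeNth v)))) =
      Complex.I ^ q * detForm (Fin.cons L (Fin.cons M (mixedCoframe a a))) v := by
    rw [detForm_cons, Finset.mul_sum]
    refine Finset.sum_congr rfl fun i _ => ?_
    rw [h1]
    have : L (v i) = (l (v i) : ℂ) := rfl
    rw [this]
    ring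
  have h3 : (cplx l).restrictScalars ℝ = L + Complex.I • M := by
    ext w
    simp [cplx_apply, hL, hM, mulVec_apply, sub_eq_add_neg]
  have h4 : conjCov (cplx l) = L + (-Complex.I) • M := by
    ext w
    simp [cplx_apply, hL, hM, mulVec_apply, sub_eq_add_neg]
  -- The two leading zeros are placeholders. Writing the wedge products as updates of one family
  -- makes them bilinear and alternating in the first two slots.
  set τ : Fin (2 * q + 1 + 1) → E →L[ℝ] ℂ := Fin.cons 0 (Fin.cons 0 (mixedCoframe a a)) with hτ
  have hc : ∀ x y : E →L[ℝ] ℂ, detForm (Fin.cons x (Fin.cons y (mixedCoframe a a))) v =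
      detAlt v (Function.update (Function.update τ 0 x) 1 y) := by
    intro x y
    rw [detAlt_apply]
    congr 2
    funext r
    refine Fin.cases ?_ (fun r => Fin.cases ?_ (fun r => ?_) r) r
    · simp
    · simp [Function.update]
    · simp [hτ, Function.update, Fin.ext_iff]
  have h01 : (0 : Fin (2 * q + 1 + 1)) ≠ 1 := by simp
  have hsame : ∀ x, detAlt v (Function.update (Function.update τ 0 x) 1 x) = 0 := fun x =>
    (detAlt v).map_eq_zero_of_eq _ (i := 0) (j := 1) (by simp) h01
  have hadd2 : ∀ x y z, detAlt v (Function.update (Function.update τ 0 x) 1 (y + z)) =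
      detAlt v (Function.update (Function.update τ 0 x) 1 y) +
      detAlt v (Function.update (Function.update τ 0 x) 1 z) := fun x y z =>
    (detAlt v).map_update_add _ _ _ _
  have hsmul2 : ∀ (c : ℂ) x y, detAlt v (Function.update (Function.update τ 0 x) 1 (c • y)) =
      c * detAlt v (Function.update (Function.update τ 0 x) 1 y) := fun c x y =>
    (detAlt v).map_update_smul _ _ _ _
  have hadd1 : ∀ x y z, detAlt v (Function.update (Function.update τ 0 (x + y)) 1 z) =
      detAlt v (Function.update (Function.update τ 0 x) 1 z) +
      detAlt v (Function.update (Function.update τ 0 y) 1 z) := fun x y z => by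
    simp only [Function.update_comm h01]
    exact (detAlt v).map_update_add _ _ _ _
  have hsmul1 : ∀ (c : ℂ) x y, detAlt v (Function.update (Function.update τ 0 (c • x)) 1 y) =
      c * detAlt v (Function.update (Function.update τ 0 x) 1 y) := fun c x y => by
    simp only [Function.update_comm h01]
    exact (detAlt v).map_update_smul _ _ _ _
  have hanti : detAlt v (Function.update (Function.update τ 0 M) 1 L) =
      - detAlt v (Function.update (Function.update τ 0 L) 1 M) := by
    have := hsame (L + M)
    rw [hadd1, hadd2, hadd2, hsame, hsame] at this
    linear_combination this
  rw [h2, elemForm, ContinuousAlternatingMap.smul_apply, smul_eq_mul]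
  have h5 := mixedCoframe_cons (cplx l) (cplx l) a a
  have h6 : (detForm (mixedCoframe (Fin.cons (cplx l) a : Fin (q + 1) → E →L[ℂ] ℂ)
      (Fin.cons (cplx l) a))) v = detForm (Fin.cons ((cplx l).restrictScalars ℝ)
        (Fin.cons (conjCov (cplx l)) (mixedCoframe a a))) v := by
    rw [← h5]
  rw [h6, h3, h4, hc, hc, hadd1, hadd2, hadd2, hsmul1, hsmul1, hsmul2,
    hsmul2, hsame, hsame, hanti, pow_succ]
  linear_combination (Complex.I ^ q * detAlt v (Function.update (Function.update τ 0 L) 1 M))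
    * Complex.I_mul_I

end DeterminantForms

/-! ### Elementary forms span the forms of bidegree (p, p). -/

section Spanning

variable {E : Type*} [NormedAddCommGroup E] [NormedSpace ℂ E]

theorem elemForm_cons_apply {q : ℕ} (l : E →L[ℂ] ℂ) (a : Fin q → E →L[ℂ] ℂ)
    (v : Fin (2 * q + 1 + 1) → E) :
    elemForm (q := q + 1) (Fin.cons l a) v = Complex.I ^ (q + 1) *
      (((detAlt v).curryLeft (l.restrictScalars ℝ)).curryLeft (conjCov l)) (mixedCoframe a a) := by
  rw [elemForm, ContinuousAlternatingMap.smul_apply, smul_eq_mul]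
  congr 1
  have h6 : (detForm (mixedCoframe (Fin.cons l a : Fin (q + 1) → E →L[ℂ] ℂ)
      (Fin.cons l a))) v = detForm (Fin.cons (l.restrictScalars ℝ)
        (Fin.cons (conjCov l) (mixedCoframe a a))) v := by
    rw [← mixedCoframe_cons l l a a]
  rw [h6, ← detAlt_apply]
  rfl

/-- The covectors z_k with k ≠ j and their conjugates already occur in the wedge product, so only
the j-th term of the sum survives in each of the first two slots. It contributes c_j and conj c_j
respectively. -/
theorem elemForm_cons_sum {q : ℕ} (z : Fin (q + 1) → E →L[ℂ] ℂ) (c : Fin (q + 1) → ℂ)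
    (j : Fin (q + 1)) :
    elemForm (q := q + 1) (Fin.cons (∑ k, c k • z k) fun k => z (j.succAbove k)) =
      ((‖c j‖ ^ 2 : ℝ) : ℂ) •
        elemForm (q := q + 1) (Fin.cons (z j) fun k => z (j.succAbove k)) := by
  ext v
  set a : Fin q → E →L[ℂ] ℂ := fun k => z (j.succAbove k)
  rw [ContinuousAlternatingMap.smul_apply]
  refine (elemForm_cons_apply _ a v).trans ?_
  rw [smul_eq_mul, show elemForm (q := q + 1) (Fin.cons (z j) a) v = _ from
    elemForm_cons_apply (z j) a v]
  have h1 : (∑ k, c k • z k).restrictScalars ℝ = ∑ k, c k • (z k).restrictScalars ℝ := by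
    ext w
    simp
  have h2 : conjCov (∑ k, c k • z k) = ∑ k, starRingEnd ℂ (c k) • conjCov (z k) := by
    ext w
    simp
  have e1 : ∀ (i : Fin q) (y : E →L[ℝ] ℂ),
      (((detAlt v).curryLeft ((a i).restrictScalars ℝ)).curryLeft y) (mixedCoframe a a) = 0 := by
    intro i y
    refine (detAlt v).map_eq_zero_of_eq _ (i := 0)
      (j := (Fin.succ (Fin.succ ⟨2 * i.1, by omega⟩) : Fin (2 * q + 1 + 1))) ?_ (by simp [Fin.ext_iff])
    change (a i).restrictScalars ℝ = mixedCoframe a a ⟨2 * i.1, by omega⟩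
    rw [mixedCoframe, if_pos (by simp)]
    congr 2
    ext
    simp
  have e2 : ∀ (i : Fin q) (y : E →L[ℝ] ℂ),
      (((detAlt v).curryLeft y).curryLeft (conjCov (a i))) (mixedCoframe a a) = 0 := by
    intro i y
    refine (detAlt v).map_eq_zero_of_eq _ (i := Fin.succ 0)
      (j := (Fin.succ (Fin.succ ⟨2 * i.1 + 1, by omega⟩) : Fin (2 * q + 1 + 1))) ?_
      (by simp [Fin.ext_iff])
    change conjCov (a i) = mixedCoframe a a ⟨2 * i.1 + 1, by omega⟩
    rw [mixedCoframe, if_neg (by simp)]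
    congr 2
    ext
    simp only
    omega
  let B : (E →L[ℝ] ℂ) →ₗ[ℂ] (E →L[ℝ] ℂ) →ₗ[ℂ] ℂ := LinearMap.mk₂ ℂ
    (fun x y => (((detAlt v).curryLeft x).curryLeft y) (mixedCoframe a a))
    (fun x x' y => by rw [map_add]; rfl) (fun t x y => by rw [map_smul]; rfl)
    (fun x y y' => by rw [map_add]; rfl) (fun t x y => by rw [map_smul]; rfl)
  have e3 : ∀ (i : Fin q) y, B ((z (j.succAbove i)).restrictScalars ℝ) y = 0 := e1
  have e4 : ∀ (i : Fin q) y, B y (conjCov (z (j.succAbove i))) = 0 := e2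
  change Complex.I ^ (q + 1) * B ((∑ k, c k • z k).restrictScalars ℝ) (conjCov (∑ k, c k • z k)) =
    ((‖c j‖ ^ 2 : ℝ) : ℂ) * (Complex.I ^ (q + 1) * B ((z j).restrictScalars ℝ) (conjCov (z j)))
  rw [h1, h2, Fin.sum_univ_succAbove _ j, Fin.sum_univ_succAbove _ j]
  simp only [map_add, map_sum, map_smul, LinearMap.add_apply, LinearMap.sum_apply,
    LinearMap.smul_apply, e3, e4, Finset.sum_const_zero, add_zero, mul_zero, smul_eq_mul]
  have hn : ((‖c j‖ ^ 2 : ℝ) : ℂ) = c j * starRingEnd ℂ (c j) := by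
    rw [Complex.mul_conj, Complex.normSq_eq_norm_sq]
  rw [hn]
  ring

/-- Every alternating map is a combination of wedge products of real covectors. -/
theorem mem_span_detForm_real [FiniteDimensional ℂ E] {k : ℕ} (α : E [⋀^Fin k]→L[ℝ] ℂ) :
    α ∈ Submodule.span ℂ (Set.range fun l : Fin k → E →L[ℝ] ℝ =>
      detForm fun r => Complex.ofRealCLM.comp (l r)) := by
  have : FiniteDimensional ℝ E := FiniteDimensional.complexToReal E
  set b := Module.finBasis ℝ E
  set β : Fin (Module.finrank ℝ E) → E →L[ℝ] ℝ := fun m => LinearMap.toContinuousLinearMap (b.coord m)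
  -- Expand by multilinearity in a real basis, then antisymmetrise over all permutations of the
  -- arguments. The sum over permutations turns each product of coordinates into a determinant and
  -- costs the factor k!.
  have hα : ((k.factorial : ℕ) : ℂ) • α = ∑ idx : Fin k → Fin (Module.finrank ℝ E),
      α (fun r => b (idx r)) • detForm fun r => Complex.ofRealCLM.comp (β (idx r)) := by
    ext v
    have h1 : ∀ w : Fin k → E, α w = ∑ idx : Fin k → Fin (Module.finrank ℝ E),
        (∏ r, (β (idx r) (w r) : ℂ)) * α (fun r => b (idx r)) := by
      intro w
      have : w = fun r => ∑ m, β m (w r) • b m := by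
        funext r
        exact (b.sum_repr (w r)).symm
      conv_lhs => rw [this]
      rw [ContinuousAlternatingMap.map_sum]
      refine Finset.sum_congr rfl fun idx _ => ?_
      rw [ContinuousAlternatingMap.map_smul_univ, Complex.real_smul]
      push_cast
      rfl
    have h2 : ∀ σ : Equiv.Perm (Fin k), α v = Equiv.Perm.sign σ • α (v ∘ σ) := by
      intro σ
      have := α.toAlternatingMap.map_perm v σ
      have h3 : α (v ∘ σ) = Equiv.Perm.sign σ • α v := this
      rw [h3, smul_smul, Int.units_mul_self, one_smul]
    have h4 : (k.factorial : ℂ) * α v = ∑ σ : Equiv.Perm (Fin k), Equiv.Perm.sign σ • α (v ∘ σ) := by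
      rw [Finset.sum_congr rfl fun σ _ => (h2 σ).symm]
      rw [Finset.sum_const, Finset.card_univ, Fintype.card_perm, Fintype.card_fin, nsmul_eq_mul]
    rw [ContinuousAlternatingMap.smul_apply, smul_eq_mul, h4, ContinuousAlternatingMap.sum_apply]
    have h5 : ∀ σ : Equiv.Perm (Fin k), Equiv.Perm.sign σ • α (v ∘ σ) =
        ∑ idx : Fin k → Fin (Module.finrank ℝ E), Equiv.Perm.sign σ •
          ((∏ r, (β (idx r) ((v ∘ σ) r) : ℂ)) * α (fun r => b (idx r))) := fun σ => by
      rw [h1 (v ∘ σ), Finset.smul_sum]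
    simp only [h5]
    rw [Finset.sum_comm]
    refine Finset.sum_congr rfl fun idx _ => ?_
    rw [ContinuousAlternatingMap.smul_apply, detForm_apply, ← Matrix.det_transpose,
      Matrix.det_apply, smul_eq_mul, Finset.mul_sum]
    refine Finset.sum_congr rfl fun σ _ => ?_
    rw [mul_comm (α _), smul_mul_assoc]
    rfl
  have hk : ((k.factorial : ℕ) : ℂ) ≠ 0 := Nat.cast_ne_zero.2 k.factorial_ne_zero
  rw [← inv_smul_smul₀ hk α, hα]
  exact Submodule.smul_mem _ _ (Submodule.sum_mem _ fun idx _ => Submodule.smul_mem _ _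
    (Submodule.subset_span ⟨fun r => β (idx r), rfl⟩))

/-- The rows of a wedge product, linear on `s` and antilinear outside `s`. -/
def splitRows {k : ℕ} (s : Finset (Fin k)) (a b : Fin k → E →L[ℂ] ℂ) : Fin k → E →L[ℝ] ℂ :=
  s.piecewise (fun r => (a r).restrictScalars ℝ) (fun r => conjCov (b r))

theorem detForm_add_univ {k : ℕ} (τ τ' : Fin k → E →L[ℝ] ℂ) :
    detForm (τ + τ') = ∑ s : Finset (Fin k), detForm (s.piecewise τ τ') := by
  ext v
  rw [ContinuousAlternatingMap.sum_apply]
  simp only [← detAlt_apply]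
  exact (detAlt v).map_add_univ τ τ'

/-- A real covector l is the sum of the (1, 0)-covector `cplx l` / 2 and its conjugate. Substituting
this in every row of a wedge product of real covectors and expanding gives the rows of mixed type.
-/
theorem mem_span_splitRows [FiniteDimensional ℂ E] {k : ℕ} (α : E [⋀^Fin k]→L[ℝ] ℂ) :
    α ∈ Submodule.span ℂ {β | ∃ (s : Finset (Fin k)) (a b : Fin k → E →L[ℂ] ℂ),
      β = detForm (splitRows s a b)} := by
  refine Submodule.span_le.2 ?_ (mem_span_detForm_real α)
  rintro _ ⟨l, rfl⟩
  set a : Fin k → E →L[ℂ] ℂ := fun r => (1 / 2 : ℂ) • cplx (l r)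
  have h : (fun r => Complex.ofRealCLM.comp (l r)) =
      (fun r => (a r).restrictScalars ℝ) + fun r => conjCov (a r) := by
    funext r
    ext w
    change (l r w : ℂ) = (1 / 2 : ℂ) * cplx (l r) w + starRingEnd ℂ ((1 / 2 : ℂ) * cplx (l r) w)
    simp only [cplx_apply, map_mul, map_sub, Complex.conj_ofReal, Complex.conj_I, map_div₀, map_one,
      map_ofNat]
    ring
  simp only [h, detForm_add_univ]
  exact Submodule.sum_mem _ fun s _ => Submodule.subset_span ⟨s, a, a, rfl⟩

theorem detForm_splitRows_smul {k : ℕ} (s : Finset (Fin k)) (a b : Fin k → E →L[ℂ] ℂ) (z : ℂ)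
    (v : Fin k → E) : detForm (splitRows s a b) (fun j => z • v j) =
      z ^ s.card * starRingEnd ℂ z ^ (k - s.card) * detForm (splitRows s a b) v := by
  rw [detForm_smul_vec _ z (fun r => if r ∈ s then z else starRingEnd ℂ z)]
  · congr 1
    rw [Finset.prod_ite]
    simp only [Finset.prod_const]
    congr 2
    · simp
    · rw [Finset.filter_not, Finset.card_sdiff_of_subset (Finset.filter_subset _ _)]
      simp
  · intro r v
    simp only [splitRows, Finset.piecewise]
    split_ifs <;> simp

/-- The average over rotations of the vectors by roots of unity fixes α, by its bidegree, and kills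
every wedge product in which the number of linear rows is not p. So applying it to any expansion of
α removes the unwanted terms. -/
theorem mem_span_splitRows_of_hasBidegree [FiniteDimensional ℂ E] {p : ℕ}
    {α : E [⋀^Fin (2 * p)]→L[ℝ] ℂ} (hα : HasBidegree p p α) :
    α ∈ Submodule.span ℂ {β | ∃ (s : Finset (Fin (2 * p))) (a b : Fin (2 * p) → E →L[ℂ] ℂ),
      s.card = p ∧ β = detForm (splitRows s a b)} := by
  -- A product with |s| linear rows is multiplied by ζ^(2(|s| - p)). Since N is odd and larger than
  -- ||s| - p|, this factor is 1 only for |s| = p.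
  set N : ℕ := 2 * p + 1 with hN
  have hN0 : N ≠ 0 := by omega
  set ζ : ℂ := Complex.exp (2 * Real.pi * Complex.I / N)
  have hζ : IsPrimitiveRoot ζ N := Complex.isPrimitiveRoot_exp N hN0
  have hnorm : ∀ j : ℕ, ‖ζ ^ j‖ = 1 := by
    intro j
    rw [norm_pow, hζ.norm'_eq_one hN0, one_pow]
  have hconj : ∀ j : ℕ, starRingEnd ℂ (ζ ^ j) = (ζ ^ j) ^ (2 * p) := by
    intro j
    have h1 : ζ ^ j * starRingEnd ℂ (ζ ^ j) = 1 := by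
      rw [Complex.mul_conj, Complex.normSq_eq_norm_sq, hnorm]
      simp
    have h2 : ζ ^ j * (ζ ^ j) ^ (2 * p) = 1 := by
      rw [← pow_succ', ← pow_mul, mul_comm, pow_mul, hζ.pow_eq_one, one_pow]
    have h0 : ζ ^ j ≠ 0 := by
      intro h
      have := hnorm j
      simp [h] at this
    exact mul_left_cancel₀ h0 (h1.trans h2.symm)
  -- averaging over the roots of unity
  let A : (E [⋀^Fin (2 * p)]→L[ℝ] ℂ) →ₗ[ℂ] (E [⋀^Fin (2 * p)]→L[ℝ] ℂ) :=
    { toFun := fun β => ((N : ℂ)⁻¹) • ∑ j ∈ Finset.range N,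
        β.compContinuousLinearMap (mulVec E (ζ ^ j))
      map_add' := by
        intro β γ
        ext v
        simp only [ContinuousAlternatingMap.smul_apply, ContinuousAlternatingMap.sum_apply,
          ContinuousAlternatingMap.add_apply, smul_eq_mul, ← mul_add, ← Finset.sum_add_distrib]
        rfl
      map_smul' := by
        intro c β
        ext v
        simp only [ContinuousAlternatingMap.smul_apply, ContinuousAlternatingMap.sum_apply,
          RingHom.id_apply, smul_eq_mul]
        rw [mul_left_comm, Finset.mul_sum _ _ c]
        rfl }
  have hA : ∀ β v, A β v = ((N : ℂ)⁻¹) * ∑ j ∈ Finset.range N, β (fun i => ζ ^ j • v i) := by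
    intro β v
    change (((N : ℂ)⁻¹) • ∑ j ∈ Finset.range N, β.compContinuousLinearMap (mulVec E (ζ ^ j))) v = _
    rw [ContinuousAlternatingMap.smul_apply, ContinuousAlternatingMap.sum_apply, smul_eq_mul]
    rfl
  have hNc : (N : ℂ) ≠ 0 := Nat.cast_ne_zero.2 hN0
  have hAα : A α = α := by
    ext v
    rw [hA]
    have : ∀ j ∈ Finset.range N, α (fun i => ζ ^ j • v i) = α v := by
      intro j _
      rw [hα, ← mul_pow, Complex.mul_conj, Complex.normSq_eq_norm_sq, hnorm]
      simp
    rw [Finset.sum_congr rfl this]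
    simp [hNc]
  rw [← hAα]
  refine Submodule.span_induction (p := fun β _ => A β ∈ _) ?_ ?_ ?_ ?_ (mem_span_splitRows α)
  · rintro _ ⟨s, a, b, rfl⟩
    have hs : s.card ≤ 2 * p := by simpa using s.card_le_univ
    have h1 : A (detForm (splitRows s a b)) = ((N : ℂ)⁻¹ * ∑ j ∈ Finset.range N,
        (ζ ^ (s.card + 2 * p * (2 * p - s.card))) ^ j) • detForm (splitRows s a b) := by
      ext v
      rw [hA, ContinuousAlternatingMap.smul_apply, smul_eq_mul, mul_assoc, Finset.sum_mul]
      congr 1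
      refine Finset.sum_congr rfl fun j _ => ?_
      rw [detForm_splitRows_smul, hconj]
      congr 1
      ring
    by_cases hsp : s.card = p
    · rw [h1]
      exact Submodule.smul_mem _ _ (Submodule.subset_span ⟨s, a, b, hsp, rfl⟩)
    · have h2 : ζ ^ (s.card + 2 * p * (2 * p - s.card)) ≠ 1 := by
        intro h
        rw [hζ.pow_eq_one_iff_dvd] at h
        have h3 : (N : ℤ) ∣ (s.card + 2 * p * (2 * p - s.card) : ℤ) := by
          have := Int.natCast_dvd_natCast.2 h
          push_cast [Nat.cast_sub hs] at this
          exact this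
        -- Conjugation on N-th roots of unity is the power 2p, which is -1 modulo N. The exponent
        -- therefore reduces to |s| - (2p - |s|).
        have h4 : (N : ℤ) ∣ 2 * ((s.card : ℤ) - p) := by
          have h5 : (2 * ((s.card : ℤ) - p)) = (s.card + 2 * p * (2 * p - s.card) : ℤ) -
              N * (2 * p - s.card) := by
            rw [hN]
            push_cast
            ring
          rw [h5]
          exact dvd_sub h3 (dvd_mul_right _ _)
        have h6 : IsCoprime (N : ℤ) 2 := ⟨1, -p, by rw [hN]; push_cast; ring⟩
        have h7 := h6.dvd_of_dvd_mul_left h4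
        have h8 : (s.card : ℤ) - p = 0 := by
          refine Int.eq_zero_of_abs_lt_dvd h7 ?_
          rw [abs_lt]
          constructor <;> omega
        omega
      have h3 : ∑ j ∈ Finset.range N, (ζ ^ (s.card + 2 * p * (2 * p - s.card))) ^ j = 0 := by
        rw [geom_sum_eq h2, ← pow_mul, mul_comm, pow_mul, hζ.pow_eq_one, one_pow, sub_self, zero_div]
      have h4 : A (detForm (splitRows s a b)) = 0 := by
        ext v
        rw [h1, h3, mul_zero, ContinuousAlternatingMap.smul_apply, zero_smul]
        rfl
      rw [h4]
      exact Submodule.zero_mem _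
  · rw [map_zero]
    exact Submodule.zero_mem _
  · intro x y _ _ hx hy
    rw [map_add]
    exact Submodule.add_mem _ hx hy
  · intro c x _ hx
    rw [map_smul]
    exact Submodule.smul_mem _ _ hx

/-- This serves to interleave p linear rows with p antilinear rows, as in `mixedCoframe`; the
reordering changes a wedge product only by a sign. -/
theorem exists_perm_even_iff {p : ℕ} {s : Finset (Fin (2 * p))} (hs : s.card = p) :
    ∃ e : Equiv.Perm (Fin (2 * p)), ∀ r, e r ∈ s ↔ r.1 % 2 = 0 := by
  have hcard : Fintype.card {r : Fin (2 * p) // r.1 % 2 = 0} = Fintype.card {r // r ∈ s} := by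
    rw [Fintype.card_coe, hs]
    refine (Fintype.card_congr (β := Fin p)
      ⟨fun r => ⟨r.1.1 / 2, by omega⟩, fun i => ⟨⟨2 * i.1, by omega⟩, by simp⟩, ?_, ?_⟩).trans
      (Fintype.card_fin p)
    · rintro ⟨⟨r, h1⟩, h2⟩
      simp only [Subtype.mk.injEq, Fin.mk.injEq]
      simp only at h2
      omega
    · rintro ⟨i, hi⟩
      simp
  let e := Fintype.equivOfCardEq hcard
  refine ⟨e.extendSubtype, fun r => ⟨fun h => ?_, fun h => e.extendSubtype_mem r h⟩⟩
  by_contra h'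
  exact e.extendSubtype_not_mem r h' h

/-- Polarise one pair x ∧ conj y at a time. The induction is on the number m of leading positions at
which the two families may still differ. -/
theorem detForm_mixedCoframe_mem_span {p : ℕ} (m : ℕ) : ∀ a b : Fin p → E →L[ℂ] ℂ,
    (∀ r : Fin p, m ≤ r.1 → a r = b r) → detForm (mixedCoframe a b) ∈
      Submodule.span ℂ (Set.range fun a : Fin p → E →L[ℂ] ℂ => elemForm a) := by
  induction m with
  | zero =>
    intro a b hab
    have : a = b := funext fun r => hab r (Nat.zero_le _)
    subst this
    have hI : (Complex.I ^ p : ℂ) ≠ 0 := pow_ne_zero _ Complex.I_ne_zero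
    rw [← inv_smul_smul₀ hI (detForm (mixedCoframe a a))]
    exact Submodule.smul_mem _ _ (Submodule.subset_span ⟨a, rfl⟩)
  | succ m ih =>
    intro a b hab
    by_cases hm : m < p
    swap
    · exact ih a b fun r hr => absurd r.2 (by omega)
    set i : Fin p := ⟨m, hm⟩ with hi
    set x := a i
    set y := b i
    have hupd : ∀ c d : E →L[ℂ] ℂ, mixedCoframe (Function.update a i c) (Function.update b i d) =
        Function.update (Function.update (mixedCoframe a b) ⟨2 * m, by omega⟩
          (c.restrictScalars ℝ)) ⟨2 * m + 1, by omega⟩ (conjCov d) := by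
      intro c d
      funext r
      simp only [mixedCoframe, Function.update_apply, Fin.ext_iff, hi]
      by_cases h0 : r.1 % 2 = 0
      · have h1 : r.1 ≠ 2 * m + 1 := by omega
        by_cases h2 : r.1 = 2 * m
        · simp [h2]
        · have h3 : r.1 / 2 ≠ m := by omega
          simp [h0, h1, h2, h3]
      · have h1 : r.1 ≠ 2 * m := by omega
        by_cases h2 : r.1 = 2 * m + 1
        · have h3 : (2 * m + 1) / 2 = m := by omega
          simp [h2, h3]
        · have h3 : r.1 / 2 ≠ m := by omega
          simp [h0, h1, h2, h3]
    have hne : (⟨2 * m, by omega⟩ : Fin (2 * p)) ≠ ⟨2 * m + 1, by omega⟩ := by simp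
    -- The polarisation identity in position m: the weight i^j meets the conjugate of i^j exactly in
    -- the term x ∧ conj y, and the other three terms sum to zero over the fourth roots of unity.
    have hpol : detForm (mixedCoframe a b) = (1 / 4 : ℂ) • ∑ j : Fin 4, (Complex.I ^ j.1) •
        detForm (mixedCoframe (Function.update a i (x + Complex.I ^ j.1 • y))
          (Function.update b i (x + Complex.I ^ j.1 • y))) := by
      ext v
      rw [ContinuousAlternatingMap.smul_apply, ContinuousAlternatingMap.sum_apply]
      simp only [ContinuousAlternatingMap.smul_apply, hupd]
      set B : (E →L[ℝ] ℂ) → (E →L[ℝ] ℂ) → ℂ := fun c d =>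
        detAlt v (Function.update (Function.update (mixedCoframe a b) ⟨2 * m, by omega⟩ c)
          ⟨2 * m + 1, by omega⟩ d) with hB
      have hB1 : ∀ (c c' d) (t : ℂ), B (c + t • c') d = B c d + t * B c' d := by
        intro c c' d t
        simp only [hB, Function.update_comm hne]
        rw [(detAlt v).map_update_add, (detAlt v).map_update_smul]
        rfl
      have hB2 : ∀ (c d d') (t : ℂ), B c (d + t • d') = B c d + t * B c d' := by
        intro c d d' t
        simp only [hB]
        rw [(detAlt v).map_update_add, (detAlt v).map_update_smul]
        rfl
      have h1 : ∀ t : ℂ, (x + t • y).restrictScalars ℝ = x.restrictScalars ℝ +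
          t • y.restrictScalars ℝ := fun t => rfl
      have h2 : ∀ t : ℂ, conjCov (x + t • y) = conjCov x + (starRingEnd ℂ t) • conjCov y := by
        intro t
        ext w
        simp
      have h3 : ∀ c d : E →L[ℝ] ℂ, detForm (Function.update (Function.update (mixedCoframe a b)
          ⟨2 * m, by omega⟩ c) ⟨2 * m + 1, by omega⟩ d) v = B c d := fun c d =>
        (detAlt_apply _ _).symm
      have h4 : detForm (mixedCoframe a b) v = B (x.restrictScalars ℝ) (conjCov y) := by
        rw [← h3, ← hupd, Function.update_eq_self, Function.update_eq_self]
      simp only [h1, h2, h3, h4, hB1, hB2, Fin.sum_univ_four, map_pow, Complex.conj_I, smul_eq_mul]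
      generalize B (x.restrictScalars ℝ) (conjCov x) = B1
      generalize B (x.restrictScalars ℝ) (conjCov y) = B2
      generalize B (y.restrictScalars ℝ) (conjCov x) = B3
      generalize B (y.restrictScalars ℝ) (conjCov y) = B4
      have hI := Complex.I_sq
      have hI3 : Complex.I ^ 3 = - Complex.I := Complex.I_pow_three
      have v0 : (0 : Fin 4).1 = 0 := rfl
      have v1 : (1 : Fin 4).1 = 1 := rfl
      have v2 : (2 : Fin 4).1 = 2 := rfl
      have v3 : (3 : Fin 4).1 = 3 := rfl
      rw [v0, v1, v2, v3, neg_pow Complex.I 2, neg_pow Complex.I 3, hI, hI3]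
      linear_combination (B2 / 2 - B3 / 2) * hI
    rw [hpol]
    refine Submodule.smul_mem _ _ (Submodule.sum_mem _ fun j _ => Submodule.smul_mem _ _ (ih _ _ ?_))
    intro r hr
    by_cases hri : r = i
    · subst hri
      simp
    · rw [Function.update_of_ne hri, Function.update_of_ne hri]
      refine hab r ?_
      have : r.1 ≠ m := fun h => hri (Fin.ext h)
      omega

/-- The forms of bidegree `(p, p)` are spanned by the elementary forms. -/
theorem mem_span_elemForm [FiniteDimensional ℂ E] {p : ℕ} {α : E [⋀^Fin (2 * p)]→L[ℝ] ℂ}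
    (hα : HasBidegree p p α) :
    α ∈ Submodule.span ℂ (Set.range fun a : Fin p → E →L[ℂ] ℂ => elemForm a) := by
  refine Submodule.span_le.2 ?_ (mem_span_splitRows_of_hasBidegree hα)
  rintro _ ⟨s, a, b, hs, rfl⟩
  obtain ⟨e, he⟩ := exists_perm_even_iff hs
  have h1 : splitRows s a b ∘ e = mixedCoframe (fun k : Fin p => a (e ⟨2 * k.1, by omega⟩))
      (fun k : Fin p => b (e ⟨2 * k.1 + 1, by omega⟩)) := by
    funext r
    by_cases hr : r.1 % 2 = 0
    · have h2 : (⟨2 * (r.1 / 2), by omega⟩ : Fin (2 * p)) = r := Fin.ext (by simp only; omega)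
      simp only [Function.comp_apply, splitRows, mixedCoframe, if_pos hr, h2]
      rw [Finset.piecewise_eq_of_mem _ _ _ ((he r).2 hr)]
    · have h2 : (⟨2 * (r.1 / 2) + 1, by omega⟩ : Fin (2 * p)) = r := Fin.ext (by simp only; omega)
      simp only [Function.comp_apply, splitRows, mixedCoframe, if_neg hr, h2]
      rw [Finset.piecewise_eq_of_notMem _ _ _ (fun h => hr ((he r).1 h))]
  have h2 : detForm (splitRows s a b) = ((Equiv.Perm.sign e : ℤ) : ℂ) •
      detForm (splitRows s a b ∘ e) := by
    ext v
    rw [ContinuousAlternatingMap.smul_apply, ← detAlt_apply, ← detAlt_apply,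
      (detAlt v).map_perm, Units.smul_def, ← Int.cast_smul_eq_zsmul ℂ, smul_smul, ← Int.cast_mul,
      ← Units.val_mul, Int.units_mul_self]
    simp
  rw [h2, h1]
  exact Submodule.smul_mem _ _ (detForm_mixedCoframe_mem_span p _ _ fun r hr => absurd r.2 (by omega))

end Spanning

/-! ### Spanning by elementary forms close to a given one. -/

section SpanNear

variable {E : Type*} [NormedAddCommGroup E] [NormedSpace ℂ E]

/-- Since t is real, the conjugate rows are also affine in t. Expanding the wedge product over the
set s of rows in which b is chosen produces the power t^|s|. -/
theorem exists_polynomial_elemForm {p : ℕ} (a b : Fin p → E →L[ℂ] ℂ)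
    (f : (E [⋀^Fin (2 * p)]→L[ℝ] ℂ) →ₗ[ℂ] ℂ) :
    ∃ Q : Polynomial ℂ, ∀ t : ℝ, f (elemForm fun k => a k + (t : ℂ) • b k) = Q.eval (t : ℂ) := by
  refine ⟨∑ s : Finset (Fin (2 * p)), Polynomial.C (Complex.I ^ p *
    f (detForm (s.piecewise (mixedCoframe b b) (mixedCoframe a a)))) * Polynomial.X ^ s.card,
    fun t => ?_⟩
  have h1 : mixedCoframe (fun k => a k + (t : ℂ) • b k) (fun k => a k + (t : ℂ) • b k) =
      (fun r => (t : ℂ) • mixedCoframe b b r) + mixedCoframe a a := by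
    funext r
    ext v
    simp only [mixedCoframe, Pi.add_apply]
    split_ifs
    · simp [add_comm]
    · simp [add_comm]
  have h2 : ∀ s : Finset (Fin (2 * p)),
      detForm (s.piecewise (fun r => (t : ℂ) • mixedCoframe b b r) (mixedCoframe a a)) =
      ((t : ℂ) ^ s.card) • detForm (s.piecewise (mixedCoframe b b) (mixedCoframe a a)) := by
    intro s
    ext v
    rw [ContinuousAlternatingMap.smul_apply, ← detAlt_apply, ← detAlt_apply]
    have := (detAlt v).toMultilinearMap.map_piecewise_smul (fun _ => (t : ℂ))
      (s.piecewise (mixedCoframe b b) (mixedCoframe a a)) s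
    rw [Finset.prod_const] at this
    refine Eq.trans ?_ this
    change detAlt v _ = detAlt v _
    congr 1
    funext r
    by_cases hr : r ∈ s
    · simp only [Finset.piecewise_eq_of_mem _ _ _ hr]
    · simp only [Finset.piecewise_eq_of_notMem _ _ _ hr]
  rw [elemForm, h1, detForm_add_univ, map_smul, map_sum, Polynomial.eval_finsetSum, smul_eq_mul,
    Finset.mul_sum]
  refine Finset.sum_congr rfl fun s _ => ?_
  rw [h2, map_smul]
  simp only [Polynomial.eval_mul, Polynomial.eval_C, Polynomial.eval_pow, Polynomial.eval_X,
    smul_eq_mul]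
  ring

/-- The elementary forms of the covectors close to a given one, on each real line through it, span
the forms of bidegree `(p, p)`. -/
theorem mem_span_elemForm_near [FiniteDimensional ℂ E] {p : ℕ} (a : Fin p → E →L[ℂ] ℂ)
    {s : Set (Fin p → E →L[ℂ] ℂ)}
    (hs : ∀ b : Fin p → E →L[ℂ] ℂ, ∀ᶠ t : ℝ in 𝓝[>] 0, (fun k => a k + (t : ℂ) • b k) ∈ s)
    {α : E [⋀^Fin (2 * p)]→L[ℝ] ℂ} (hα : HasBidegree p p α) :
    α ∈ Submodule.span ℂ (elemForm '' s) := by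
  refine Submodule.span_le.2 ?_ (mem_span_elemForm hα)
  rintro _ ⟨c, rfl⟩
  by_contra hc
  obtain ⟨f, hf, hle⟩ := Submodule.exists_le_ker_of_notMem hc
  -- The functional separating `elemForm c` from the span becomes a polynomial along the line from a
  -- to c. It vanishes for all small t > 0, hence identically, and t = 1 gives a contradiction.
  obtain ⟨Q, hQ⟩ := exists_polynomial_elemForm a (fun k => c k - a k) f
  have hQ0 : Q = 0 := by
    refine Polynomial.eq_zero_of_infinite_isRoot Q ?_
    have h1 : {t : ℝ | (fun k => a k + (t : ℂ) • (c k - a k)) ∈ s} ∈ 𝓝[>] (0 : ℝ) := hs _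
    have h2 : Set.Infinite {t : ℝ | (fun k => a k + (t : ℂ) • (c k - a k)) ∈ s} := by
      obtain ⟨u, hu, h⟩ := mem_nhdsGT_iff_exists_Ioo_subset.1 h1
      exact (Set.Ioo_infinite hu).mono h
    refine (h2.image (Complex.ofReal_injective.injOn)).mono ?_
    rintro _ ⟨t, ht, rfl⟩
    change Q.eval (t : ℂ) = 0
    rw [← hQ]
    exact hle (Submodule.subset_span ⟨_, ht, rfl⟩)
  have h := hQ 1
  rw [hQ0, Polynomial.eval_zero] at h
  refine hf ?_
  rw [← h]
  congr 2
  funext k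
  simp

end SpanNear

/-! ### ddᶜ of forms on a vector space. -/

section FlatCalculus

variable {E : Type*} [NormedAddCommGroup E] [NormedSpace ℂ E]

/-- Evaluation on the tuples of basis vectors. -/
theorem exists_injective_evaluation [FiniteDimensional ℂ E] (k : ℕ) :
    ∃ (d : ℕ) (w : (Fin k → Fin d) → Fin k → E), ∀ α β : E [⋀^Fin k]→L[ℝ] ℂ,
      (∀ i, α (w i) = β (w i)) → α = β := by
  have : FiniteDimensional ℝ E := FiniteDimensional.complexToReal E
  set b := Module.finBasis ℝ E
  refine ⟨Module.finrank ℝ E, fun i r => b (i r), fun α β h => ?_⟩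
  have := Module.Basis.ext_multilinear (f := α.toMultilinearMap) (g := β.toMultilinearMap)
    (fun _ => b) h
  ext v
  exact DFunLike.congr_fun this v

instance finiteDimensional_alternating [FiniteDimensional ℂ E] (k : ℕ) :
    FiniteDimensional ℝ (E [⋀^Fin k]→L[ℝ] ℂ) := by
  obtain ⟨d, w, hw⟩ := exists_injective_evaluation (E := E) k
  let J : (E [⋀^Fin k]→L[ℝ] ℂ) →ₗ[ℝ] ((Fin k → Fin d) → ℂ) :=
    { toFun := fun α i => α (w i)
      map_add' := fun _ _ => rfl
      map_smul' := fun _ _ => rfl }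
  exact Module.Finite.of_injective J fun α β h => hw α β fun i => congrFun h i

instance finiteDimensional_alternating_complex [FiniteDimensional ℂ E] (k : ℕ) :
    FiniteDimensional ℂ (E [⋀^Fin k]→L[ℝ] ℂ) := by
  obtain ⟨d, w, hw⟩ := exists_injective_evaluation (E := E) k
  let J : (E [⋀^Fin k]→L[ℝ] ℂ) →ₗ[ℂ] ((Fin k → Fin d) → ℂ) :=
    { toFun := fun α i => α (w i)
      map_add' := fun _ _ => rfl
      map_smul' := fun _ _ => rfl }
  exact Module.Finite.of_injective J fun α β h => hw α β fun i => congrFun h i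

/-- A function with values in the alternating maps is smooth if its values at fixed vectors are. -/
theorem contDiffOn_alternating [FiniteDimensional ℂ E] {X : Type*} [NormedAddCommGroup X]
    [NormedSpace ℝ X] {k : ℕ} {n : WithTop ℕ∞} {φ : X → E [⋀^Fin k]→L[ℝ] ℂ} {s : Set X}
    (h : ∀ v, ContDiffOn ℝ n (fun x => φ x v) s) : ContDiffOn ℝ n φ s := by
  obtain ⟨d, w, hw⟩ := exists_injective_evaluation (E := E) k
  let J : (E [⋀^Fin k]→L[ℝ] ℂ) →ₗ[ℝ] ((Fin k → Fin d) → ℂ) :=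
    { toFun := fun α i => α (w i)
      map_add' := fun _ _ => rfl
      map_smul' := fun _ _ => rfl }
  have hJ : Function.Injective J := fun α β h => hw α β fun i => congrFun h i
  obtain ⟨L, hL⟩ := J.exists_leftInverse_of_injective (LinearMap.ker_eq_bot.2 hJ)
  have h1 : φ = fun x => L.toContinuousLinearMap (J (φ x)) := by
    funext x
    exact (LinearMap.congr_fun hL (φ x)).symm
  rw [h1]
  exact L.toContinuousLinearMap.contDiff.comp_contDiffOn (contDiffOn_pi.2 fun i => h (w i))

/-- `ddᶜ` of the product of a function and a constant form. -/
theorem extDeriv_rotD_smul_const {k : ℕ} {u : E → ℝ} {u' : E → E →L[ℝ] ℝ}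
    {u'' : E →L[ℝ] E →L[ℝ] ℝ} {x : E}
    (hu : ∀ y, HasFDerivAt u (u' y) y) (hu' : HasFDerivAt u' u'' x) (S : E [⋀^Fin k]→L[ℝ] ℂ)
    (v : Fin (k + 1 + 1) → E) :
    extDeriv (rotD (-Complex.I) fun y => u y • S) x v =
      ∑ i, (-1 : ℂ) ^ i.val * ∑ j, (-1 : ℂ) ^ j.val *
        ((u'' (v i) (-Complex.I • i.removeNth v j) : ℂ) * S (j.removeNth (i.removeNth v))) := by
  let Λ : (E →L[ℝ] ℝ) →L[ℝ] E [⋀^Fin (k + 1)]→L[ℝ] ℂ :=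
    (ContinuousAlternatingMap.alternatizeUncurryFinCLM (n := k) ℝ E ℂ).comp
      (((ContinuousLinearMap.smulRightL ℝ E (E [⋀^Fin k]→L[ℝ] ℂ)).flip S).comp
        ((ContinuousLinearMap.compL ℝ E E ℝ).flip (mulVec E (-Complex.I))))
  have hΛ : ∀ l w, Λ l w = ∑ j, (-1 : ℂ) ^ j.val *
      ((l (-Complex.I • w j) : ℂ) * S (j.removeNth w)) := by
    intro l w
    refine (ContinuousAlternatingMap.alternatizeUncurryFin_apply _ _).trans ?_
    refine Finset.sum_congr rfl fun j _ => ?_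
    rw [zsmul_eq_mul]
    push_cast
    rfl
  have h1 : rotD (-Complex.I) (fun y => u y • S) = fun y => Λ (u' y) := by
    funext y
    ext w
    have hd : HasFDerivAt (fun y => u y • S) ((u' y).smulRight S) y := (hu y).smul_const S
    rw [rotD_apply (by simp) hd.differentiableAt, hd.fderiv, hΛ]
    refine Finset.sum_congr rfl fun j _ => ?_
    rw [zsmul_eq_mul]
    push_cast
    rfl
  have h2 : HasFDerivAt (fun y => Λ (u' y)) (Λ.comp u'') x := Λ.hasFDerivAt.comp x hu'
  rw [h1, extDeriv, h2.fderiv, ContinuousAlternatingMap.alternatizeUncurryFin_apply]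
  refine Finset.sum_congr rfl fun i _ => ?_
  rw [ContinuousLinearMap.comp_apply, hΛ, zsmul_eq_mul]
  push_cast
  rfl

/-- `ddᶜ` of the product of a function and an elementary form, when the second derivative of the
function is a combination of squares of real covectors. -/
theorem extDeriv_rotD_smul_elemForm {q : ℕ} {ι : Type*} [Fintype ι] {u : E → ℝ}
    {u' : E → E →L[ℝ] ℝ} {u'' : E →L[ℝ] E →L[ℝ] ℝ} {x : E} (hu : ∀ y, HasFDerivAt u (u' y) y)
    (hu' : HasFDerivAt u' u'' x) (μ : ι → ℝ) (l : ι → E →L[ℝ] ℝ)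
    (hl : ∀ v w, u'' v w = ∑ m, μ m * (l m v * l m w)) (a : Fin q → E →L[ℂ] ℂ) :
    extDeriv (rotD (-Complex.I) fun y => u y • elemForm a) x =
      ∑ m, ((μ m / 2 : ℝ) : ℂ) • elemForm (q := q + 1) (Fin.cons (cplx (l m)) a) := by
  ext v
  rw [ContinuousAlternatingMap.sum_apply]
  refine (extDeriv_rotD_smul_const hu hu' _ v).trans ?_
  have h1 : ∀ m, (((μ m / 2 : ℝ) : ℂ) • elemForm (q := q + 1) (Fin.cons (cplx (l m)) a)) v =
      (μ m : ℂ) * ∑ i, (-1 : ℂ) ^ i.val * ((l m (v i) : ℂ) * ∑ j, (-1 : ℂ) ^ j.val *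
      ((l m (-Complex.I • i.removeNth v j) : ℂ) * elemForm a (j.removeNth (i.removeNth v)))) := by
    intro m
    rw [sum_sum_elemForm, ContinuousAlternatingMap.smul_apply, smul_eq_mul]
    push_cast
    ring
  simp only [h1, Finset.mul_sum]
  conv_rhs => rw [Finset.sum_comm]
  refine Finset.sum_congr rfl fun i _ => ?_
  conv_rhs => rw [Finset.sum_comm]
  refine Finset.sum_congr rfl fun j _ => ?_
  rw [hl]
  push_cast
  rw [Finset.sum_mul, Finset.mul_sum, Finset.mul_sum]
  refine Finset.sum_congr rfl fun m _ => ?_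
  ring

/-- The exterior derivative commutes with every smooth pullback, and multiplication of the vectors
by a complex number commutes with a pullback whose differential is complex linear. The two together
give the commutation of ddᶜ with holomorphic pullback. -/
theorem extDeriv_rotD_pullback {F : Type*} [NormedAddCommGroup F] [NormedSpace ℂ F] {k : ℕ}
    {θ : F → F [⋀^Fin k]→L[ℝ] ℂ} (hθ : ContDiff ℝ ∞ θ) {G : E → F} {y : E}
    (hG : ∀ᶠ z in 𝓝 y, ContDiffAt ℝ ∞ G z ∧
      ∀ (u : ℂ) (v : E), fderiv ℝ G z (u • v) = u • fderiv ℝ G z v) :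
    extDeriv (rotD (-Complex.I) fun z => (θ (G z)).compContinuousLinearMap (fderiv ℝ G z)) y =
      (extDeriv (rotD (-Complex.I) θ) (G y)).compContinuousLinearMap (fderiv ℝ G y) := by
  have hr : minSmoothness ℝ 2 ≤ (∞ : WithTop ℕ∞) := by
    rw [minSmoothness_of_isRCLikeNormedField]
    exact WithTop.coe_le_coe.2 le_top
  have hrot : ∀ {m : ℕ} (u : ℂ) (η : F → F [⋀^Fin m]→L[ℝ] ℂ) (z : E),
      (∀ (u : ℂ) (v : E), fderiv ℝ G z (u • v) = u • fderiv ℝ G z v) →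
      rot u (fun z => (η (G z)).compContinuousLinearMap (fderiv ℝ G z)) z =
        (rot u η (G z)).compContinuousLinearMap (fderiv ℝ G z) := by
    intro m u η z hz
    ext v
    change η (G z) (fun j => fderiv ℝ G z (u • v j)) = η (G z) (fun j => u • fderiv ℝ G z (v j))
    simp only [hz]
  have hθ' : ContDiff ℝ ∞ (rot (-Complex.I)⁻¹ θ) :=
    contDiffOn_univ.1 (rot_contDiffOn _ hθ.contDiffOn)
  have hθ'' : ContDiff ℝ ∞ (rotD (-Complex.I) θ) :=
    contDiffOn_univ.1 (rotD_contDiffOn _ isOpen_univ hθ.contDiffOn)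
  have h1 : rotD (-Complex.I) (fun z => (θ (G z)).compContinuousLinearMap (fderiv ℝ G z)) =ᶠ[𝓝 y]
      fun z => (rotD (-Complex.I) θ (G z)).compContinuousLinearMap (fderiv ℝ G z) := by
    filter_upwards [hG.eventually_nhds] with z hz
    have hz0 := hz.self_of_nhds
    have h2 : rot (-Complex.I)⁻¹ (fun z => (θ (G z)).compContinuousLinearMap (fderiv ℝ G z)) =ᶠ[𝓝 z]
        fun z => (rot (-Complex.I)⁻¹ θ (G z)).compContinuousLinearMap (fderiv ℝ G z) := by
      filter_upwards [hz] with w hw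
      exact hrot _ θ w hw.2
    have h3 := extDeriv_pullback (hθ'.differentiable (by simp) (G z)) hz0.1 hr
    rw [rotD, rotD, ← hrot _ _ z hz0.2]
    exact congrArg (fun α => α.compContinuousLinearMap (mulVec E (-Complex.I)))
      (h2.extDeriv_eq.trans h3)
  rw [h1.extDeriv_eq]
  exact extDeriv_pullback (hθ''.differentiable (by simp) (G y)) hG.self_of_nhds.1 hr

end FlatCalculus

/-! ### The exponential barrier in a ball and its ddᶜ. -/

section Barrier

/-- The derivative of `expNegInvGlue`. -/
def glueDeriv (t : ℝ) : ℝ := t⁻¹ ^ 2 * expNegInvGlue t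

/-- The second derivative of `expNegInvGlue`. -/
def glueDeriv₂ (t : ℝ) : ℝ := (t⁻¹ ^ 4 - 2 * t⁻¹ ^ 3) * expNegInvGlue t

theorem hasDerivAt_glue (t : ℝ) : HasDerivAt expNegInvGlue (glueDeriv t) t := by
  simpa [glueDeriv] using expNegInvGlue.hasDerivAt_polynomial_eval_inv_mul 1 t

theorem hasDerivAt_glueDeriv (t : ℝ) : HasDerivAt glueDeriv (glueDeriv₂ t) t := by
  have h := expNegInvGlue.hasDerivAt_polynomial_eval_inv_mul (Polynomial.X ^ 2) t
  simp only [Polynomial.eval_pow, Polynomial.eval_X] at h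
  have h1 : (Polynomial.X ^ 2 * (Polynomial.X ^ 2 - Polynomial.derivative (R := ℝ)
      (Polynomial.X ^ 2))).eval t⁻¹ * expNegInvGlue t = glueDeriv₂ t := by
    rw [glueDeriv₂]
    simp
    left
    ring
  rwa [h1] at h

theorem contDiff_glueDeriv : ContDiff ℝ ∞ glueDeriv := by
  have h := expNegInvGlue.contDiff_polynomial_eval_inv_mul (n := ⊤) (Polynomial.X ^ 2)
  simp only [Polynomial.eval_pow, Polynomial.eval_X] at h
  exact h

theorem contDiff_glueDeriv₂ : ContDiff ℝ ∞ glueDeriv₂ := by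
  have h := expNegInvGlue.contDiff_polynomial_eval_inv_mul (n := ⊤)
    (Polynomial.X ^ 4 - 2 * Polynomial.X ^ 3)
  simp only [Polynomial.eval_sub, Polynomial.eval_mul, Polynomial.eval_pow, Polynomial.eval_X,
    Polynomial.eval_ofNat] at h
  exact h

section Squares

variable {E : Type*} [NormedAddCommGroup E] [NormedSpace ℂ E] {ι : Type*} [Fintype ι]

/-- For s the sum of the squares and h = `expNegInvGlue`, the Hessian of h(R - s) is h″ ds ⊗ ds -
2h′ ∑ l_m ⊗ l_m. This is a combination of squares of covectors, as `extDeriv_rotD_smul_elemForm`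
requires. -/
theorem extDeriv_rotD_glue {q : ℕ} (l : ι → E →L[ℝ] ℝ) (c : E) (R : ℝ)
    (a : Fin q → E →L[ℂ] ℂ) (x : E) :
    extDeriv (rotD (-Complex.I) fun y =>
      expNegInvGlue (R - ∑ m, l m (y - c) ^ 2) • elemForm a) x =
      ((glueDeriv₂ (R - ∑ m, l m (x - c) ^ 2) / 2 : ℝ) : ℂ) •
        elemForm (q := q + 1) (Fin.cons (cplx (∑ m, (2 * l m (x - c)) • l m)) a) +
      ∑ m, ((-glueDeriv (R - ∑ m, l m (x - c) ^ 2) : ℝ) : ℂ) •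
        elemForm (q := q + 1) (Fin.cons (cplx (l m)) a) := by
  set s : E → ℝ := fun y => ∑ m, l m (y - c) ^ 2 with hs
  set s' : E → E →L[ℝ] ℝ := fun y => ∑ m, (2 * l m (y - c)) • l m with hs'
  have hlin : ∀ m y, HasFDerivAt (fun y => l m (y - c)) (l m) y := fun m y =>
    (l m).hasFDerivAt.comp y ((hasFDerivAt_id y).sub_const c)
  have h1 : ∀ y, HasFDerivAt s (s' y) y := by
    intro y
    refine HasFDerivAt.fun_sum fun m _ => ?_
    simpa using (hlin m y).pow 2
  have h2 : ∀ y, HasFDerivAt s' (∑ m, ((2 : ℝ) • l m).smulRight (l m)) y := by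
    intro y
    refine HasFDerivAt.fun_sum fun m _ => ?_
    exact ((hlin m y).const_mul 2).smul_const (l m)
  have h3 : ∀ y, HasFDerivAt (fun y => expNegInvGlue (R - s y)) ((-glueDeriv (R - s y)) • s' y) y := by
    intro y
    have := (hasDerivAt_glue (R - s y)).comp_hasFDerivAt y ((h1 y).const_sub R)
    rwa [smul_neg, ← neg_smul] at this
  have h4 : HasFDerivAt (fun y => -glueDeriv (R - s y)) (glueDeriv₂ (R - s x) • s' x) x := by
    have := ((hasDerivAt_glueDeriv (R - s x)).comp_hasFDerivAt x ((h1 x).const_sub R)).neg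
    rwa [smul_neg, neg_neg] at this
  have h5 := h4.smul (h2 x)
  -- The index `none` carries the gradient ds; the indices `some m` carry the covectors l_m.
  refine (extDeriv_rotD_smul_elemForm (ι := Option ι) h3 h5
    (fun o => o.elim (glueDeriv₂ (R - s x)) fun _ => -2 * glueDeriv (R - s x))
    (fun o => o.elim (s' x) l) ?_ a).trans ?_
  · intro v w
    rw [Fintype.sum_option]
    simp only [_root_.add_apply, _root_.smul_apply,
      _root_.sum_apply, ContinuousLinearMap.smulRight_apply, smul_eq_mul,
      Option.elim_none, Option.elim_some, Finset.mul_sum]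
    rw [add_comm]
    congr 1
    · ring
    · refine Finset.sum_congr rfl fun m _ => ?_
      ring
  · rw [Fintype.sum_option]
    simp only [Option.elim_none, Option.elim_some]
    congr 1
    refine Finset.sum_congr rfl fun m _ => ?_
    congr 2
    ring

end Squares

variable {q : ℕ}

/-- The coordinates on `ℂ^q`. -/
def coordForm (k : Fin q) : EuclideanSpace ℂ (Fin q) →L[ℂ] ℂ := EuclideanSpace.proj k

theorem coordForm_apply (k : Fin q) (z : EuclideanSpace ℂ (Fin q)) : coordForm k z = z k := rfl

/-- Real and imaginary parts of the coordinates. -/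
def realCoord : Fin q ⊕ Fin q → EuclideanSpace ℂ (Fin q) →L[ℝ] ℝ :=
  Sum.elim (fun k => Complex.reCLM.comp ((coordForm k).restrictScalars ℝ))
    fun k => Complex.imCLM.comp ((coordForm k).restrictScalars ℝ)

theorem norm_sq_eq_sum_realCoord (z : EuclideanSpace ℂ (Fin q)) :
    ‖z‖ ^ 2 = ∑ m, realCoord m z ^ 2 := by
  rw [EuclideanSpace.norm_sq_eq, Fintype.sum_sum_type, ← Finset.sum_add_distrib]
  refine Finset.sum_congr rfl fun k _ => ?_
  rw [Complex.sq_norm, Complex.normSq_apply]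
  simp [realCoord, coordForm_apply]
  ring

theorem cplx_realCoord_inl (k : Fin q) : cplx (realCoord (Sum.inl k)) = coordForm k := by
  ext z
  rw [cplx_apply]
  apply Complex.ext <;> simp [realCoord, coordForm_apply]

theorem cplx_realCoord_inr (k : Fin q) :
    cplx (realCoord (Sum.inr k)) = (-Complex.I) • coordForm k := by
  ext z
  rw [cplx_apply]
  apply Complex.ext <;> simp [realCoord, coordForm_apply]

/-- The coefficient of `ddᶜ` of the barrier `exp (-1 / (R - ‖z - c‖²))` in the direction `j`. -/
def barrierCoeff (c : EuclideanSpace ℂ (Fin q)) (R : ℝ) (j : Fin q)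
    (z : EuclideanSpace ℂ (Fin q)) : ℝ :=
  2 * glueDeriv₂ (R - ‖z - c‖ ^ 2) * ‖z j - c j‖ ^ 2 - 2 * glueDeriv (R - ‖z - c‖ ^ 2)

/-- With t = R - ‖z - c‖² and m = ‖z_j - c_j‖², the coefficient factors as 2 t⁻⁴ exp(-1/t) (m - t² -
2tm). For m bounded below the second derivative of the exponential dominates when t is small. -/
theorem barrierCoeff_pos {c : EuclideanSpace ℂ (Fin q)} {R : ℝ} {j : Fin q}
    {z : EuclideanSpace ℂ (Fin q)} (ht : 0 < R - ‖z - c‖ ^ 2)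
    (h : (R - ‖z - c‖ ^ 2) ^ 2 + 2 * (R - ‖z - c‖ ^ 2) * ‖z j - c j‖ ^ 2 < ‖z j - c j‖ ^ 2) :
    0 < barrierCoeff c R j z := by
  rw [barrierCoeff, glueDeriv, glueDeriv₂]
  generalize R - ‖z - c‖ ^ 2 = t at *
  generalize ‖z j - c j‖ ^ 2 = m at *
  have h1 : 2 * ((t⁻¹ ^ 4 - 2 * t⁻¹ ^ 3) * expNegInvGlue t) * m -
      2 * (t⁻¹ ^ 2 * expNegInvGlue t) =
      2 * t⁻¹ ^ 4 * expNegInvGlue t * (m - (t ^ 2 + 2 * t * m)) := by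
    field_simp
    ring
  rw [h1]
  have := expNegInvGlue.pos_of_pos ht
  have h2 : 0 < m - (t ^ 2 + 2 * t * m) := by linarith
  positivity

theorem barrierCoeff_of_nonpos {c : EuclideanSpace ℂ (Fin q)} {R : ℝ} {j : Fin q}
    {z : EuclideanSpace ℂ (Fin q)} (ht : R - ‖z - c‖ ^ 2 ≤ 0) : barrierCoeff c R j z = 0 := by
  rw [barrierCoeff, glueDeriv, glueDeriv₂, expNegInvGlue.zero_of_nonpos ht]
  ring

theorem contDiff_norm_sub_sq (c : EuclideanSpace ℂ (Fin q)) :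
    ContDiff ℝ ∞ fun z : EuclideanSpace ℂ (Fin q) => ‖z - c‖ ^ 2 := by
  simp only [norm_sq_eq_sum_realCoord]
  fun_prop

theorem contDiff_barrier (c : EuclideanSpace ℂ (Fin q)) (R : ℝ) :
    ContDiff ℝ ∞ fun z : EuclideanSpace ℂ (Fin q) => expNegInvGlue (R - ‖z - c‖ ^ 2) :=
  expNegInvGlue.contDiff.comp (contDiff_const.sub (contDiff_norm_sub_sq c))

theorem contDiff_barrierCoeff (c : EuclideanSpace ℂ (Fin q)) (R : ℝ) (j : Fin q) :
    ContDiff ℝ ∞ (barrierCoeff c R j) := by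
  have h : ContDiff ℝ ∞ fun z : EuclideanSpace ℂ (Fin q) => R - ‖z - c‖ ^ 2 :=
    contDiff_const.sub (contDiff_norm_sub_sq c)
  have h1 : ContDiff ℝ ∞ fun z : EuclideanSpace ℂ (Fin q) => ‖z j - c j‖ ^ 2 := by
    have h2 : ∀ z : EuclideanSpace ℂ (Fin q), ‖z j - c j‖ ^ 2 =
        realCoord (Sum.inl j) (z - c) ^ 2 + realCoord (Sum.inr j) (z - c) ^ 2 := by
      intro z
      rw [Complex.sq_norm, Complex.normSq_apply]
      simp [realCoord, coordForm_apply]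
      ring
    simp only [h2]
    fun_prop
  exact ((contDiff_const.mul (contDiff_glueDeriv₂.comp h)).mul h1).sub
    (contDiff_const.mul (contDiff_glueDeriv.comp h))

/-- The coordinate covectors, that of index `j` being omitted. -/
def omitForms (j : Fin (q + 1)) (k : Fin q) : EuclideanSpace ℂ (Fin (q + 1)) →L[ℂ] ℂ :=
  coordForm (j.succAbove k)

/-- The coordinate covectors, that of index `j` being put first. -/
def frontForms (j : Fin (q + 1)) : Fin (q + 1) → EuclideanSpace ℂ (Fin (q + 1)) →L[ℂ] ℂ :=
  Fin.cons (coordForm j) (omitForms j)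

/-- Wedging with all the other coordinates leaves only the j-th component. The gradient has j-th
component 2 conj(z_j - c_j), which produces the term in `glueDeriv₂`. The real and imaginary parts
of z_j each contribute one copy of -`glueDeriv`. -/
theorem extDeriv_rotD_barrier (c : EuclideanSpace ℂ (Fin (q + 1))) (R : ℝ) (j : Fin (q + 1))
    (z : EuclideanSpace ℂ (Fin (q + 1))) :
    extDeriv (rotD (-Complex.I) fun y : EuclideanSpace ℂ (Fin (q + 1)) =>
      expNegInvGlue (R - ‖y - c‖ ^ 2) • elemForm (omitForms j)) z =
      (barrierCoeff c R j z : ℂ) • elemForm (q := q + 1) (frontForms j) := by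
  have hsum : ∀ d : Fin (q + 1) → ℂ,
      elemForm (q := q + 1) (Fin.cons (∑ k, d k • coordForm k) (omitForms j)) =
        ((‖d j‖ ^ 2 : ℝ) : ℂ) • elemForm (q := q + 1) (frontForms j) :=
    fun d => elemForm_cons_sum (fun k => coordForm k) d j
  have hsingle : ∀ (k : Fin (q + 1)) (d : ℂ),
      elemForm (q := q + 1) (Fin.cons (d • coordForm k) (omitForms j)) =
        (if k = j then ((‖d‖ ^ 2 : ℝ) : ℂ) else 0) • elemForm (q := q + 1) (frontForms j) := by
    intro k d
    have h := hsum (Pi.single k d)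
    have h1 : ∑ i, (Pi.single k d : Fin (q + 1) → ℂ) i • coordForm i = d • coordForm k := by
      rw [Finset.sum_eq_single k]
      · simp
      · intro i _ hi
        rw [Pi.single_eq_of_ne hi]
        ext w
        simp
      · simp
    rw [h1] at h
    rw [h]
    congr 1
    by_cases hk : k = j
    · subst hk
      simp
    · simp [hk]
  have hgrad : cplx (∑ m, (2 * realCoord m (z - c)) • realCoord m) =
      ∑ k, (2 * starRingEnd ℂ (z k - c k)) • coordForm k := by
    have h1 : cplx (∑ m, (2 * realCoord m (z - c)) • realCoord m) =
        ∑ m, ((2 * realCoord m (z - c) : ℝ) : ℂ) • cplx (realCoord m) := by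
      ext w
      simp only [cplx_apply, _root_.sum_apply, _root_.smul_apply,
        smul_eq_mul]
      push_cast
      rw [Finset.mul_sum, ← Finset.sum_sub_distrib]
      refine Finset.sum_congr rfl fun m _ => ?_
      ring
    rw [h1, Fintype.sum_sum_type, ← Finset.sum_add_distrib]
    refine Finset.sum_congr rfl fun k _ => ?_
    rw [cplx_realCoord_inl, cplx_realCoord_inr, smul_smul]
    ext w
    simp only [_root_.add_apply, _root_.smul_apply, smul_eq_mul, ← add_mul]
    congr 1
    apply Complex.ext
    · simp [realCoord, coordForm_apply]
    · simp [realCoord, coordForm_apply]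
      ring
  have h := extDeriv_rotD_glue (realCoord (q := q + 1)) c R (omitForms j) z
  simp only [← norm_sq_eq_sum_realCoord] at h
  rw [h, hgrad, hsum, Fintype.sum_sum_type]
  simp only [cplx_realCoord_inl, cplx_realCoord_inr, hsingle]
  have hone : ∀ k : Fin (q + 1), elemForm (q := q + 1) (Fin.cons (coordForm k) (omitForms j)) =
      (if k = j then (1 : ℂ) else 0) • elemForm (q := q + 1) (frontForms j) := by
    intro k
    have := hsingle k 1
    rwa [one_smul, norm_one, one_pow, Complex.ofReal_one] at this
  simp only [hone]
  ext v
  simp only [ContinuousAlternatingMap.add_apply, ContinuousAlternatingMap.sum_apply,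
    ContinuousAlternatingMap.smul_apply, smul_eq_mul]
  generalize elemForm (q := q + 1) (frontForms j) v = w
  simp only [norm_neg, Complex.norm_I, one_pow, norm_mul, RCLike.norm_conj, Complex.norm_ofNat]
  rw [barrierCoeff]
  simp
  ring

end Barrier

/-! ### Cutoff functions and localisation of currents on their support. -/

section Cutoff

variable {E : Type*} [NormedAddCommGroup E] [NormedSpace ℂ E]
variable {V : Type*} [TopologicalSpace V] [ChartedSpace E V]

theorem contMDiff_ofReal {χ : V → ℝ} (h : ContMDiff 𝓘(ℝ, E) 𝓘(ℝ, ℝ) ∞ χ) :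
    ContMDiff 𝓘(ℝ, E) 𝓘(ℝ, ℂ) ∞ fun x => (χ x : ℂ) :=
  Complex.ofRealCLM.contDiff.contMDiff.comp h

theorem tsupport_ofReal (χ : V → ℝ) : tsupport (fun x => (χ x : ℂ)) = tsupport χ := by
  simp [tsupport, Function.support]

theorem Current.isClosed_support {p : ℕ} (T : Current E V p) : IsClosed T.support := by
  rw [← isOpen_compl_iff, isOpen_iff_mem_nhds]
  intro x hx
  simp only [Current.support, Set.mem_compl_iff, Set.mem_ofPred_eq, not_forall] at hx
  obtain ⟨O, hO, hxO, h⟩ := hx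
  filter_upwards [hO.mem_nhds hxO] with y hy hy'
  exact h (hy' O hO hy)

variable [IsManifold 𝓘(ℂ, E) ω V]

theorem exists_cutoff [FiniteDimensional ℂ E] [T2Space V] [SecondCountableTopology V]
    {K O : Set V} (hK : IsCompact K) (hO : IsOpen O) (hKO : K ⊆ O) :
    ∃ χ : V → ℝ, ContMDiff 𝓘(ℝ, E) 𝓘(ℝ, ℝ) ∞ χ ∧ HasCompactSupport χ ∧ tsupport χ ⊆ O ∧
      (∀ x ∈ K, ∀ᶠ y in 𝓝 x, χ y = 1) ∧ ∀ x, 0 ≤ χ x := by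
  have : FiniteDimensional ℝ E := FiniteDimensional.complexToReal E
  have : IsManifold 𝓘(ℝ, E) ∞ V := isManifold_real
  have : LocallyCompactSpace V := ChartedSpace.locallyCompactSpace E V
  obtain ⟨L, hL, hKL, hLO⟩ := exists_compact_between hK hO hKO
  obtain ⟨χ, h1, h0, h⟩ := exists_contMDiffMap_one_nhds_of_subset_interior (n := ⊤) 𝓘(ℝ, E)
    hK.isClosed hKL
  have hsupp : tsupport χ ⊆ L := closure_minimal
    (fun x hx => by_contra fun hx' => hx (h0 x hx')) hL.isClosed
  exact ⟨χ, χ.contMDiff, HasCompactSupport.of_support_subset_isCompact hL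
    ((subset_tsupport _).trans hsupp), hsupp.trans hLO,
    fun x hx => (h1.filter_mono (nhds_le_nhdsSet hx)), fun x => (h x).1⟩

theorem contDiffOn_comp_symm {F : Type*} [NormedAddCommGroup F] [NormedSpace ℝ F] {ψ : V → F}
    (hψ : ContMDiff 𝓘(ℝ, E) 𝓘(ℝ, F) ∞ ψ) {c : OpenPartialHomeomorph V E} (hc : c ∈ atlas E V) :
    ContDiffOn ℝ ∞ (ψ ∘ c.symm) c.target := by
  have : IsManifold 𝓘(ℝ, E) ∞ V := isManifold_real
  exact contMDiffOn_iff_contDiffOn.1 (hψ.comp_contMDiffOn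
    (contMDiffOn_symm_of_mem_maximalAtlas (IsManifold.subset_maximalAtlas hc)))

/-- The product of a test form and a smooth function. -/
def smulTest {q : ℕ} {ψ : V → ℂ} (hψ : ContMDiff 𝓘(ℝ, E) 𝓘(ℝ, ℂ) ∞ ψ) (φ : TestForm E V q) :
    TestForm E V q :=
  ⟨fun x => ψ x • φ.1 x, fun _ hc => (contDiffOn_comp_symm hψ hc).smul (φ.2.1 _ hc),
    φ.2.2.1.mono' fun x hx => subset_tsupport _ fun h0 => hx (by
      change ψ x • φ.1 x = 0
      rw [h0]
      ext v
      simp),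
    fun x => (φ.2.2.2 x).smul _⟩

theorem smulTest_apply {q : ℕ} {ψ : V → ℂ} (hψ : ContMDiff 𝓘(ℝ, E) 𝓘(ℝ, ℂ) ∞ ψ)
    (φ : TestForm E V q) (x : V) : (smulTest hψ φ).1 x = ψ x • φ.1 x := rfl

theorem smulTest_eq_zero {q : ℕ} {ψ : V → ℂ} (hψ : ContMDiff 𝓘(ℝ, E) 𝓘(ℝ, ℂ) ∞ ψ)
    (φ : TestForm E V q) {x : V} (h : ψ x = 0 ∨ φ.1 x = 0) : (smulTest hψ φ).1 x = 0 := by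
  ext v
  rw [smulTest_apply, ContinuousAlternatingMap.smul_apply]
  rcases h with h | h <;> simp [h]

/-- Each point of the support of φ has an open neighbourhood on which the current vanishes.
Compactness together with a cutoff that glues two such open sets gives one open set containing the
whole support of φ. -/
theorem Current.apply_eq_zero [FiniteDimensional ℂ E] [T2Space V] [SecondCountableTopology V]
    {p : ℕ} (T : Current E V p) {φ : TestForm E V p} (hφ : Disjoint (tsupport φ.1) T.support) :
    T.toFun φ = 0 := by
  have key : ∃ O : Set V, IsOpen O ∧ tsupport φ.1 ⊆ O ∧
      ∀ ψ : TestForm E V p, tsupport ψ.1 ⊆ O → T.toFun ψ = 0 := by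
    refine IsCompact.induction_on (p := fun K => ∃ O : Set V, IsOpen O ∧ K ⊆ O ∧
      ∀ ψ : TestForm E V p, tsupport ψ.1 ⊆ O → T.toFun ψ = 0) φ.2.2.1 ?_ ?_ ?_ ?_
    · refine ⟨∅, isOpen_empty, subset_rfl, fun ψ hψ => ?_⟩
      have : ψ = 0 := Subtype.ext (tsupport_eq_empty_iff.1 (Set.subset_empty_iff.1 hψ))
      rw [this, map_zero]
    · rintro s t hst ⟨O, h1, h2, h3⟩
      exact ⟨O, h1, hst.trans h2, h3⟩
    · rintro s t ⟨O, h1, h2, h3⟩ ⟨O', h1', h2', h3'⟩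
      refine ⟨O ∪ O', h1.union h1', Set.union_subset_union h2 h2', fun ψ hψ => ?_⟩
      -- A cutoff equal to 1 near this compact set and supported in O splits ψ into a part supported
      -- in O and a remainder supported in O'.
      have hK : IsCompact (tsupport ψ.1 \ O') := ψ.2.2.1.diff h1'
      have hKO : tsupport ψ.1 \ O' ⊆ O := fun x hx => (hψ hx.1).resolve_right hx.2
      obtain ⟨χ, hχ, -, hχO, hχ1, -⟩ := exists_cutoff (E := E) hK h1 hKO
      have hχ' := contMDiff_ofReal hχ
      have hχ'' : ContMDiff 𝓘(ℝ, E) 𝓘(ℝ, ℂ) ∞ fun x => 1 - (χ x : ℂ) :=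
        contMDiff_const.sub hχ'
      have hsum : ψ = smulTest hχ' ψ + smulTest hχ'' ψ := by
        refine Subtype.ext (funext fun x => ?_)
        ext v
        change ψ.1 x v = (χ x : ℂ) * ψ.1 x v + (1 - (χ x : ℂ)) * ψ.1 x v
        ring
      have e1 : tsupport (smulTest hχ' ψ).1 ⊆ O := by
        refine (closure_mono ?_).trans hχO
        intro x hx hx'
        exact hx (smulTest_eq_zero _ _ (Or.inl (by simp [hx'])))
      have e2 : tsupport (smulTest hχ'' ψ).1 ⊆ O' := by
        intro x hx
        have hx1 : x ∈ tsupport ψ.1 := by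
          refine closure_mono (fun y hy => ?_) hx
          exact fun hy' => hy (smulTest_eq_zero hχ'' ψ (Or.inr hy'))
        by_contra hxO
        refine notMem_tsupport_iff_eventuallyEq.2 ?_ hx
        filter_upwards [hχ1 x ⟨hx1, hxO⟩] with y hy
        exact smulTest_eq_zero _ _ (Or.inl (by simp [hy]))
      rw [hsum, map_add, h3 _ e1, h3' _ e2, add_zero]
    · intro x hx
      have hx' : x ∉ T.support := Set.disjoint_left.1 hφ hx
      simp only [Current.support, Set.mem_ofPred_eq, not_forall, not_exists, not_and, not_not] at hx'
      obtain ⟨O, hO, hxO, h⟩ := hx'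
      exact ⟨O, mem_nhdsWithin_of_mem_nhds (hO.mem_nhds hxO), O, hO, subset_rfl, h⟩
  obtain ⟨O, -, h2, h3⟩ := key
  exact h3 φ h2

/-- Only the germs along the support matter. The ddᶜ of a form cut off near the support may thus be
replaced by its value without derivatives of the cutoff. -/
theorem Current.apply_congr [FiniteDimensional ℂ E] [T2Space V] [SecondCountableTopology V]
    {p : ℕ} (T : Current E V p) {φ ψ : TestForm E V p}
    (h : ∀ x ∈ T.support, φ.1 =ᶠ[𝓝 x] ψ.1) : T.toFun φ = T.toFun ψ := by
  rw [← sub_eq_zero, ← map_sub]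
  refine T.apply_eq_zero (Set.disjoint_left.2 fun x hx hxT => ?_)
  refine notMem_tsupport_iff_eventuallyEq.2 ?_ hx
  filter_upwards [h x hxT] with y hy
  change φ.1 y - ψ.1 y = 0
  rw [hy, sub_self]

end Cutoff

/-! ### Pullbacks of constant forms by holomorphic maps. -/

section Pullback

variable {E : Type*} [NormedAddCommGroup E] [NormedSpace ℂ E]
variable {V : Type*} [TopologicalSpace V] [ChartedSpace E V]

variable {P : Type*} [NormedAddCommGroup P] [NormedSpace ℂ P]

variable (E) in
/-- The real differential of a map from the manifold to a vector space. -/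
def diffAt (F : V → P) (x : V) : E →L[ℝ] P := mfderiv 𝓘(ℝ, E) 𝓘(ℝ, P) F x

variable (E) in
/-- The pullback by `F` of a constant form, multiplied by the function `ψ`. -/
def pullForm {k : ℕ} (ψ : V → ℂ) (F : V → P) (S : P [⋀^Fin k]→L[ℝ] ℂ) (x : V) :
    E [⋀^Fin k]→L[ℝ] ℂ :=
  ψ x • S.compContinuousLinearMap (diffAt E F x)

variable (E) in
/-- The complex differential of a map from the manifold to a vector space. -/
def holDiff (F : V → P) (x : V) : E →L[ℂ] P := mfderiv 𝓘(ℂ, E) 𝓘(ℂ, P) F x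

theorem mdifferentiableAt_of_holomorphic {F : V → P} {W : Set V}
    (hF : ContMDiffOn 𝓘(ℂ, E) 𝓘(ℂ, P) ω F W) (hW : IsOpen W) {x : V} (hx : x ∈ W) :
    MDifferentiableAt 𝓘(ℂ, E) 𝓘(ℂ, P) F x :=
  ((hF x hx).contMDiffAt (hW.mem_nhds hx)).mdifferentiableAt (by simp)

theorem diffAt_eq_of_holomorphic {F : V → P} {W : Set V}
    (hF : ContMDiffOn 𝓘(ℂ, E) 𝓘(ℂ, P) ω F W) (hW : IsOpen W) {x : V} (hx : x ∈ W) :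
    diffAt E F x = (holDiff E F x).restrictScalars ℝ :=
  (hasMFDerivAt_restrictScalars (E := E) (F := P) (mdifferentiableAt_of_holomorphic hF hW hx).hasMFDerivAt).mfderiv

/-- A complex linear differential pulls an elementary form back to an elementary form. Off W, where
F is arbitrary, the factor χ makes the form zero. -/
theorem isStronglyPositive_pullForm {F : V → P} {W : Set V}
    (hF : ContMDiffOn 𝓘(ℂ, E) 𝓘(ℂ, P) ω F W) (hW : IsOpen W) {χ : V → ℝ} (h0 : ∀ x, 0 ≤ χ x)
    (hχ : ∀ x ∉ W, χ x = 0) {q : ℕ} (a : Fin q → P →L[ℂ] ℂ) (x : V) :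
    IsStronglyPositive (pullForm E (fun x => (χ x : ℂ)) F (elemForm a) x) := by
  by_cases hx : x ∈ W
  · refine ⟨1, fun _ => χ x, fun _ k => (a k).comp (holDiff E F x),
      fun _ => h0 x, fun v => ?_⟩
    rw [pullForm, diffAt_eq_of_holomorphic hF hW hx, elemForm_comp,
      ContinuousAlternatingMap.smul_apply, elemForm_apply]
    simp
  · refine ⟨0, fun _ => 0, fun _ _ => 0, fun _ => le_rfl, fun v => ?_⟩
    change (χ x : ℂ) * _ = _
    rw [hχ x hx]
    simp

variable [IsManifold 𝓘(ℂ, E) ω V]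

theorem eq_of_inChart_eq {k : ℕ} {c : OpenPartialHomeomorph V E} (hc : c ∈ atlas E V) {x : V}
    (hx : x ∈ c.source) {φ ψ : V → E [⋀^Fin k]→L[ℝ] ℂ}
    (h : inChart c φ (c x) = inChart c ψ (c x)) : φ x = ψ x := by
  have : IsManifold 𝓘(ℝ, E) ∞ V := isManifold_real
  have : IsManifold 𝓘(ℝ, E) 1 V := IsManifold.of_le (n := ∞) (by simp)
  have h1 : MDifferentiableAt 𝓘(ℝ, E) 𝓘(ℝ, E) c x := mdifferentiableAt_atlas hc hx
  have h2 : MDifferentiableAt 𝓘(ℝ, E) 𝓘(ℝ, E) c.symm (c x) :=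
    mdifferentiableAt_atlas_symm hc (c.map_source hx)
  have h3 := mfderiv_comp x h2 h1
  have h4 : c.symm ∘ c =ᶠ[𝓝 x] id := by
    filter_upwards [c.open_source.mem_nhds hx] with z hz
    exact c.left_inv hz
  rw [h4.mfderiv_eq, mfderiv_id] at h3
  have h5 : ∀ v : E, dparam c (c x) (dchart c x v) = v := fun v =>
    (DFunLike.congr_fun h3 v).symm
  ext v
  have h6 := DFunLike.congr_fun h fun j => dchart c x (v j)
  change φ (c.symm (c x)) (fun j => dparam c (c x) (dchart c x (v j))) =
    ψ (c.symm (c x)) (fun j => dparam c (c x) (dchart c x (v j))) at h6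
  simpa only [h5, c.left_inv hx] using h6

theorem inChart_ddc {k : ℕ} {φ : V → E [⋀^Fin k]→L[ℝ] ℂ} (hφ : IsSmoothForm φ)
    {c : OpenPartialHomeomorph V E} (hc : c ∈ atlas E V) {y : E} (hy : y ∈ c.target) :
    inChart c (ddc φ) y = extDeriv (rotD (-Complex.I) (inChart c φ)) y := by
  have hdc : Set.EqOn (inChart c (extDc φ)) (rotD (-Complex.I) (inChart c φ)) c.target := by
    intro y hy
    have h1 : inChart c (rot Complex.I φ) =ᶠ[𝓝 y] rot (-Complex.I)⁻¹ (inChart c φ) := by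
      filter_upwards [c.open_target.mem_nhds hy] with z hz
      rw [inChart_rot hc hz]
      simp
    rw [extDc, inChart_rot hc hy, rotD]
    simp only [rot, inChart_extD (hφ.rot Complex.I) hc hy]
    rw [← h1.extDeriv_eq]
  rw [ddc, inChart_extD hφ.extDc hc hy]
  exact (Filter.eventuallyEq_of_mem (c.open_target.mem_nhds hy) hdc).extDeriv_eq

theorem contDiffOn_holomorphic_comp_symm {F : V → P} {W : Set V}
    (hF : ContMDiffOn 𝓘(ℂ, E) 𝓘(ℂ, P) ω F W) {c : OpenPartialHomeomorph V E} (hc : c ∈ atlas E V) :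
    ContDiffOn ℂ ω (F ∘ c.symm) (c.target ∩ c.symm ⁻¹' W) := by
  refine contMDiffOn_iff_contDiffOn.1 (hF.comp (t := W)
    ((contMDiffOn_symm_of_mem_maximalAtlas (IsManifold.subset_maximalAtlas hc)).mono
      Set.inter_subset_left) fun y hy => hy.2)

theorem contDiffAt_holomorphic_comp_symm {F : V → P} {W : Set V}
    (hF : ContMDiffOn 𝓘(ℂ, E) 𝓘(ℂ, P) ω F W) (hW : IsOpen W) {c : OpenPartialHomeomorph V E}
    (hc : c ∈ atlas E V) {y : E} (hy : y ∈ c.target) (hy' : c.symm y ∈ W) :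
    ContDiffAt ℝ ∞ (F ∘ c.symm) y ∧
      ∀ (u : ℂ) (v : E), fderiv ℝ (F ∘ c.symm) y (u • v) = u • fderiv ℝ (F ∘ c.symm) y v := by
  have h := (contDiffOn_holomorphic_comp_symm hF hc).contDiffAt
    ((c.isOpen_inter_preimage_symm hW).mem_nhds ⟨hy, hy'⟩)
  refine ⟨(h.restrict_scalars ℝ).of_le le_top, fun u v => ?_⟩
  rw [(h.differentiableAt (by simp)).fderiv_restrictScalars ℝ]
  exact map_smul (fderiv ℂ (F ∘ c.symm) y) u v

theorem diffAt_comp_dparam {F : V → P} {W : Set V}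
    (hF : ContMDiffOn 𝓘(ℂ, E) 𝓘(ℂ, P) ω F W) (hW : IsOpen W) {c : OpenPartialHomeomorph V E}
    (hc : c ∈ atlas E V) {y : E} (hy : y ∈ c.target) (hy' : c.symm y ∈ W) :
    (diffAt E F (c.symm y)).comp (dparam c y) = fderiv ℝ (F ∘ c.symm) y := by
  have : IsManifold 𝓘(ℝ, E) ∞ V := isManifold_real
  have : IsManifold 𝓘(ℝ, E) 1 V := IsManifold.of_le (n := ∞) (by simp)
  have h1 : MDifferentiableAt 𝓘(ℝ, E) 𝓘(ℝ, P) F (c.symm y) := (hasMFDerivAt_restrictScalars (E := E) (F := P)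
    (mdifferentiableAt_of_holomorphic hF hW hy').hasMFDerivAt).mdifferentiableAt
  rw [← mfderiv_eq_fderiv]
  exact (mfderiv_comp y h1 (mdifferentiableAt_atlas_symm hc hy)).symm

theorem inChart_pullForm {k : ℕ} {F : V → P} {W : Set V}
    (hF : ContMDiffOn 𝓘(ℂ, E) 𝓘(ℂ, P) ω F W) (ψ : V → ℂ) (S : P [⋀^Fin k]→L[ℝ] ℂ) (hW : IsOpen W)
    {c : OpenPartialHomeomorph V E} (hc : c ∈ atlas E V) {y : E} (hy : y ∈ c.target)
    (hy' : c.symm y ∈ W) :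
    inChart c (pullForm E ψ F S) y =
      ψ (c.symm y) • S.compContinuousLinearMap (fderiv ℝ (F ∘ c.symm) y) := by
  rw [← diffAt_comp_dparam hF hW hc hy hy']
  rfl

theorem contDiffOn_flatPull [FiniteDimensional ℂ E] {k : ℕ} {F : V → P} {W : Set V}
    (hF : ContMDiffOn 𝓘(ℂ, E) 𝓘(ℂ, P) ω F W) (S : P [⋀^Fin k]→L[ℝ] ℂ)
    (hW : IsOpen W) {c : OpenPartialHomeomorph V E} (hc : c ∈ atlas E V) :
    ContDiffOn ℝ ∞ (fun y => S.compContinuousLinearMap (fderiv ℝ (F ∘ c.symm) y))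
      (c.target ∩ c.symm ⁻¹' W) := by
  have hopen := c.isOpen_inter_preimage_symm hW
  have h : ContDiffOn ℝ ∞ (F ∘ c.symm) (c.target ∩ c.symm ⁻¹' W) :=
    ((contDiffOn_holomorphic_comp_symm hF hc).restrict_scalars ℝ).of_le le_top
  have h' := h.fderiv_of_isOpen hopen (m := ∞) (by simp)
  refine contDiffOn_alternating fun v => ?_
  exact S.toContinuousMultilinearMap.contDiff.comp_contDiffOn
    (contDiffOn_pi.2 fun i => h'.clm_apply contDiffOn_const)

/-- Nothing is known about F outside W, but a point outside W is off the closed support of ψ, so the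
form vanishes around it. -/
theorem isSmoothForm_pullForm [FiniteDimensional ℂ E] {k : ℕ} {F : V → P} {W : Set V}
    (hF : ContMDiffOn 𝓘(ℂ, E) 𝓘(ℂ, P) ω F W) {ψ : V → ℂ}
    (hψ : ContMDiff 𝓘(ℝ, E) 𝓘(ℝ, ℂ) ∞ ψ) (S : P [⋀^Fin k]→L[ℝ] ℂ) (hW : IsOpen W)
    (hψW : tsupport ψ ⊆ W) : IsSmoothForm (pullForm E ψ F S) := by
  intro c hc y hy
  refine ContDiffAt.contDiffWithinAt ?_
  have hopen := c.isOpen_inter_preimage_symm hW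
  by_cases hy' : c.symm y ∈ W
  · have h1 : inChart c (pullForm E ψ F S) =ᶠ[𝓝 y] fun z =>
        (ψ ∘ c.symm) z • S.compContinuousLinearMap (fderiv ℝ (F ∘ c.symm) z) := by
      filter_upwards [hopen.mem_nhds ⟨hy, hy'⟩] with z hz
      exact inChart_pullForm hF ψ S hW hc hz.1 hz.2
    refine ContDiffAt.congr_of_eventuallyEq ?_ h1
    exact ((contDiffOn_comp_symm hψ hc).contDiffAt (c.open_target.mem_nhds hy)).smul
      ((contDiffOn_flatPull hF S hW hc).contDiffAt (hopen.mem_nhds ⟨hy, hy'⟩))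
  · have h0 : ψ =ᶠ[𝓝 (c.symm y)] 0 := notMem_tsupport_iff_eventuallyEq.1 fun h => hy' (hψW h)
    have h1 : inChart c (pullForm E ψ F S) =ᶠ[𝓝 y] fun _ => 0 := by
      filter_upwards [(c.continuousAt_symm hy).eventually h0] with z hz
      ext v
      change ψ (c.symm z) * _ = 0
      rw [hz]
      exact zero_mul _
    exact contDiffAt_const.congr_of_eventuallyEq h1

/-- The pullback by a holomorphic map of a constant form of bidegree `(q, q)`, multiplied by a
smooth function with compact support, as a test form. -/
def pullTest [FiniteDimensional ℂ E] {F : V → P} {W : Set V}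
    (hF : ContMDiffOn 𝓘(ℂ, E) 𝓘(ℂ, P) ω F W) (hW : IsOpen W) {ψ : V → ℂ}
    (hψ : ContMDiff 𝓘(ℝ, E) 𝓘(ℝ, ℂ) ∞ ψ) (hc : HasCompactSupport ψ) (hψW : tsupport ψ ⊆ W) {q : ℕ}
    {S : P [⋀^Fin (2 * q)]→L[ℝ] ℂ} (hS : HasBidegree q q S) : TestForm E V q :=
  ⟨pullForm E ψ F S, isSmoothForm_pullForm hF hψ S hW hψW,
    hc.mono' fun x hx => subset_tsupport _ fun h0 => hx (by
      ext v
      change ψ x * _ = 0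
      rw [h0, zero_mul]), by
    intro x
    by_cases hx : x ∈ W
    · rw [pullForm, diffAt_eq_of_holomorphic hF hW hx]
      exact (hS.comp _).smul _
    · have h0 : ψ x = 0 := image_eq_zero_of_notMem_tsupport fun h => hx (hψW h)
      intro z v
      change ψ x * _ = _ * (ψ x * _)
      rw [h0, zero_mul, zero_mul, mul_zero]⟩

/-- In the preferred chart at x the map F is holomorphic, so ddᶜ can be computed on the target
before pulling back. -/
theorem ddc_eq_of_eventuallyEq {F : V → P} {W : Set V}
    (hF : ContMDiffOn 𝓘(ℂ, E) 𝓘(ℂ, P) ω F W) (hW : IsOpen W) {x : V} (hx : x ∈ W) {k : ℕ}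
    {φ : V → E [⋀^Fin k]→L[ℝ] ℂ} (hφ : IsSmoothForm φ) {θ : P → P [⋀^Fin k]→L[ℝ] ℂ}
    (hθ : ContDiff ℝ ∞ θ)
    (h : ∀ᶠ z in 𝓝 x, φ z = (θ (F z)).compContinuousLinearMap (diffAt E F z)) :
    ddc φ x = (extDeriv (rotD (-Complex.I) θ) (F x)).compContinuousLinearMap (diffAt E F x) := by
  set c := chartAt E x
  have hc : c ∈ atlas E V := chart_mem_atlas E x
  have hxs : x ∈ c.source := mem_chart_source E x
  have ht : c x ∈ c.target := c.map_source hxs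
  have hW' : c.symm (c x) ∈ W := by rwa [c.left_inv hxs]
  have hopen := c.isOpen_inter_preimage_symm hW
  refine eq_of_inChart_eq hc hxs (ψ := fun x =>
    (extDeriv (rotD (-Complex.I) θ) (F x)).compContinuousLinearMap (diffAt E F x)) ?_
  rw [inChart_ddc hφ hc ht]
  have h1 : inChart c φ =ᶠ[𝓝 (c x)] fun z => (θ ((F ∘ c.symm) z)).compContinuousLinearMap
      (fderiv ℝ (F ∘ c.symm) z) := by
    have h2 : ∀ᶠ z in 𝓝 (c.symm (c x)), φ z =
        (θ (F z)).compContinuousLinearMap (diffAt E F z) := by rwa [c.left_inv hxs]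
    filter_upwards [(c.continuousAt_symm ht).eventually h2, hopen.mem_nhds ⟨ht, hW'⟩] with z hz hz'
    rw [inChart, hz, ← diffAt_comp_dparam hF hW hc hz'.1 hz'.2]
    rfl
  have h2 := extDeriv_rotD_pullback hθ (G := F ∘ c.symm) (y := c x) (by
    filter_upwards [hopen.mem_nhds ⟨ht, hW'⟩] with z hz
    exact contDiffAt_holomorphic_comp_symm hF hW hc hz.1 hz.2)
  have h3 : rotD (-Complex.I) (inChart c φ) =ᶠ[𝓝 (c x)] rotD (-Complex.I) fun z =>
      (θ ((F ∘ c.symm) z)).compContinuousLinearMap (fderiv ℝ (F ∘ c.symm) z) := by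
    filter_upwards [h1.eventually_nhds] with z hz
    exact rotD_congr hz
  rw [h3.extDeriv_eq, h2, ← diffAt_comp_dparam hF hW hc ht hW']
  rfl

end Pullback

/-! ### The current vanishes on the pullback of the barrier. -/

section Vanishing

variable {E : Type*} [NormedAddCommGroup E] [NormedSpace ℂ E]
variable {V : Type*} [TopologicalSpace V] [ChartedSpace E V]

section

variable {P : Type*} [NormedAddCommGroup P] [NormedSpace ℂ P]

theorem contMDiffAt_real_of_complex {F : V → P} {x : V}
    (h : ContMDiffAt 𝓘(ℂ, E) 𝓘(ℂ, P) ω F x) : ContMDiffAt 𝓘(ℝ, E) 𝓘(ℝ, P) ∞ F x :=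
  contMDiffAt_iff.2 ⟨h.continuousAt,
    (ContDiffWithinAt.restrict_scalars ℝ (contMDiffAt_iff.1 h).2).of_le le_top⟩

theorem contMDiff_mul_comp {F : V → P} {W : Set V} (hF : ContMDiffOn 𝓘(ℂ, E) 𝓘(ℂ, P) ω F W)
    (hW : IsOpen W) {χ : V → ℝ} (hχ : ContMDiff 𝓘(ℝ, E) 𝓘(ℝ, ℝ) ∞ χ) (hχW : tsupport χ ⊆ W)
    {w : P → ℝ} (hw : ContDiff ℝ ∞ w) :
    ContMDiff 𝓘(ℝ, E) 𝓘(ℝ, ℝ) ∞ fun x => χ x * w (F x) := by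
  refine contMDiff_of_tsupport fun x hx => ?_
  have hx' : x ∈ W := hχW (closure_mono (Function.support_mul_subset_left _ _) hx)
  exact (hχ x).mul (hw.contMDiff.contMDiffAt.comp x
    (contMDiffAt_real_of_complex ((hF x hx').contMDiffAt (hW.mem_nhds hx'))))

theorem Current.apply_sub {p : ℕ} (T : Current E V p) (φ ψ : TestForm E V p) :
    T.toFun (φ - ψ) = T.toFun φ - T.toFun ψ := by
  rw [eq_sub_iff_add_eq, ← map_add]
  exact congrArg T.toFun (Subtype.ext (sub_add_cancel φ.1 ψ.1))

/-- The current vanishes near `x` on the multiples of the pullback of the constant form `S`. -/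
def Current.VanishesNear {p : ℕ} (T : Current E V p) (F : V → P) (S : P [⋀^Fin (2 * p)]→L[ℝ] ℂ)
    (x : V) : Prop :=
  ∃ O : Set V, IsOpen O ∧ x ∈ O ∧ ∀ ψ : V → ℂ, ContMDiff 𝓘(ℝ, E) 𝓘(ℝ, ℂ) ∞ ψ →
    HasCompactSupport ψ → tsupport ψ ⊆ O → ∀ φ : TestForm E V p,
      φ.1 = pullForm E ψ F S → T.toFun φ = 0

end

variable [IsManifold 𝓘(ℂ, E) ω V]

/-- Vanishing on nonnegative multiples of a positive test form implies vanishing on all multiples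
where the coefficient of the form is positive. -/
theorem Current.vanishesNear_of_apply_eq_zero [FiniteDimensional ℂ E] [T2Space V]
    [SecondCountableTopology V] {P : Type*} [NormedAddCommGroup P] [NormedSpace ℂ P] {p : ℕ}
    (T : Current E V p) (hpos : IsPositive T.toFun) {W : Set V} (hW : IsOpen W) {F : V → P}
    (hF : ContMDiffOn 𝓘(ℂ, E) 𝓘(ℂ, P) ω F W) (a : Fin p → P →L[ℂ] ℂ) {h : V → ℝ}
    (hh : ContMDiff 𝓘(ℝ, E) 𝓘(ℝ, ℝ) ∞ h) (h0 : ∀ x, 0 ≤ h x)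
    (hhW : tsupport h ⊆ W) {Ψ : TestForm E V p}
    (hΨ : Ψ.1 = pullForm E (fun x => (h x : ℂ)) F (elemForm a)) (hT : T.toFun Ψ = 0) {x : V}
    (hxW : x ∈ W) (hx : 0 < h x) : T.VanishesNear F (elemForm a) x := by
  set O : Set V := W ∩ {y | 0 < h y}
  have hO : IsOpen O := hW.inter (isOpen_lt continuous_const hh.continuous)
  -- nonnegative coefficients
  have hreal : ∀ r : V → ℝ, ContMDiff 𝓘(ℝ, E) 𝓘(ℝ, ℝ) ∞ r → HasCompactSupport r → tsupport r ⊆ O →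
      (∀ y, 0 ≤ r y) → ∀ φ : TestForm E V p,
        φ.1 = pullForm E (fun y => (r y : ℂ)) F (elemForm a) → T.toFun φ = 0 := by
    intro r hr hrc hrO hr0 φ hφ
    have hcont : ContinuousOn (fun y => r y / h y) (tsupport r) :=
      hr.continuous.continuousOn.div hh.continuous.continuousOn fun y hy => (hrO hy).2.ne'
    -- On the compact support of r the function h is bounded below by a positive constant, so r is
    -- at most a multiple of h. Positivity then squeezes the value on r between 0 and a multiple of
    -- the value on h, which is 0.
    obtain ⟨C, hC⟩ := IsCompact.bddAbove_image hrc hcont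
    have hle : ∀ y, r y ≤ max C 0 * h y := by
      intro y
      by_cases hy : y ∈ tsupport r
      · have h1 : r y / h y ≤ C := hC ⟨y, hy, rfl⟩
        rw [div_le_iff₀ (hrO hy).2] at h1
        exact h1.trans (mul_le_mul_of_nonneg_right (le_max_left _ _) (h0 y))
      · rw [image_eq_zero_of_notMem_tsupport hy]
        exact mul_nonneg (le_max_right _ _) (h0 y)
    have hC0 : (0 : ℝ) ≤ max C 0 := le_max_right _ _
    have e1 := hpos φ fun y => by
      rw [hφ]
      exact isStronglyPositive_pullForm hF hW hr0
        (fun z hz => image_eq_zero_of_notMem_tsupport fun hz' => hz (hrO hz').1) a y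
    have e2 := hpos (((max C 0 : ℝ) : ℂ) • Ψ - φ) fun y => by
      have h1 : (((max C 0 : ℝ) : ℂ) • Ψ - φ).1 y =
          pullForm E (fun y => ((max C 0 * h y - r y : ℝ) : ℂ)) F (elemForm a) y := by
        ext v
        change ((max C 0 : ℝ) : ℂ) * Ψ.1 y v - φ.1 y v = ((max C 0 * h y - r y : ℝ) : ℂ) * _
        rw [hΨ, hφ]
        change ((max C 0 : ℝ) : ℂ) * ((h y : ℂ) * _) - (r y : ℂ) * _ = _
        push_cast
        ring
      rw [h1]
      refine isStronglyPositive_pullForm hF hW (fun z => sub_nonneg.2 (hle z)) (fun z hz => ?_) a y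
      rw [image_eq_zero_of_notMem_tsupport fun hz' => hz (hhW hz'),
        image_eq_zero_of_notMem_tsupport fun hz' => hz (hrO hz').1]
      ring
    have e3 : T.toFun (((max C 0 : ℝ) : ℂ) • Ψ - φ) = - T.toFun φ := by
      rw [T.apply_sub, map_smul, hT, smul_zero, zero_sub]
    rw [e3, Complex.neg_re] at e2
    refine Complex.ext (le_antisymm ?_ e1.1) e1.2
    have := e2.1
    rw [Complex.zero_re]
    linarith
  refine ⟨O, hO, ⟨hxW, hx⟩, fun ψ hψ hψc hψO φ hφ => ?_⟩
  obtain ⟨η, hη, hηc, hηO, hη1, hη0⟩ := exists_cutoff (E := E) hψc hO hψO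
  obtain ⟨K, hK⟩ := hψc.exists_bound_of_continuous hψ.continuous
  have hK0 : 0 ≤ K := (norm_nonneg _).trans (hK x)
  have hS := elemForm_hasBidegree a
  -- Adding K η, with K a bound of ψ and η = 1 on its support, makes the real and imaginary parts
  -- nonnegative. The choice l = 0 gives the correction K η itself, to be subtracted again.
  have hc : ∀ l : ℂ →L[ℝ] ℝ, (∀ z, |l z| ≤ ‖z‖) → ContMDiff 𝓘(ℝ, E) 𝓘(ℝ, ℝ) ∞
      (fun y => l (ψ y) + K * η y) ∧ HasCompactSupport (fun y => l (ψ y) + K * η y) ∧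
      tsupport (fun y => l (ψ y) + K * η y) ⊆ O ∧ ∀ y, 0 ≤ l (ψ y) + K * η y := by
    intro l hl
    have hsupp : Function.support (fun y => l (ψ y) + K * η y) ⊆ tsupport η := by
      intro y hy
      by_contra hy'
      refine hy ?_
      have h1 : y ∉ tsupport ψ := fun h => by
        have := (hη1 y h).self_of_nhds
        rw [image_eq_zero_of_notMem_tsupport hy'] at this
        exact zero_ne_one this
      simp [image_eq_zero_of_notMem_tsupport hy', image_eq_zero_of_notMem_tsupport h1]
    refine ⟨(l.contDiff.contMDiff.comp hψ).add (contMDiff_const.mul hη), hηc.mono' hsupp,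
      (closure_minimal hsupp (isClosed_tsupport η)).trans hηO, fun y => ?_⟩
    by_cases hy : y ∈ tsupport ψ
    · rw [(hη1 y hy).self_of_nhds]
      have h1 := (hl (ψ y)).trans (hK y)
      linarith [neg_abs_le (l (ψ y))]
    · rw [image_eq_zero_of_notMem_tsupport hy, map_zero, zero_add]
      exact mul_nonneg hK0 (hη0 y)
  have key : ∀ l : ℂ →L[ℝ] ℝ, (∀ z, |l z| ≤ ‖z‖) → ∃ φ : TestForm E V p,
      φ.1 = pullForm E (fun y => ((l (ψ y) + K * η y : ℝ) : ℂ)) F (elemForm a) ∧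
        T.toFun φ = 0 := by
    intro l hl
    obtain ⟨h1, h2, h3, h4⟩ := hc l hl
    have h2' : HasCompactSupport fun y => ((l (ψ y) + K * η y : ℝ) : ℂ) :=
      h2.comp_left (g := Complex.ofReal) rfl
    have h3' : tsupport (fun y => ((l (ψ y) + K * η y : ℝ) : ℂ)) ⊆ W := by
      rw [tsupport_ofReal]
      exact h3.trans Set.inter_subset_left
    exact ⟨pullTest hF hW (contMDiff_ofReal h1) h2' h3' hS, rfl, hreal _ h1 h2 h3 h4 _ rfl⟩
  obtain ⟨φ₀, e0, t0⟩ := key 0 (by simp)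
  obtain ⟨φ₁, e1, t1⟩ := key Complex.reCLM Complex.abs_re_le_norm
  obtain ⟨φ₂, e2, t2⟩ := key Complex.imCLM Complex.abs_im_le_norm
  have hsum : φ = (φ₁ - φ₀) + Complex.I • (φ₂ - φ₀) := by
    refine Subtype.ext (funext fun y => ?_)
    ext v
    change φ.1 y v = φ₁.1 y v - φ₀.1 y v + Complex.I * (φ₂.1 y v - φ₀.1 y v)
    rw [hφ, e0, e1, e2]
    simp only [pullForm, ContinuousAlternatingMap.smul_apply, smul_eq_mul, Complex.reCLM_apply,
      Complex.imCLM_apply, _root_.zero_apply]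
    conv_lhs => rw [← Complex.re_add_im (ψ y)]
    push_cast
    ring
  rw [hsum, map_add, map_smul, T.apply_sub, T.apply_sub, t0, t1, t2]
  simp

/-- The hypothesis `hZ` says that, on the part of the support lying over the closed ball, the points
are in U and satisfy the inequality of `barrierCoeff_pos`. A cutoff near this part then makes both
the form carrying the barrier and its ddᶜ strongly positive along the support. The two positivity
assumptions give opposite signs to the same number. -/
theorem Current.vanishesNear_of_barrier [FiniteDimensional ℂ E] [T2Space V]
    [SecondCountableTopology V] {q : ℕ} (T : Current E V (q + 1)) (hpos : IsPositive T.toFun)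
    (hpsh : IsPlurisuperharmonic (q + 1) T) {U W : Set V} (hU : IsOpen U)
    (hUc : IsCompact (closure U)) (hW : IsOpen W) (hUW : closure U ⊆ W)
    {F : V → EuclideanSpace ℂ (Fin (q + 1))}
    (hF : ContMDiffOn 𝓘(ℂ, E) 𝓘(ℂ, EuclideanSpace ℂ (Fin (q + 1))) ω F W)
    (c : EuclideanSpace ℂ (Fin (q + 1))) (R : ℝ) (j : Fin (q + 1))
    (hZ : ∀ x ∈ T.support ∩ closure U, R < ‖F x - c‖ ^ 2 ∨ x ∈ U ∧
      (R - ‖F x - c‖ ^ 2) ^ 2 + 2 * (R - ‖F x - c‖ ^ 2) * ‖F x j - c j‖ ^ 2 < ‖F x j - c j‖ ^ 2)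
    {x : V} (hxT : x ∈ T.support) (hxU : x ∈ U) (hxR : ‖F x - c‖ ^ 2 < R) :
    T.VanishesNear F (elemForm (frontForms j)) x := by
  set t : V → ℝ := fun y => R - ‖F y - c‖ ^ 2 with ht
  set m : V → ℝ := fun y => ‖F y j - c j‖ ^ 2 with hm
  have hUW' : U ⊆ W := subset_closure.trans hUW
  have htc : ContinuousOn t W := by
    have := hF.continuousOn
    fun_prop
  have hmc : ContinuousOn m W := by
    have h1 := (coordForm j).continuous.comp_continuousOn hF.continuousOn
    have h2 : ContinuousOn (fun y => F y j) W := h1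
    fun_prop
  -- the compact set where the barrier lives on the support, and a neighbourhood of it
  set Z : Set V := T.support ∩ (closure U ∩ {y | 0 ≤ t y}) with hZdef
  have hZc : IsCompact Z := by
    refine IsCompact.inter_left ?_ T.isClosed_support
    exact hUc.of_isClosed_subset ((htc.mono hUW).preimage_isClosed_of_isClosed isClosed_closure
      isClosed_Ici) Set.inter_subset_left
  set G : Set V := U ∩ {y | t y ^ 2 + 2 * t y * m y < m y} with hGdef
  have hG : IsOpen G := by
    have h1 : ContinuousOn (fun y => t y ^ 2 + 2 * t y * m y - m y) U := by
      have := htc.mono hUW'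
      have := hmc.mono hUW'
      fun_prop
    have h2 := h1.isOpen_inter_preimage hU (isOpen_Iio (a := (0 : ℝ)))
    convert h2 using 1
    ext y
    simp [hGdef]
  have hZG : Z ⊆ G := fun y hy => by
    rcases hZ y ⟨hy.1, hy.2.1⟩ with h | h
    · have h1 : 0 ≤ t y := hy.2.2
      simp only [ht] at h1
      linarith
    · exact h
  obtain ⟨χ, hχ, hχc, hχG, hχ1, hχ0⟩ := exists_cutoff (E := E) hZc hG hZG
  have hGW : G ⊆ W := Set.inter_subset_left.trans hUW'
  have hχW : tsupport χ ⊆ W := hχG.trans hGW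
  -- the test form
  set u : EuclideanSpace ℂ (Fin (q + 1)) → ℝ := fun z => expNegInvGlue (R - ‖z - c‖ ^ 2) with hu
  have hu' : ContDiff ℝ ∞ u := contDiff_barrier c R
  have hcu := contMDiff_mul_comp hF hW hχ hχW hu'
  have hch := contMDiff_mul_comp hF hW hχ hχW (contDiff_barrierCoeff c R j)
  have hsub : ∀ w : EuclideanSpace ℂ (Fin (q + 1)) → ℝ,
      tsupport (fun y => χ y * w (F y)) ⊆ tsupport χ := fun w =>
    closure_mono (Function.support_mul_subset_left _ _)
  have hsub' : ∀ w : EuclideanSpace ℂ (Fin (q + 1)) → ℝ,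
      tsupport (fun y => ((χ y * w (F y) : ℝ) : ℂ)) ⊆ tsupport χ := fun w => by
    rw [tsupport_ofReal]
    exact hsub w
  have hcpt : ∀ w : EuclideanSpace ℂ (Fin (q + 1)) → ℝ,
      HasCompactSupport (fun y => ((χ y * w (F y) : ℝ) : ℂ)) := fun w =>
    hχc.of_isClosed_subset (isClosed_tsupport _) (hsub' w)
  set Θ : TestForm E V q := pullTest hF hW (contMDiff_ofReal hcu) (hcpt u)
    ((hsub' u).trans hχW) (elemForm_hasBidegree (omitForms j)) with hΘ
  set Ψ : TestForm E V (q + 1) := pullTest hF hW (contMDiff_ofReal hch) (hcpt _)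
    ((hsub' _).trans hχW) (elemForm_hasBidegree (frontForms j)) with hΨ
  have hcoeff : ∀ y, 0 ≤ χ y * barrierCoeff c R j (F y) := by
    intro y
    by_cases hy : y ∈ tsupport χ
    · refine mul_nonneg (hχ0 y) ?_
      rcases le_or_gt (t y) 0 with h | h
      · exact (barrierCoeff_of_nonpos h).ge
      · exact (barrierCoeff_pos h (hχG hy).2).le
    · rw [image_eq_zero_of_notMem_tsupport hy, zero_mul]
  have hΘpos : ∀ y, IsStronglyPositive (Θ.1 y) :=
    isStronglyPositive_pullForm hF hW (fun y => mul_nonneg (hχ0 y) (expNegInvGlue.nonneg _))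
      (fun y hy => by
        rw [image_eq_zero_of_notMem_tsupport fun h => hy (hχW h), zero_mul]) _
  have hΨpos : ∀ y, IsStronglyPositive (Ψ.1 y) :=
    isStronglyPositive_pullForm hF hW hcoeff
      (fun y hy => by
        rw [image_eq_zero_of_notMem_tsupport fun h => hy (hχW h), zero_mul]) _
  have hΘ0 : ∀ y, χ y * u (F y) = 0 → Θ.1 y = 0 := by
    intro y hy
    ext v
    change ((χ y * u (F y) : ℝ) : ℂ) * _ = 0
    rw [hy]
    simp
  have hΨ0 : ∀ y, χ y * barrierCoeff c R j (F y) = 0 → Ψ.1 y = 0 := by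
    intro y hy
    ext v
    change ((χ y * barrierCoeff c R j (F y) : ℝ) : ℂ) * _ = 0
    rw [hy]
    simp
  have hddc0 : ∀ y, Θ.1 =ᶠ[𝓝 y] 0 → ddc Θ.1 =ᶠ[𝓝 y] 0 := by
    intro y hy
    rw [← notMem_tsupport_iff_eventuallyEq] at hy ⊢
    exact fun h => hy (tsupport_ddc _ h)
  -- Around a point of the support there are three cases: the cutoff vanishes nearby, the point lies
  -- outside the closed ball and the barrier vanishes nearby, or the cutoff is 1 nearby and the flat
  -- computation applies.
  have hcongr : T.toFun (ddcTest q Θ) = T.toFun Ψ := by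
    refine T.apply_congr fun y hyT => ?_
    change ddc Θ.1 =ᶠ[𝓝 y] Ψ.1
    by_cases hy : y ∈ tsupport χ
    swap
    · have h0 := notMem_tsupport_iff_eventuallyEq.1 hy
      have h1 : Θ.1 =ᶠ[𝓝 y] 0 := by
        filter_upwards [h0] with z hz
        exact hΘ0 z (by rw [hz]; simp)
      filter_upwards [hddc0 y h1, h0] with z hz hz'
      rw [hz, hΨ0 z (by rw [hz']; simp)]
      rfl
    have hyU : y ∈ U := (hχG hy).1
    have hyW := hUW' hyU
    have htcy : ContinuousAt t y := htc.continuousAt (hW.mem_nhds hyW)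
    rcases lt_or_ge (t y) 0 with hty | hty
    · have h0 : ∀ᶠ z in 𝓝 y, t z < 0 := htcy.eventually_lt continuousAt_const hty
      have h1 : Θ.1 =ᶠ[𝓝 y] 0 := by
        filter_upwards [h0] with z hz
        refine hΘ0 z ?_
        change χ z * expNegInvGlue (t z) = 0
        rw [expNegInvGlue.zero_of_nonpos hz.le, mul_zero]
      filter_upwards [hddc0 y h1, h0] with z hz hz'
      rw [hz, hΨ0 z (by rw [barrierCoeff_of_nonpos hz'.le, mul_zero])]
      rfl
    · have h1 := hχ1 y ⟨hyT, subset_closure hyU, hty⟩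
      have hθ : ContDiff ℝ ∞ fun z => u z • elemForm (omitForms j) := hu'.smul contDiff_const
      filter_upwards [h1.eventually_nhds, hW.mem_nhds hyW] with z hz hzW
      rw [ddc_eq_of_eventuallyEq hF hW hzW Θ.2.1 hθ ?_, extDeriv_rotD_barrier]
      · ext v
        change _ = ((χ z * barrierCoeff c R j (F z) : ℝ) : ℂ) * _
        rw [hz.self_of_nhds, one_mul]
        rfl
      · filter_upwards [hz] with w hw
        ext v
        change ((χ w * u (F w) : ℝ) : ℂ) * _ = _
        rw [hw, one_mul]
        exact (Complex.real_smul (x := u (F w))).symm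
  have hT : T.toFun Ψ = 0 := by
    have e1 := hpos Ψ hΨpos
    have e2 := hpsh Θ hΘpos
    -- Plurisuperharmonicity tested on Θ gives the value on Ψ the sign opposite to the one given by
    -- positivity.
    have e3 : (-(T.toFun ∘ₗ ddcTest q)) Θ = - T.toFun Ψ := by
      rw [← hcongr]
      rfl
    rw [e3, Complex.neg_re] at e2
    refine Complex.ext (le_antisymm ?_ e1.1) e1.2
    have := e2.1
    rw [Complex.zero_re]
    linarith
  have hxZ : x ∈ Z := ⟨hxT, subset_closure hxU, sub_nonneg.2 hxR.le⟩
  refine T.vanishesNear_of_apply_eq_zero hpos hW hF (frontForms j) hch hcoeff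
    ((hsub _).trans hχW) (Ψ := Ψ) rfl hT (hUW' hxU) ?_
  rw [(hχ1 x hxZ).self_of_nhds, one_mul]
  exact barrierCoeff_pos (sub_pos.2 hxR) (hZG hxZ).2

end Vanishing

/-! ### A ball touching a compact set from outside. -/

section Touching

variable {p : ℕ}

/-- A compact set with a point in the unbounded component of the complement of a subset admits a
ball which touches it from outside at a single point, away from the subset. -/
theorem exists_touching_ball {K K' : Set (EuclideanSpace ℂ (Fin p))} (hK : IsCompact K)
    (hK' : IsCompact K') {w : EuclideanSpace ℂ (Fin p)} (hw : w ∈ K)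
    (hw' : w ∈ unboundedComponent K') :
    ∃ a c, c ∈ K ∧ c ∉ K' ∧ a ≠ c ∧ ∀ y ∈ K, ‖y - a‖ ≤ ‖c - a‖ → y = c := by
  -- Otherwise the connected component would be covered by the disjoint open sets interior K and the
  -- complement of K, hence contained in K, which is bounded.
  obtain ⟨b, hbC, hbK, hbi⟩ : ∃ b ∈ connectedComponentIn K'ᶜ w, b ∈ K ∧ b ∉ interior K := by
    by_contra! h
    have h1 : connectedComponentIn K'ᶜ w ⊆ interior K ∪ Kᶜ := fun b hb => by
      by_cases hbK : b ∈ K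
      · exact Or.inl (h b hb hbK)
      · exact Or.inr hbK
    have hwC := mem_connectedComponentIn hw'.1
    have h2 : connectedComponentIn K'ᶜ w ⊆ interior K :=
      isPreconnected_connectedComponentIn.subset_left_of_subset_union isOpen_interior
        hK.isClosed.isOpen_compl
        (Set.disjoint_left.2 fun x hx hx' => hx' (interior_subset hx)) h1 ⟨w, hwC, h w hwC hw⟩
    exact hw'.2 (hK.isBounded.subset (h2.trans interior_subset))
  have hbK' : b ∈ K'ᶜ := connectedComponentIn_subset _ _ hbC
  obtain ⟨ε, hε, hball⟩ := Metric.isOpen_iff.1 hK'.isClosed.isOpen_compl b hbK'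
  -- With a₀ within ε/2 of b, a nearest point c of K to a₀ is also within ε/2 of a₀. So c is within
  -- ε of b and avoids K'.
  obtain ⟨a₀, ha₀, ha₀K⟩ : ∃ a₀ ∈ Metric.ball b (ε / 2), a₀ ∉ K := by
    by_contra! h
    exact hbi (mem_interior_iff_mem_nhds.2 (Filter.mem_of_superset
      (Metric.ball_mem_nhds b (half_pos hε)) h))
  obtain ⟨c, hcK, hc⟩ := hK.exists_isMinOn ⟨w, hw⟩
    (f := fun y => ‖y - a₀‖) (by fun_prop)
  have hmin : ∀ y ∈ K, ‖c - a₀‖ ≤ ‖y - a₀‖ := fun y hy => hc hy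
  have hba : ‖b - a₀‖ < ε / 2 := by
    rw [← dist_eq_norm, dist_comm]
    exact ha₀
  have hca : c ≠ a₀ := fun h => ha₀K (h ▸ hcK)
  -- The ball centred at the midpoint with half the radius is internally tangent at c to the ball
  -- around a₀. The parallelogram law shows that c is then the only contact point.
  set a : EuclideanSpace ℂ (Fin p) := (2⁻¹ : ℂ) • (a₀ + c) with ha
  have e1 : a - a₀ = c - a := by
    rw [sub_eq_sub_iff_add_eq_add, ha, ← add_smul, ← two_mul, mul_inv_cancel₀ two_ne_zero, one_smul,
      add_comm]
  have e2 : c - a₀ = (2 : ℂ) • (c - a) := by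
    rw [two_smul]
    nth_rewrite 2 [← e1]
    abel
  have e3 : ‖c - a₀‖ = 2 * ‖c - a‖ := by
    rw [e2, norm_smul]
    simp
  refine ⟨a, c, hcK, fun h => hball ?_ h, fun h => ?_, fun y hy hle => ?_⟩
  · rw [Metric.mem_ball, dist_eq_norm]
    calc ‖c - b‖ = ‖(c - a₀) - (b - a₀)‖ := by rw [sub_sub_sub_cancel_right]
      _ ≤ ‖c - a₀‖ + ‖b - a₀‖ := norm_sub_le _ _
      _ < ε := by linarith [hmin b hbK]
  · refine hca (sub_eq_zero.1 ?_)
    rw [e2, h, sub_self, smul_zero]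
  · have h1 := parallelogram_law_with_norm ℂ (y - a) (a - a₀)
    rw [sub_add_sub_cancel, e1, sub_sub_sub_cancel_right] at h1
    have h2 := hmin y hy
    rw [e3] at h2
    have h3 : ‖y - c‖ = 0 := by
      have h4 := norm_nonneg (y - c)
      have h5 := norm_nonneg (c - a)
      have h6 := norm_nonneg (y - a)
      nlinarith
    exact sub_eq_zero.1 (norm_eq_zero.1 h3)

end Touching

/-! ### Stability of the touching situation. -/

section Perturbation

variable {E : Type*} [NormedAddCommGroup E] [NormedSpace ℂ E]
variable {V : Type*} [TopologicalSpace V] [ChartedSpace E V] [IsManifold 𝓘(ℂ, E) ω V]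

/-- At a point where the image of the support by `f` is touched from outside by a ball, the current
vanishes on the pullbacks by the small perturbations of `f`. -/
theorem Current.eventually_vanishesNear [FiniteDimensional ℂ E] [T2Space V]
    [SecondCountableTopology V] {q : ℕ} (T : Current E V (q + 1)) (hpos : IsPositive T.toFun)
    (hpsh : IsPlurisuperharmonic (q + 1) T) {U W : Set V} (hU : IsOpen U)
    (hUc : IsCompact (closure U)) (hW : IsOpen W) (hUW : closure U ⊆ W)
    {f H : V → EuclideanSpace ℂ (Fin (q + 1))}
    (hf : ContMDiffOn 𝓘(ℂ, E) 𝓘(ℂ, EuclideanSpace ℂ (Fin (q + 1))) ω f W)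
    (hH : ContMDiffOn 𝓘(ℂ, E) 𝓘(ℂ, EuclideanSpace ℂ (Fin (q + 1))) ω H W)
    {x : V} (hxT : x ∈ T.support) (hxU : x ∈ U) (hHx : H x = 0)
    {a : EuclideanSpace ℂ (Fin (q + 1))} {j : Fin (q + 1)} (hj : f x j ≠ a j)
    (htouch : ∀ y ∈ T.support ∩ closure U, ‖f y - a‖ ≤ ‖f x - a‖ → y ∈ U ∧ f y = f x) :
    ∀ᶠ t : ℝ in 𝓝 0,
      T.VanishesNear (fun y => f y + (t : ℂ) • H y) (elemForm (frontForms j)) x := by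
  -- The conditions needed for the barrier are open in the parameter t, the squared radius R and the
  -- point y. Compactness makes them hold uniformly in y for (t, R) near (0, ‖f x - a‖²).
  have hK : IsCompact (T.support ∩ closure U) := hUc.inter_left T.isClosed_support
  have hev : ∀ᶠ s : ℝ × ℝ in 𝓝 (0, ‖f x - a‖ ^ 2), ∀ y ∈ T.support ∩ closure U,
      s.2 < ‖(f y + (s.1 : ℂ) • H y) - a‖ ^ 2 ∨ y ∈ U ∧
        (s.2 - ‖(f y + (s.1 : ℂ) • H y) - a‖ ^ 2) ^ 2 +
          2 * (s.2 - ‖(f y + (s.1 : ℂ) • H y) - a‖ ^ 2) *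
            ‖(f y + (s.1 : ℂ) • H y) j - a j‖ ^ 2 < ‖(f y + (s.1 : ℂ) • H y) j - a j‖ ^ 2 := by
    refine hK.eventually_forall_of_forall_eventually fun y hy => ?_
    have hyW : W ∈ 𝓝 y := hW.mem_nhds (hUW hy.2)
    have hfy : ContinuousAt f y := hf.continuousOn.continuousAt hyW
    have hHy : ContinuousAt H y := hH.continuousOn.continuousAt hyW
    have hf' : ContinuousAt (fun z : (ℝ × ℝ) × V => f z.2) ((0, ‖f x - a‖ ^ 2), y) :=
      ContinuousAt.comp (g := f) hfy continuousAt_snd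
    have hH' : ContinuousAt (fun z : (ℝ × ℝ) × V => H z.2) ((0, ‖f x - a‖ ^ 2), y) :=
      ContinuousAt.comp (g := H) hHy continuousAt_snd
    have ht : ContinuousAt (fun z : (ℝ × ℝ) × V => (z.1.1 : ℂ)) ((0, ‖f x - a‖ ^ 2), y) := by
      fun_prop
    have hF : ContinuousAt (fun z : (ℝ × ℝ) × V => f z.2 + (z.1.1 : ℂ) • H z.2)
        ((0, ‖f x - a‖ ^ 2), y) := hf'.add (ht.smul hH')
    have hN : ContinuousAt (fun z : (ℝ × ℝ) × V => ‖(f z.2 + (z.1.1 : ℂ) • H z.2) - a‖ ^ 2)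
        ((0, ‖f x - a‖ ^ 2), y) := (hF.sub continuousAt_const).norm.pow 2
    have hR : ContinuousAt (fun z : (ℝ × ℝ) × V => z.1.2) ((0, ‖f x - a‖ ^ 2), y) := by fun_prop
    have hm : ContinuousAt (fun z : (ℝ × ℝ) × V =>
        ‖(f z.2 + (z.1.1 : ℂ) • H z.2) j - a j‖ ^ 2) ((0, ‖f x - a‖ ^ 2), y) :=
      (((coordForm j).continuous.continuousAt.comp hF).sub continuousAt_const).norm.pow 2
    rcases lt_or_ge ‖f x - a‖ ‖f y - a‖ with h | h
    · refine (hR.eventually_lt hN ?_).mono fun _ => Or.inl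
      simp only [Complex.ofReal_zero, zero_smul, add_zero]
      exact pow_lt_pow_left₀ h (norm_nonneg _) two_ne_zero
    -- At a contact point R - ‖f y - a‖² is zero for the limiting parameters, so the inequality
    -- reduces to 0 < ‖f x j - a j‖².
    · obtain ⟨hyU, hyx⟩ := htouch y hy h
      have h2 : 0 < ‖f x j - a j‖ ^ 2 := pow_pos (norm_pos_iff.2 (sub_ne_zero.2 hj)) 2
      have hL : ContinuousAt (fun z : (ℝ × ℝ) × V =>
          (z.1.2 - ‖(f z.2 + (z.1.1 : ℂ) • H z.2) - a‖ ^ 2) ^ 2 +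
          2 * (z.1.2 - ‖(f z.2 + (z.1.1 : ℂ) • H z.2) - a‖ ^ 2) *
            ‖(f z.2 + (z.1.1 : ℂ) • H z.2) j - a j‖ ^ 2) ((0, ‖f x - a‖ ^ 2), y) :=
        ((hR.sub hN).pow 2).add ((continuousAt_const.mul (hR.sub hN)).mul hm)
      have h1 := hL.eventually_lt hm (by
        simp only [Complex.ofReal_zero, zero_smul, add_zero, hyx, sub_self]
        simpa only [ne_eq, OfNat.ofNat_ne_zero, not_false_eq_true, zero_pow, mul_zero, zero_mul,
          add_zero] using h2)
      filter_upwards [h1, continuousAt_snd.eventually (hU.mem_nhds hyU)] with z hz hzU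
      exact Or.inr ⟨hzU, hz⟩
  filter_upwards [hev.curry_nhds] with t ht
  -- R must exceed the touching radius squared, so that x, where H vanishes, falls strictly inside
  -- the ball.
  obtain ⟨R, hR, hRx⟩ := ((ht.filter_mono nhdsWithin_le_nhds).and
    (self_mem_nhdsWithin (a := ‖f x - a‖ ^ 2) (s := Set.Ioi (‖f x - a‖ ^ 2)))).exists
  have hF : ContMDiffOn 𝓘(ℂ, E) 𝓘(ℂ, EuclideanSpace ℂ (Fin (q + 1))) ω
      (fun y => f y + (t : ℂ) • H y) W := by
    have h1 : ContMDiffOn 𝓘(ℂ, E) 𝓘(ℂ, EuclideanSpace ℂ (Fin (q + 1))) ω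
        (fun y => (t : ℂ) • H y) W := fun y hy =>
      ((contDiff_const_smul (t : ℂ)).contMDiff.contMDiffAt).comp_contMDiffWithinAt y (hH y hy)
    exact hf.add h1
  refine T.vanishesNear_of_barrier hpos hpsh hU hUc hW hUW hF a R j hR hxT hxU ?_
  rw [hHx, smul_zero, add_zero]
  exact hRx

end Perturbation

/-! ### From vanishing on a spanning family to vanishing near the point. -/

section Span

variable {E : Type*} [NormedAddCommGroup E] [NormedSpace ℂ E]
variable {V : Type*} [TopologicalSpace V] [ChartedSpace E V] [IsManifold 𝓘(ℂ, E) ω V]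
variable {P : Type*} [NormedAddCommGroup P] [NormedSpace ℂ P]

theorem hasBidegree_inChart {k p q : ℕ} {φ : V → E [⋀^Fin k]→L[ℝ] ℂ}
    (hφ : ∀ x, HasBidegree p q (φ x)) {c : OpenPartialHomeomorph V E} (hc : c ∈ atlas E V) {y : E}
    (hy : y ∈ c.target) : HasBidegree p q (inChart c φ y) := by
  intro z v
  change φ (c.symm y) (fun j => dparam c y (z • v j)) = _
  simp only [dparam_smul hc hy]
  exact hφ (c.symm y) z fun j => dparam c y (v j)

/-- The linear map with given values on the standard basis. -/
def columnMap (m : ℕ) :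
    (Fin m → Fin m → ℂ) →ₗ[ℝ] ((Fin m → ℂ) →L[ℂ] (Fin m → ℂ)) where
  toFun N := ∑ i, (ContinuousLinearMap.proj i : (Fin m → ℂ) →L[ℂ] ℂ).smulRight (N i)
  map_add' N N' := by
    ext v
    simp [_root_.sum_apply, Finset.sum_add_distrib]
  map_smul' r N := by
    ext v
    simp [_root_.sum_apply, Finset.mul_sum, mul_left_comm]

theorem columnMap_apply {m : ℕ} (N : Fin m → Fin m → ℂ) (v : Fin m → ℂ) :
    columnMap m N v = ∑ i, v i • N i := by
  simp [columnMap, _root_.sum_apply]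

/-- If the current vanishes near `x` on the multiples of sufficiently many pullbacks of a constant
form, so that they span all forms of bidegree `(p, p)` at `x`, then `x` is not in the support. -/
theorem Current.notMem_support_of_span [FiniteDimensional ℂ E] [T2Space V]
    [SecondCountableTopology V] {p : ℕ} (T : Current E V p) {W : Set V} (hW : IsOpen W)
    {S : P [⋀^Fin (2 * p)]→L[ℝ] ℂ} (hS : HasBidegree p p S) {x : V} (hxW : x ∈ W)
    {s : Set (E [⋀^Fin (2 * p)]→L[ℝ] ℂ)}
    (hs : ∀ α ∈ s, ∃ F : V → P, ContMDiffOn 𝓘(ℂ, E) 𝓘(ℂ, P) ω F W ∧ T.VanishesNear F S x ∧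
      α = S.compContinuousLinearMap (fderiv ℝ (F ∘ (chartAt E x).symm) (chartAt E x x)))
    (hspan : ∀ α : E [⋀^Fin (2 * p)]→L[ℝ] ℂ, HasBidegree p p α → α ∈ Submodule.span ℂ s) :
    x ∉ T.support := by
  classical
  have : IsManifold 𝓘(ℝ, E) ∞ V := isManifold_real
  set c := chartAt E x with hcdef
  have hc : c ∈ atlas E V := chart_mem_atlas E x
  have hxc : x ∈ c.source := mem_chart_source E x
  obtain ⟨m, e, hes, hesp, hli⟩ : ∃ (m : ℕ) (e : Fin m → E [⋀^Fin (2 * p)]→L[ℝ] ℂ),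
      (∀ i, e i ∈ s) ∧ Submodule.span ℂ (Set.range e) = Submodule.span ℂ s ∧
        LinearIndependent ℂ e := ⟨_, Submodule.exists_fun_fin_finrank_span_eq ℂ s⟩
  choose F hF hV he using fun i => hs (e i) (hes i)
  choose O hO hxO hOT using hV
  -- coordinates on the forms of bidegree `(p, p)`
  obtain ⟨π, hπ⟩ := (Fintype.linearCombination ℂ e).exists_leftInverse_of_injective
    (LinearMap.ker_eq_bot.2 (hli.fintypeLinearCombination_injective))
  have hπe : ∀ v : Fin m → ℂ, π (∑ i, v i • e i) = v := fun v => LinearMap.congr_fun hπ v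
  -- π is a left inverse defined on all forms; it is injective only on those of bidegree (p, p),
  -- which lie in the span of e.
  have hπ0 : ∀ α : E [⋀^Fin (2 * p)]→L[ℝ] ℂ, HasBidegree p p α → π α = 0 → α = 0 := by
    intro α hα h0
    have h1 := hspan α hα
    rw [← hesp, ← Fintype.range_linearCombination] at h1
    obtain ⟨v, rfl⟩ := h1
    have h2 : v = 0 := (hπe v).symm.trans h0
    rw [h2, map_zero]
  set πr : (E [⋀^Fin (2 * p)]→L[ℝ] ℂ) →L[ℝ] (Fin m → ℂ) :=
    (π.restrictScalars ℝ).toContinuousLinearMap with hπr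
  -- the matrix of the pullbacks
  set D : Fin m → E → E [⋀^Fin (2 * p)]→L[ℝ] ℂ := fun i y =>
    S.compContinuousLinearMap (fderiv ℝ (F i ∘ c.symm) y) with hD
  set A : E → (Fin m → ℂ) →L[ℂ] (Fin m → ℂ) := fun y => columnMap m fun i => π (D i y) with hA
  have hAv : ∀ y v, A y v = π (∑ i, v i • D i y) := by
    intro y v
    rw [hA, columnMap_apply, map_sum]
    simp only [map_smul]
  -- At the centre the pullbacks are the basis e itself, so the matrix is the identity. By
  -- continuity it stays invertible nearby, with smooth inverse.
  have hA1 : A (c x) = 1 := by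
    ext1 v
    rw [hAv]
    refine Eq.trans ?_ (hπe v)
    simp only [he]
    rfl
  have hopen := c.isOpen_inter_preimage_symm hW
  have hAs : ContDiffOn ℝ ∞ A (c.target ∩ c.symm ⁻¹' W) :=
    (columnMap m).toContinuousLinearMap.contDiff.comp_contDiffOn
      (contDiffOn_pi.2 fun i => πr.contDiff.comp_contDiffOn (contDiffOn_flatPull (hF i) S hW hc))
  have hmem : ∀ z ∈ c.source, z ∈ W → c z ∈ c.target ∩ c.symm ⁻¹' W := fun z hz hzW =>
    ⟨c.map_source hz, by rwa [Set.mem_preimage, c.left_inv hz]⟩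
  have hunit : ∀ᶠ z in 𝓝 x, IsUnit (A (c z)) := by
    have h1 : ContinuousAt A (c x) :=
      hAs.continuousOn.continuousAt (hopen.mem_nhds (hmem x hxc hxW))
    have h2 : ContinuousAt (fun z => A (c z)) x :=
      ContinuousAt.comp (g := A) h1 (c.continuousAt hxc)
    refine h2.eventually (Units.isOpen.mem_nhds ?_)
    change IsUnit (A (c x))
    rw [hA1]
    exact isUnit_one
  obtain ⟨Q, hQ, hQo, hxQ⟩ := eventually_nhds_iff.1 (hunit.and ((hW.eventually_mem hxW).and
    ((c.open_source.eventually_mem hxc).and (Filter.eventually_all.2 fun i => (hO i).eventually_mem (hxO i)))))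
  intro hx
  obtain ⟨φ, hφQ, hφT⟩ := hx Q hQo hxQ
  refine hφT ?_
  -- the coefficients
  set C : E → Fin m → ℂ := fun y => Ring.inverse (A y) (π (inChart c φ.1 y)) with hC
  -- The chart is meaningless outside its source, so the coefficients are extended by zero. They
  -- stay smooth because they are supported in the support of φ, which lies in Q.
  set ψ : Fin m → V → ℂ := fun i z => if z ∈ Q then C (c z) i else 0 with hψ
  have hψφ : ∀ i, Function.support (ψ i) ⊆ tsupport φ.1 := by
    intro i z hz
    refine subset_tsupport _ fun h0 => hz ?_
    by_cases hzQ : z ∈ Q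
    · have hzs := (hQ z hzQ).2.2.1
      have h1 : inChart c φ.1 (c z) = 0 := by
        rw [inChart, c.left_inv hzs, h0]
        rfl
      simp only [hψ, if_pos hzQ, hC, h1, map_zero, Pi.zero_apply]
    · simp only [hψ, if_neg hzQ]
  have hψφ' : ∀ i, tsupport (ψ i) ⊆ tsupport φ.1 := fun i =>
    closure_minimal (hψφ i) (isClosed_tsupport _)
  have hψc : ∀ i, HasCompactSupport (ψ i) := fun i => φ.2.2.1.mono' (hψφ i)
  have hψs : ∀ i, ContMDiff 𝓘(ℝ, E) 𝓘(ℝ, ℂ) ∞ (ψ i) := by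
    intro i
    refine contMDiff_of_tsupport fun z hz => ?_
    have hzQ : z ∈ Q := hφQ (hψφ' i hz)
    obtain ⟨h1, h2, h3, -⟩ := hQ z hzQ
    have h4 : ψ i =ᶠ[𝓝 z] fun w => C (c w) i := by
      filter_upwards [hQo.mem_nhds hzQ] with w hw
      simp only [hψ, if_pos hw]
    refine ContMDiffAt.congr_of_eventuallyEq ?_ h4
    have h5 : ContDiffAt ℝ ∞ (fun y => Ring.inverse (A y)) (c z) := by
      obtain ⟨u, hu⟩ := h1
      have h6 := contDiffAt_ringInverse ℝ (n := ∞) u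
      rw [hu] at h6
      exact h6.comp (c z) (hAs.contDiffAt (hopen.mem_nhds (hmem z h3 h2)))
    have h7 : ContDiffAt ℝ ∞ (fun y => πr (inChart c φ.1 y)) (c z) :=
      πr.contDiff.contDiffAt.comp (c z)
        ((φ.2.1 c hc).contDiffAt (c.open_target.mem_nhds (c.map_source h3)))
    have h8 : ContDiffAt ℝ ∞ (fun y => (Ring.inverse (A y)).restrictScalars ℝ) (c z) :=
      (ContinuousLinearMap.restrictScalarsL ℂ (Fin m → ℂ) (Fin m → ℂ) ℝ ℝ).contDiff.contDiffAt.comp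
        (c z) h5
    have h9 : ContDiffAt ℝ ∞ C (c z) := h8.clm_apply h7
    exact ((contDiffAt_pi.1 h9 i).contMDiffAt).comp z
      ((contMDiffOn_of_mem_maximalAtlas (IsManifold.subset_maximalAtlas hc)).contMDiffAt
        (c.open_source.mem_nhds h3))
  have hψQ : ∀ i, tsupport (ψ i) ⊆ Q := fun i => (hψφ' i).trans hφQ
  have hψW : ∀ i, tsupport (ψ i) ⊆ W := fun i => (hψQ i).trans fun z hz => (hQ z hz).2.1
  set Φ : Fin m → TestForm E V p := fun i =>
    pullTest (hF i) hW (hψs i) (hψc i) (hψW i) hS with hΦ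
  have hΦT : ∀ i, T.toFun (Φ i) = 0 := fun i =>
    hOT i (ψ i) (hψs i) (hψc i) ((hψQ i).trans fun z hz => (hQ z hz).2.2.2 i) _ rfl
  -- the decomposition
  set δ : TestForm E V p := φ - ∑ i, Φ i with hδ
  have hδz : ∀ z, δ.1 z = φ.1 z - ∑ i, pullForm E (ψ i) (F i) S z := by
    intro z
    have h1 : (∑ i, Φ i).1 = ∑ i, (Φ i).1 := AddSubmonoidClass.coe_finsetSum _ _
    change φ.1 z - (∑ i, Φ i).1 z = _
    rw [h1, Finset.sum_apply]
    rfl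
  have hδ0 : δ = 0 := by
    refine Subtype.ext (funext fun z => ?_)
    by_cases hzQ : z ∈ Q
    · obtain ⟨h1, h2, h3, -⟩ := hQ z hzQ
      refine eq_of_inChart_eq hc h3 ?_
      have hy := c.map_source h3
      have e1 : inChart c δ.1 (c z) = inChart c φ.1 (c z) - ∑ i, C (c z) i • D i (c z) := by
        have e2 : ∀ i, inChart c (pullForm E (ψ i) (F i) S) (c z) = C (c z) i • D i (c z) := by
          intro i
          rw [inChart_pullForm (hF i) _ _ hW hc hy (hmem z h3 h2).2, c.left_inv h3]
          simp only [hψ, if_pos hzQ]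
          rfl
        simp only [← e2]
        ext v
        simp only [inChart, hδz, ContinuousAlternatingMap.compContinuousLinearMap_apply,
          ContinuousAlternatingMap.sub_apply, ContinuousAlternatingMap.sum_apply]
      refine (hπ0 _ (hasBidegree_inChart δ.2.2.2 hc hy) ?_).trans ?_
      · have e3 : A (c z) (C (c z)) = π (inChart c φ.1 (c z)) := by
          change (A (c z) * Ring.inverse (A (c z))) _ = _
          rw [Ring.mul_inverse_cancel _ h1]
          rfl
        rw [e1, map_sub, ← hAv, e3, sub_self]
      · ext v
        rfl
    · rw [hδz]
      have e1 : φ.1 z = 0 := image_eq_zero_of_notMem_tsupport fun h => hzQ (hφQ h)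
      ext v
      rw [e1, ContinuousAlternatingMap.sub_apply, ContinuousAlternatingMap.sum_apply]
      simp only [pullForm, ContinuousAlternatingMap.smul_apply, hψ, if_neg hzQ]
      simp
  have h1 : T.toFun δ = T.toFun φ - T.toFun (∑ i, Φ i) := T.apply_sub _ _
  rw [hδ0, map_zero, map_sum, Finset.sum_eq_zero fun i _ => hΦT i, sub_zero] at h1
  exact h1.symm

end Span

/-! ### Perturbation through the immersion and the conclusion. -/

section Final

variable {E : Type*} [NormedAddCommGroup E] [NormedSpace ℂ E]
variable {V : Type*} [TopologicalSpace V] [ChartedSpace E V] [IsManifold 𝓘(ℂ, E) ω V]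

/-- A linear map with prescribed components. -/
theorem exists_frontForms_comp {N : Type*} [NormedAddCommGroup N] [NormedSpace ℂ N] {q : ℕ}
    (j : Fin (q + 1)) (b : Fin (q + 1) → N →L[ℂ] ℂ) :
    ∃ A : N →L[ℂ] EuclideanSpace ℂ (Fin (q + 1)), ∀ k, (frontForms j k).comp A = b k := by
  refine ⟨((EuclideanSpace.equiv (Fin (q + 1)) ℂ).symm : _ →L[ℂ] _).comp
    (ContinuousLinearMap.pi (Fin.insertNth (α := fun _ => N →L[ℂ] ℂ) j (b 0) fun i => b i.succ)),
    fun k => ?_⟩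
  ext v
  refine Fin.cases ?_ (fun i => ?_) k
  · change Fin.insertNth (α := fun _ => N →L[ℂ] ℂ) j (b 0) (fun i => b i.succ) j v = _
    rw [Fin.insertNth_apply_same]
  · change Fin.insertNth (α := fun _ => N →L[ℂ] ℂ) j (b 0) (fun i => b i.succ)
      (j.succAbove i) v = _
    rw [Fin.insertNth_apply_succAbove]

theorem fderiv_comp_symm_injective {P : Type*} [NormedAddCommGroup P] [NormedSpace ℂ P] {g : V → P}
    {W : Set V} (hg : ContMDiffOn 𝓘(ℂ, E) 𝓘(ℂ, P) ω g W) (hW : IsOpen W) {x : V} (hxW : x ∈ W)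
    (hinj : Function.Injective (mfderiv 𝓘(ℂ, E) 𝓘(ℂ, P) g x)) :
    Function.Injective (fderiv ℂ (g ∘ (chartAt E x).symm) (chartAt E x x)) := by
  have : IsManifold 𝓘(ℂ, E) 1 V := IsManifold.of_le (n := ω) le_top
  set c := chartAt E x with hcdef
  have hc : c ∈ atlas E V := chart_mem_atlas E x
  have hxc : x ∈ c.source := mem_chart_source E x
  have hy : c x ∈ c.target := c.map_source hxc
  have h1 : MDifferentiableAt 𝓘(ℂ, E) 𝓘(ℂ, P) g (c.symm (c x)) := by
    rw [c.left_inv hxc]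
    exact mdifferentiableAt_of_holomorphic hg hW hxW
  have h2 : MDifferentiableAt 𝓘(ℂ, E) 𝓘(ℂ, E) c.symm (c x) := mdifferentiableAt_atlas_symm hc hy
  have h3 := mfderiv_comp (c x) h1 h2
  rw [mfderiv_eq_fderiv] at h3
  have h4 : Function.Injective (mfderiv 𝓘(ℂ, E) 𝓘(ℂ, E) c.symm (c x)) :=
    (mdifferentiable_of_mem_atlas (I := 𝓘(ℂ, E)) hc).symm.mfderiv_injective hy
  have h5 : Function.Injective (mfderiv 𝓘(ℂ, E) 𝓘(ℂ, P) g (c.symm (c x))) := by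
    rw [c.left_inv hxc]
    exact hinj
  intro v w hvw
  refine h4 (h5 ?_)
  exact (DFunLike.congr_fun h3 v).symm.trans (hvw.trans (DFunLike.congr_fun h3 w))

/-- The support of a positive plurisuperharmonic current cannot be touched from outside by the
pullback of a ball by a holomorphic map. -/
theorem Current.notMem_support_of_touching [FiniteDimensional ℂ E] [T2Space V]
    [SecondCountableTopology V] {q N : ℕ} (T : Current E V (q + 1)) (hpos : IsPositive T.toFun)
    (hpsh : IsPlurisuperharmonic (q + 1) T) {U W : Set V} (hU : IsOpen U)
    (hUc : IsCompact (closure U)) (hW : IsOpen W) (hUW : closure U ⊆ W)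
    {f : V → EuclideanSpace ℂ (Fin (q + 1))} {g : V → EuclideanSpace ℂ (Fin N)}
    (hf : ContMDiffOn 𝓘(ℂ, E) 𝓘(ℂ, EuclideanSpace ℂ (Fin (q + 1))) ω f W)
    (hg : ContMDiffOn 𝓘(ℂ, E) 𝓘(ℂ, EuclideanSpace ℂ (Fin N)) ω g W) {x : V} (hxU : x ∈ U)
    (hinj : Function.Injective (mfderiv 𝓘(ℂ, E) 𝓘(ℂ, EuclideanSpace ℂ (Fin N)) g x))
    {a : EuclideanSpace ℂ (Fin (q + 1))} (ha : f x ≠ a)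
    (htouch : ∀ y ∈ T.support ∩ closure U, ‖f y - a‖ ≤ ‖f x - a‖ → y ∈ U ∧ f y = f x) :
    x ∉ T.support := by
  intro hxT
  have hxW : x ∈ W := hUW (subset_closure hxU)
  obtain ⟨j, hj⟩ : ∃ j, f x j ≠ a j := by
    by_contra! h
    exact ha (PiLp.ext h)
  set c := chartAt E x with hcdef
  have hc : c ∈ atlas E V := chart_mem_atlas E x
  have hxc : x ∈ c.source := mem_chart_source E x
  have hy : c x ∈ c.target ∩ c.symm ⁻¹' W :=
    ⟨c.map_source hxc, by rwa [Set.mem_preimage, c.left_inv hxc]⟩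
  have hdiff : ∀ {P : Type} [NormedAddCommGroup P] [NormedSpace ℂ P] {F : V → P},
      ContMDiffOn 𝓘(ℂ, E) 𝓘(ℂ, P) ω F W → DifferentiableAt ℂ (F ∘ c.symm) (c x) := fun hF =>
    ((contDiffOn_holomorphic_comp_symm hF hc).contDiffAt
      ((c.isOpen_inter_preimage_symm hW).mem_nhds hy)).differentiableAt (by simp)
  -- This is where the immersion enters: every covector at x factors through the differential of g,
  -- by means of the left inverse L.
  obtain ⟨L, hL⟩ := (fderiv ℂ (g ∘ c.symm) (c x)).toLinearMap.exists_leftInverse_of_injective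
    (LinearMap.ker_eq_bot.2 (fderiv_comp_symm_injective hg hW hxW hinj))
  have hL' : ∀ v, L (fderiv ℂ (g ∘ c.symm) (c x) v) = v := fun v => LinearMap.congr_fun hL v
  set s : Set (Fin (q + 1) → E →L[ℂ] ℂ) := {α | ∃ F : V → EuclideanSpace ℂ (Fin (q + 1)),
    ContMDiffOn 𝓘(ℂ, E) 𝓘(ℂ, EuclideanSpace ℂ (Fin (q + 1))) ω F W ∧
      T.VanishesNear F (elemForm (frontForms j)) x ∧
      α = fun k => (frontForms j k).comp (fderiv ℂ (F ∘ c.symm) (c x))} with hs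
  have hnear : ∀ b : Fin (q + 1) → E →L[ℂ] ℂ, ∀ᶠ t : ℝ in 𝓝[>] 0,
      (fun k => (frontForms j k).comp (fderiv ℂ (f ∘ c.symm) (c x)) + (t : ℂ) • b k) ∈ s := by
    intro b
    -- With this A, the map A(g - g(x)) vanishes at x and its differential there has components b.
    -- The perturbation thus moves the covectors of f at x in the direction b.
    obtain ⟨A, hA⟩ := exists_frontForms_comp j fun k => (b k).comp L.toContinuousLinearMap
    set H : V → EuclideanSpace ℂ (Fin (q + 1)) := fun y => A (g y - g x) with hHdef
    have hH : ContMDiffOn 𝓘(ℂ, E) 𝓘(ℂ, EuclideanSpace ℂ (Fin (q + 1))) ω H W := fun y hy =>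
      ((A.contDiff.comp (contDiff_id.sub contDiff_const)).contMDiff.contMDiffAt
        (x := g y)).comp_contMDiffWithinAt y (hg y hy)
    have hH' : HasFDerivAt (H ∘ c.symm) (A.comp (fderiv ℂ (g ∘ c.symm) (c x))) (c x) :=
      A.hasFDerivAt.comp (c x) ((hdiff hg).hasFDerivAt.sub_const (g x))
    have hev := T.eventually_vanishesNear hpos hpsh hU hUc hW hUW hf hH hxT hxU
      (by simp [hHdef]) hj htouch
    refine (hev.filter_mono nhdsWithin_le_nhds).mono fun t ht => ?_
    refine ⟨_, ?_, ht, ?_⟩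
    · exact hf.add fun y hy =>
        ((contDiff_const_smul (t : ℂ)).contMDiff.contMDiffAt).comp_contMDiffWithinAt y (hH y hy)
    · have h1 : HasFDerivAt ((fun y => f y + (t : ℂ) • H y) ∘ c.symm)
          (fderiv ℂ (f ∘ c.symm) (c x) + (t : ℂ) • A.comp (fderiv ℂ (g ∘ c.symm) (c x))) (c x) :=
        (hdiff hf).hasFDerivAt.add (hH'.const_smul (t : ℂ))
      funext k
      rw [h1.fderiv, ContinuousLinearMap.comp_add, ContinuousLinearMap.comp_smul,
        ← ContinuousLinearMap.comp_assoc, hA]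
      congr 2
      ext v
      exact congrArg (b k) (hL' v).symm
  refine T.notMem_support_of_span hW (elemForm_hasBidegree (frontForms j)) hxW (s := elemForm '' s)
    ?_ (fun α hα => mem_span_elemForm_near _ hnear hα) hxT
  rintro _ ⟨_, ⟨F, hF, hFT, rfl⟩, rfl⟩
  refine ⟨F, hF, hFT, ?_⟩
  rw [(hdiff hF).fderiv_restrictScalars ℝ, elemForm_comp]

/-- The support of a positive plurisuperharmonic current is pseudoconcave in the open sets which
admit a holomorphic immersion. -/
theorem Current.isPseudoconcaveIn_support [FiniteDimensional ℂ E] [T2Space V]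
    [SecondCountableTopology V] {q : ℕ} (T : Current E V (q + 1)) (hpos : IsPositive T.toFun)
    (hpsh : IsPlurisuperharmonic (q + 1) T) {W : Set V} (hW : HasHolomorphicImmersion E W) :
    IsPseudoconcaveIn E (q + 1) T.support W := by
  obtain ⟨N, g, hg, hinj⟩ := hW
  rintro U hU hUc - W' hW' hUW' hW'W f hf _ ⟨z, ⟨hzT, hzU⟩, rfl⟩ hmem
  have hfc : ContinuousOn f (closure U) := hf.continuousOn.mono hUW'
  have hK : IsCompact (f '' (T.support ∩ closure U)) :=
    (hUc.inter_left T.isClosed_support).image_of_continuousOn (hfc.mono Set.inter_subset_right)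
  have hK' : IsCompact (f '' (T.support ∩ frontier U)) :=
    ((hUc.of_isClosed_subset isClosed_frontier frontier_subset_closure).inter_left
      T.isClosed_support).image_of_continuousOn
        (hfc.mono (Set.inter_subset_right.trans frontier_subset_closure))
  obtain ⟨a, _, ⟨x, hx, rfl⟩, hcK', hac, htouch⟩ :=
    exists_touching_ball hK hK' ⟨z, ⟨hzT, subset_closure hzU⟩, rfl⟩ hmem
  -- The touching point avoids the image of the support over the frontier, so its whole fibre in the
  -- support lies in U.
  have hmemU : ∀ y ∈ T.support ∩ closure U, f y = f x → y ∈ U := by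
    intro y hy hyx
    by_contra hyU
    refine hcK' ⟨y, ⟨hy.1, ?_⟩, hyx⟩
    rw [hU.frontier_eq]
    exact ⟨hy.2, hyU⟩
  have hxU := hmemU x hx rfl
  refine T.notMem_support_of_touching hpos hpsh hU hUc hW' hUW' hf (hg.mono hW'W) hxU
    (hinj x (hW'W (hUW' hx.2))) hac.symm (fun y hy hle => ?_) hx.1
  have hyx := htouch (f y) ⟨y, hy, rfl⟩ hle
  exact ⟨hmemU y hy hyx, hyx⟩

end Final

end ComplexCurrents

end

theorem proposition1 {E : Type*} [NormedAddCommGroup E] [NormedSpace ℂ E] [FiniteDimensional ℂ E]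
    {V : Type*} [TopologicalSpace V] [T2Space V] [SecondCountableTopology V]
    [ChartedSpace E V] [IsManifold 𝓘(ℂ, E) ω V]
    (p : ℕ) (hp : 1 ≤ p) (hpn : p < Module.finrank ℂ E)
    (T : ComplexCurrents.Current E V p)
    (hpos : ComplexCurrents.IsPositive T.toFun)
    (hpsh : ComplexCurrents.IsPlurisuperharmonic p T) :
    IsClosed T.support ∧
      ∀ W : Set V, IsOpen W → ComplexCurrents.HasHolomorphicImmersion E W →
        ComplexCurrents.IsPseudoconcaveIn E p T.support W := by
  -- Writing p = q + 1 makes ddᶜ of test forms of bidegree (q, q) available; for p = 0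
  -- plurisuperharmonicity carries no condition.
  obtain ⟨q, rfl⟩ := Nat.exists_eq_add_of_le' hp
  exact ⟨T.isClosed_support, fun W _ hW => T.isPseudoconcaveIn_support hpos hpsh hW⟩
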